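/- **Model.** Work in the applied $\pi$-calculus with events and ProVerif-style tables (which the attacker can neither read nor write), with $n$-tuples and with the equational theory generated by $\mathrm{decrypt}(\mathrm{encrypt}(m,\mathrm{pk}(k),r),k)=m$, $\mathrm{getmess}(\mathrm{sign}(m,k))=m$, $\mathrm{checksign}(\mathrm{sign}(m,k),\mathrm{spk}(k))=m$, $\exp(\exp(\exp(g,x),y),z)=\exp(\exp(\exp(g,y),z),x)$, $\mathrm{zkpsec}(\mathrm{zkp}(v,e_2),v)=\mathrm{true}$ and $\mathrm{zkpsec}_2(\mathrm{zkp}_2(u,v,e_2),u,v)=\mathrm{true}$ for $u=\exp(g,e_1)$, $v=\exp(u,e_2)$, and $\mathrm{checkproof}(\mathrm{xproof}(p,p',t,\exp(t,e),e),p,p',t,\exp(t,e))=\mathrm{true}$. A free hash function $H$ is available. All principals are honest; the attacker controls the public channel, on which senders and receivers are anonymous. **The original Huszti–Pethő protocol.** All messages go over the public channel. (i) The question committee publishes the signed question. (ii) The exam authority (EA), which is also the collector, draws $s$ and publishes $h=g^s$ with its signature; it receives a question with a signature. It then registers any number of examiners and candidates. (iii) A candidate draws a key $k$ and publishes $g^k$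 with its identity. To register it, the EA publishes the partial pseudonym $\tilde p=(g^{k})^s$. On receipt of any message $\tilde p$ the timed-release service (NET) draws $\rho$, emits $\mathtt{registered}(p')$ with $p'=\tilde p^{\rho}$, and publishes $p'$ and $r=g^\rho$. The candidate (who obtains $\tilde p$, and the triple $(\tilde p,r,p')$, from tables) computes $p=r^{k}$ and sends $(p,p')$; the EA answers any received pair $(p,p')$ with $\mathrm{xproof}(p,p',g,h,s)$, which the candidate checks. (iv) An examiner with key $k_E$ and fresh $\alpha$ obtains in the same way from the EA the partial pseudonym $\tilde q=(g^{k_E})^s$ and a proof for $(q,q')$, where $q'=\tilde q^{\alpha}$, $t=g^\alpha$, $q=t^{k_E}$; the examiner is then listed under $(t,q)$ for exam $h$. (v) The candidate sends $(r,p,p')$ and a proof of knowledge of $k$; the EA checks $p^s=p'$, the proof, and the signature on the question, and sends the question. The candidate checks the signature, emits $\mathtt{submitted}(p',h,\mathit{quest},\mathit{ans})$, and sends $(r,p,\mathit{ans})$. The EA emits $\mathtt{collected}(p',h,\mathit{quest},\mathit{ans})$ and returns the receipt, a hash of the data of the submission, which the candidate compares with its own data. (vi) The EA chooses an examiner $(t,q)$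 listed for $h$ and a fresh test identifier $\mathit{eap}$, emits $\mathtt{distributed}(p',h,\mathit{quest},\mathit{ans},\mathit{eap},q)$ and sends $(\mathit{eap},\mathit{ans})$. The examiner, after receiving the signed question and a pair $(\mathit{eap},\mathit{ans})$, chooses a mark, emits $\mathtt{marked}(\mathit{quest},\mathit{ans},\mathit{mark},\mathit{eap},q,h)$, and sends the mark, $H(\mathit{mark},\mathit{ans})$, $H(\mathit{mark},\mathit{ans})^{k_E}$ and a proof that the exponent is that of $q$ to the base $t$. (vii) The EA checks the proof, sends $p'$ to the NET, receives $(p',\tilde p)$, and stores the mark for the candidate with partial pseudonym $\tilde p$. The candidate reads the mark from the EA's table, checks its hash and proof, and emits $\mathtt{notified}(p',h,\mathit{mark})$. **The modified protocol** differs as follows. (1) The EA sends $\tilde p$ to the NET over a private channel. (2) The NET sends the eligible pseudonym $p'$ back to the EA over a private channel; the EA issues its proof to the candidate, and accepts a test, for this $p'$ only. (3) The EA signs the distributed test (its identifier, exam, question, answer, and the chosen examiner $q$), and the examiner marks only a test with a valid signature. (4) The identifier $\mathit{eap}$ is added to the receipt of submission, which also names the exam $h$ and is now signed by the EA and checked by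 the candidate, and to the receipt of marking, now $H(\mathit{mark},\mathit{ans},\mathit{eap})$. **Exam processes.** An exam instance is the parallel composition, under the restricted names, of finitely many candidates with their answers, finitely many examiners with their markings (all identities being distinct), the committee with its question, the collector with an assignment of tests to examiners, and the NET. The exam processes of a protocol are all its instances and the process with unboundedly many exams, candidates and examiners with fresh data. The EA and the NET are replicated. **Requirements.** A protocol satisfies an authentication requirement if, for every exam process, the following holds on every execution trace with an arbitrary attacker. ($\leadsto\mathit{inj}$ means that each occurrence of the left event has a distinct earlier occurrence of the right one; with two events on the right, both are required. Variables that occur only on the right are existential, and common to the two events.) - Candidate Authorisation: $\mathtt{submitted}(c,h,q,a)\leadsto \mathit{inj}\ \mathtt{registered}(c)$. - Answer Authenticity: $\mathtt{collected}(c,h,q,a)\leadsto \mathit{inj}\ \mathtt{submitted}(c,h,q,a)$. - Test Origin Authentication: $\mathtt{collected}(c,h,q,a)\leadsto \mathit{inj}\ \mathtt{registered}(c)$. - Test Authenticity: $\mathtt{marked}(q,a,m,t,x,h)\leadsto \mathit{inj}\ \mathtt{collected}(c,h,q,a)$ and $\mathit{inj}\ \mathtt{distributed}(c,h,q,a,t,x)$.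 - Mark Authenticity: $\mathtt{notified}(c,h,m)\leadsto \mathit{inj}\ \mathtt{distributed}(c,h,q,a,t,x)$ and $\mathit{inj}\ \mathtt{marked}(q,a,m,t,x,h)$. It satisfies a privacy requirement if the following two processes are always labelled bisimilar. - Question Indistinguishability: two exam instances, cut off after the event $\mathtt{registered}$, that differ only in the question. - Anonymous Marking: two instances, cut off after the event $\mathtt{marked}$, that differ in that two candidates swap their answers. - Anonymous Examiner: two instances in which the tests of two candidates are assigned to two examiners; the assignment and the marks of the two examiners are swapped in the second one. - Mark Privacy: two instances that differ only in the mark that one examiner gives. - Mark Anonymity: two instances in which the tests of two candidates with different answers are assigned to the same examiner, who swaps the marks of the two answers in the second one. **Theorem.** (a) The original Huszti–Pethő protocol satisfies Candidate Authorisation, and it violates Answer Authenticity, Test Origin Authentication, Test Authenticity, Mark Authenticity, Question Indistinguishability, Anonymous Marking, Anonymous Examiner, Mark Privacy and Mark Anonymity. (b) The modified protocol satisfies Candidate Authorisation, Test Origin Authentication, Test Authenticity and Mark Authenticity, and it violates Answer Authenticity. -/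

import Mathlib

namespace ExamPi

/-! ## Terms and the equational theory -/

/-- Terms. `pub n` are the public names (known to the attacker; these are also the free names of a
process), `priv n` the restricted names created by `ν`, and `var i` is the variable of the `i`-th
message that was output to the environment (it occurs in attacker recipes only). -/
inductive Term : Type
  | var (i : ℕ)
  | pub (n : ℕ)
  | priv (n : ℕ)
  | g | gC | gE | tt | unit
  | pair (a b : Term)
  | fst (a : Term)
  | snd (a : Term)
  | hash (a : Term)
  | pk (k : Term)
  | encrypt (m k r : Term)
  | decrypt (m k : Term)
  | spk (k : Term)
  | sign (m k : Term)
  | getmess (m : Term)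
  | checksign (m k : Term)
  | exp (a b : Term)
  | zkpProof (a b : Term)
  | zkpsec (a b : Term)
  | zkpProof2 (a b c : Term)
  | zkpsec2 (a b c : Term)
  | xproof (a b c d e : Term)
  | checkproof (a b c d e : Term)

namespace Term

/-- Equality of terms modulo the equational theory: the least congruence that contains the
equations for pairs, ElGamal encryption, signatures, zero-knowledge proofs of knowledge,
Diffie-Hellman exponentiation, and zero-knowledge proofs of equality of discrete logarithms. -/
inductive Eqv : Term → Term → Prop
  | refl (a : Term) : Eqv a a
  | symm {a b : Term} : Eqv a b → Eqv b a
  | trans {a b c : Term} : Eqv a b → Eqv b c → Eqv a c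
  -- congruence
  | pair {a a' b b' : Term} : Eqv a a' → Eqv b b' → Eqv (.pair a b) (.pair a' b')
  | fst {a a' : Term} : Eqv a a' → Eqv (.fst a) (.fst a')
  | snd {a a' : Term} : Eqv a a' → Eqv (.snd a) (.snd a')
  | hash {a a' : Term} : Eqv a a' → Eqv (.hash a) (.hash a')
  | pk {a a' : Term} : Eqv a a' → Eqv (.pk a) (.pk a')
  | encrypt {a a' b b' c c' : Term} : Eqv a a' → Eqv b b' → Eqv c c' →
      Eqv (.encrypt a b c) (.encrypt a' b' c')
  | decrypt {a a' b b' : Term} : Eqv a a' → Eqv b b' → Eqv (.decrypt a b) (.decrypt a' b')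
  | spk {a a' : Term} : Eqv a a' → Eqv (.spk a) (.spk a')
  | sign {a a' b b' : Term} : Eqv a a' → Eqv b b' → Eqv (.sign a b) (.sign a' b')
  | getmess {a a' : Term} : Eqv a a' → Eqv (.getmess a) (.getmess a')
  | checksign {a a' b b' : Term} : Eqv a a' → Eqv b b' →
      Eqv (.checksign a b) (.checksign a' b')
  | exp {a a' b b' : Term} : Eqv a a' → Eqv b b' → Eqv (.exp a b) (.exp a' b')
  | zkpProof {a a' b b' : Term} : Eqv a a' → Eqv b b' → Eqv (.zkpProof a b) (.zkpProof a' b')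
  | zkpsec {a a' b b' : Term} : Eqv a a' → Eqv b b' → Eqv (.zkpsec a b) (.zkpsec a' b')
  | zkpProof2 {a a' b b' c c' : Term} : Eqv a a' → Eqv b b' → Eqv c c' →
      Eqv (.zkpProof2 a b c) (.zkpProof2 a' b' c')
  | zkpsec2 {a a' b b' c c' : Term} : Eqv a a' → Eqv b b' → Eqv c c' →
      Eqv (.zkpsec2 a b c) (.zkpsec2 a' b' c')
  | xproof {a a' b b' c c' d d' e e' : Term} :
      Eqv a a' → Eqv b b' → Eqv c c' → Eqv d d' → Eqv e e' →
      Eqv (.xproof a b c d e) (.xproof a' b' c' d' e')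
  | checkproof {a a' b b' c c' d d' e e' : Term} :
      Eqv a a' → Eqv b b' → Eqv c c' → Eqv d d' → Eqv e e' →
      Eqv (.checkproof a b c d e) (.checkproof a' b' c' d' e')
  -- equations
  | fst_pair (a b : Term) : Eqv (.fst (.pair a b)) a
  | snd_pair (a b : Term) : Eqv (.snd (.pair a b)) b
  | decrypt_encrypt (m k r : Term) : Eqv (.decrypt (.encrypt m (.pk k) r) k) m
  | getmess_sign (m k : Term) : Eqv (.getmess (.sign m k)) m
  | checksign_sign (m k : Term) : Eqv (.checksign (.sign m k) (.spk k)) m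
  | exp_rotate (x y z : Term) :
      Eqv (.exp (.exp (.exp .g x) y) z) (.exp (.exp (.exp .g y) z) x)
  | zkpsec_proof (e₁ e₂ : Term) :
      Eqv (.zkpsec (.zkpProof (.exp (.exp .g e₁) e₂) e₂) (.exp (.exp .g e₁) e₂)) .tt
  | zkpsec2_proof (e₁ e₂ : Term) :
      Eqv (.zkpsec2 (.zkpProof2 (.exp .g e₁) (.exp (.exp .g e₁) e₂) e₂)
        (.exp .g e₁) (.exp (.exp .g e₁) e₂)) .tt
  | checkproof_xproof (p p' t e : Term) :
      Eqv (.checkproof (.xproof p p' t (.exp t e) e) p p' t (.exp t e)) .tt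

infix:50 " ≈ₑ " => Term.Eqv

/-- The `n`-tuple of a list of `n` terms. -/
def tup : List Term → Term
  | [] => .unit
  | a :: l => .pair a (tup l)

/-- The `i`-th component (from `0`) of a tuple. -/
def proj : ℕ → Term → Term
  | 0, a => .fst a
  | i + 1, a => proj i (.snd a)

/-- Instantiation of the frame variables of a recipe by the messages of a frame. -/
def subst (φ : List Term) : Term → Term
  | var i => φ.getD i (.var i)
  | pub n => .pub n
  | priv n => .priv n
  | g => .g
  | gC => .gC
  | gE => .gE
  | tt => .tt
  | unit => .unit
  | pair a b => .pair (a.subst φ) (b.subst φ)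
  | fst a => .fst (a.subst φ)
  | snd a => .snd (a.subst φ)
  | hash a => .hash (a.subst φ)
  | pk a => .pk (a.subst φ)
  | encrypt a b c => .encrypt (a.subst φ) (b.subst φ) (c.subst φ)
  | decrypt a b => .decrypt (a.subst φ) (b.subst φ)
  | spk a => .spk (a.subst φ)
  | sign a b => .sign (a.subst φ) (b.subst φ)
  | getmess a => .getmess (a.subst φ)
  | checksign a b => .checksign (a.subst φ) (b.subst φ)
  | exp a b => .exp (a.subst φ) (b.subst φ)
  | zkpProof a b => .zkpProof (a.subst φ) (b.subst φ)
  | zkpsec a b => .zkpsec (a.subst φ) (b.subst φ)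
  | zkpProof2 a b c => .zkpProof2 (a.subst φ) (b.subst φ) (c.subst φ)
  | zkpsec2 a b c => .zkpsec2 (a.subst φ) (b.subst φ) (c.subst φ)
  | xproof a b c d e => .xproof (a.subst φ) (b.subst φ) (c.subst φ) (d.subst φ) (e.subst φ)
  | checkproof a b c d e =>
      .checkproof (a.subst φ) (b.subst φ) (c.subst φ) (d.subst φ) (e.subst φ)

/-- A recipe over a frame with `n` messages: a term whose variables are among the `n` frame
variables and that contains no restricted name. -/
def IsRecipe (n : ℕ) : Term → Prop
  | var i => i < n
  | priv _ => False
  | pub _ | g | gC | gE | tt | unit => True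
  | fst a | snd a | hash a | pk a | spk a | getmess a => a.IsRecipe n
  | pair a b | decrypt a b | sign a b | checksign a b | exp a b | zkpProof a b | zkpsec a b =>
      a.IsRecipe n ∧ b.IsRecipe n
  | encrypt a b c | zkpProof2 a b c | zkpsec2 a b c =>
      a.IsRecipe n ∧ b.IsRecipe n ∧ c.IsRecipe n
  | xproof a b c d e | checkproof a b c d e =>
      a.IsRecipe n ∧ b.IsRecipe n ∧ c.IsRecipe n ∧ d.IsRecipe n ∧ e.IsRecipe n

end Term

open Term

/-! ## Plain processes, with events and tables -/

/-- The events of an exam. The arguments are: pseudonym `c` of the candidate, exam `h`, question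
`q`, answer `a`, test identifier `t`, examiner `x` (by pseudonym), and mark `m`. -/
inductive Event : Type
  | registered (c : Term)
  | submitted (c h q a : Term)
  | collected (c h q a : Term)
  | distributed (c h q a t x : Term)
  | marked (q a m t x h : Term)
  | notified (c h m : Term)

/-- Equality of events modulo the equational theory. -/
def Event.Eqv : Event → Event → Prop
  | .registered c, .registered c' => c ≈ₑ c'
  | .submitted c h q a, .submitted c' h' q' a' => c ≈ₑ c' ∧ h ≈ₑ h' ∧ q ≈ₑ q' ∧ a ≈ₑ a'
  | .collected c h q a, .collected c' h' q' a' => c ≈ₑ c' ∧ h ≈ₑ h' ∧ q ≈ₑ q' ∧ a ≈ₑ a'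
  | .distributed c h q a t x, .distributed c' h' q' a' t' x' =>
      c ≈ₑ c' ∧ h ≈ₑ h' ∧ q ≈ₑ q' ∧ a ≈ₑ a' ∧ t ≈ₑ t' ∧ x ≈ₑ x'
  | .marked q a m t x h, .marked q' a' m' t' x' h' =>
      q ≈ₑ q' ∧ a ≈ₑ a' ∧ m ≈ₑ m' ∧ t ≈ₑ t' ∧ x ≈ₑ x' ∧ h ≈ₑ h'
  | .notified c h m, .notified c' h' m' => c ≈ₑ c' ∧ h ≈ₑ h' ∧ m ≈ₑ m'
  | _, _ => False

/-- Is this the event `registered`? -/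
def Event.isRegistered : Event → Bool
  | .registered _ => true
  | _ => false

/-- Is this the event `marked`? -/
def Event.isMarked : Event → Bool
  | .marked .. => true
  | _ => false

/-- Channels: public ones, controlled by the attacker, and restricted (private) ones. -/
inductive Chan : Type
  | pub (n : ℕ)
  | priv (n : ℕ)

/-- The tables of the model; the attacker has no access to them. The table `owner` records which
pseudonym belongs to which candidate; it is read only to evaluate an assignment of candidates'
tests to examiners. -/
inductive Table : Type
  | keys | zkpeq | zkpeqnet | regCand | examiner | marks | owner

/-- Plain processes. Binders are functions. In `get tb pats P Q` a pattern is a list in which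
`some M` stands for a component that has to equal `M` and `none` for one that is bound. -/
inductive Proc : Type
  | nil
  | par (P Q : Proc)
  | repl (P : Proc)
  | new (P : Term → Proc)
  | newChan (P : Chan → Proc)
  | ite (M N : Term) (P Q : Proc)
  | inp (u : Chan) (P : Term → Proc)
  | out (u : Chan) (M : Term) (P : Proc)
  | event (e : Event) (P : Proc)
  | insert (tb : Table) (Ms : List Term) (P : Proc)
  | get (tb : Table) (pats : List (Option Term)) (P : List Term → Proc) (Q : Proc)

namespace Proc

/-- Parallel composition of a list of processes. -/
def parList : List Proc → Proc
  | [] => nil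
  | P :: L => par P (parList L)

/-- The process pruned of the code that follows the events selected by `cut`. -/
def prune (cut : Event → Bool) : Proc → Proc
  | nil => nil
  | par P Q => par (P.prune cut) (Q.prune cut)
  | repl P => repl (P.prune cut)
  | new P => new fun n => (P n).prune cut
  | newChan P => newChan fun n => (P n).prune cut
  | ite M N P Q => ite M N (P.prune cut) (Q.prune cut)
  | inp u P => inp u fun x => (P x).prune cut
  | out u M P => out u M (P.prune cut)
  | event e P => event e (if cut e then nil else P.prune cut)
  | insert tb Ms P => insert tb Ms (P.prune cut)
  | get tb pats P Q => get tb pats (fun Ms => (P Ms).prune cut) (Q.prune cut)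

/-- `if M = N then P`. -/
def cond (M N : Term) (P : Proc) : Proc := ite M N P nil

/-- Input of a message that must be a tuple of the shape given by the pattern: `none` binds a
component, `some M` requires the component to equal `M`. -/
def recv (u : Chan) (pats : List (Option Term)) (P : (ℕ → Term) → Proc) : Proc :=
  inp u fun x =>
    cond x (tup (pats.mapIdx fun i p => p.getD (proj i x))) (P fun i => proj i x)

/-- Lookup of a table entry that matches a pattern, without an `else` branch. -/
def lookup (tb : Table) (pats : List (Option Term)) (P : (ℕ → Term) → Proc) : Proc :=
  get tb pats (fun Ms => P fun i => Ms.getD i .unit) nil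

end Proc

open Proc

/-! ## Operational semantics -/

/-- An extended process in the form `ν ñ.(σ | P₁ | ... | Pₖ)`: the restricted names created so
far, the contents of the tables, the active substitution (a frame: the list of the messages output
so far) and the plain processes running in parallel. -/
structure Config : Type where
  used : Finset ℕ
  tables : Table → Set (List Term)
  frame : List Term
  procs : Multiset Proc

/-- The initial extended process for a closed plain process. -/
def Config.init (P : Proc) : Config := ⟨∅, fun _ => ∅, [], {P}⟩

/-- Labels. `inp n M` is the input of the message with recipe `M` on the public channel `n`, and
`out n` is the output, on the public channel `n`, of a message that extends the frame by a new
variable. Internal steps are `tau` and `event`. -/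
inductive Label : Type
  | tau
  | event (e : Event)
  | inp (n : ℕ) (M : Term)
  | out (n : ℕ)

/-- A table entry matches a pattern. -/
def Matches (pats : List (Option Term)) (Ms : List Term) : Prop :=
  List.Forall₂ (fun p M => ∀ N, p = some N → N ≈ₑ M) pats Ms

open Classical in
/-- Adding an entry to a table. -/
noncomputable def addEntry (T : Table → Set (List Term)) (tb : Table) (Ms : List Term) :
    Table → Set (List Term) :=
  fun tb' => if tb' = tb then {Ms} ∪ T tb' else T tb'

/-- The labelled transitions of extended processes. -/
inductive Step : Config → Label → Config → Prop
  | nil {u T φ S} : Step ⟨u, T, φ, Proc.nil ::ₘ S⟩ .tau ⟨u, T, φ, S⟩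
  | par {u T φ S P Q} : Step ⟨u, T, φ, .par P Q ::ₘ S⟩ .tau ⟨u, T, φ, P ::ₘ Q ::ₘ S⟩
  | repl {u T φ S P} : Step ⟨u, T, φ, .repl P ::ₘ S⟩ .tau ⟨u, T, φ, P ::ₘ .repl P ::ₘ S⟩
  | new {u T φ S P} (n : ℕ) : n ∉ u →
      Step ⟨u, T, φ, .new P ::ₘ S⟩ .tau ⟨insert n u, T, φ, P (.priv n) ::ₘ S⟩
  | newChan {u T φ S P} (n : ℕ) : n ∉ u →
      Step ⟨u, T, φ, .newChan P ::ₘ S⟩ .tau ⟨insert n u, T, φ, P (.priv n) ::ₘ S⟩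
  | iteTrue {u T φ S M N P Q} : M ≈ₑ N →
      Step ⟨u, T, φ, .ite M N P Q ::ₘ S⟩ .tau ⟨u, T, φ, P ::ₘ S⟩
  | iteFalse {u T φ S M N P Q} : ¬ M ≈ₑ N →
      Step ⟨u, T, φ, .ite M N P Q ::ₘ S⟩ .tau ⟨u, T, φ, Q ::ₘ S⟩
  | comm {u T φ S ch M P Q} :
      Step ⟨u, T, φ, .out ch M P ::ₘ .inp ch Q ::ₘ S⟩ .tau ⟨u, T, φ, P ::ₘ Q M ::ₘ S⟩
  | insert {u T φ S tb Ms P} :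
      Step ⟨u, T, φ, .insert tb Ms P ::ₘ S⟩ .tau ⟨u, addEntry T tb Ms, φ, P ::ₘ S⟩
  | getSome {u T φ S tb pats P Q} (Ms : List Term) : Ms ∈ T tb → Matches pats Ms →
      Step ⟨u, T, φ, .get tb pats P Q ::ₘ S⟩ .tau ⟨u, T, φ, P Ms ::ₘ S⟩
  | getNone {u T φ S tb pats P Q} : (∀ Ms ∈ T tb, ¬ Matches pats Ms) →
      Step ⟨u, T, φ, .get tb pats P Q ::ₘ S⟩ .tau ⟨u, T, φ, Q ::ₘ S⟩
  | event {u T φ S e P} : Step ⟨u, T, φ, .event e P ::ₘ S⟩ (.event e) ⟨u, T, φ, P ::ₘ S⟩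
  | inp {u T φ S P} (n : ℕ) (M : Term) : M.IsRecipe φ.length →
      Step ⟨u, T, φ, .inp (.pub n) P ::ₘ S⟩ (.inp n M) ⟨u, T, φ, P (M.subst φ) ::ₘ S⟩
  | out {u T φ S M P} (n : ℕ) :
      Step ⟨u, T, φ, .out (.pub n) M P ::ₘ S⟩ (.out n) ⟨u, T, φ ++ [M], P ::ₘ S⟩

/-- `Exec A es B`: there is an execution from `A` to `B`, in interaction with an arbitrary
environment, whose sequence of events is `es`. -/
inductive Exec : Config → List Event → Config → Prop
  | refl (A : Config) : Exec A [] A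
  | tau {A B C es} : Exec A es B → Step B .tau C → Exec A es C
  | inp {A B C es n M} : Exec A es B → Step B (.inp n M) C → Exec A es C
  | out {A B C es n} : Exec A es B → Step B (.out n) C → Exec A es C
  | event {A B C es e} : Exec A es B → Step B (.event e) C → Exec A (es ++ [e]) C

/-! ## Correspondence assertions -/

/-- Injective correspondence on a trace: the occurrences of events in `L` can be sent, injectively,
to earlier occurrences of events that are related to them by `R`. -/
def InjCorr (es : List Event) (L : Event → Prop) (R : Event → Event → Prop) : Prop :=
  ∃ f : ℕ → ℕ,
    Set.InjOn f {i | ∃ e, es[i]? = some e ∧ L e} ∧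
    ∀ i e, es[i]? = some e → L e → f i < i ∧ ∃ e', es[f i]? = some e' ∧ R e e'

/-- Injective correspondence with two events on the right-hand side: both have to have occurred
earlier, each of them in a distinct occurrence for each occurrence of the left-hand side. -/
def InjCorr₂ (es : List Event) (L : Event → Prop) (R : Event → Event → Event → Prop) : Prop :=
  ∃ f₁ f₂ : ℕ → ℕ,
    Set.InjOn f₁ {i | ∃ e, es[i]? = some e ∧ L e} ∧
    Set.InjOn f₂ {i | ∃ e, es[i]? = some e ∧ L e} ∧
    ∀ i e, es[i]? = some e → L e →
      f₁ i < i ∧ f₂ i < i ∧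
      ∃ e₁ e₂, es[f₁ i]? = some e₁ ∧ es[f₂ i]? = some e₂ ∧ R e e₁ e₂

/-! ## Labelled bisimilarity -/

/-- Static equivalence of frames. -/
def StaticEquiv (φ ψ : List Term) : Prop :=
  φ.length = ψ.length ∧
    ∀ M N : Term, M.IsRecipe φ.length → N.IsRecipe φ.length →
      (M.subst φ ≈ₑ N.subst φ ↔ M.subst ψ ≈ₑ N.subst ψ)

/-- Internal reduction; events are not visible to the environment. -/
def Internal (A B : Config) : Prop := Step A .tau B ∨ ∃ e, Step A (.event e) B

/-- Reflexive and transitive closure of internal reduction. -/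
def Internals : Config → Config → Prop := Relation.ReflTransGen Internal

/-- The labels that are visible to the environment. -/
def Label.Visible : Label → Prop
  | .inp _ _ | .out _ => True
  | .tau | .event _ => False

/-- Labelled bisimulations. -/
structure IsBisimulation (R : Config → Config → Prop) : Prop where
  symm : ∀ A B, R A B → R B A
  static : ∀ A B, R A B → StaticEquiv A.frame B.frame
  internal : ∀ A B A', R A B → Internals A A' → ∃ B', Internals B B' ∧ R A' B'
  labelled : ∀ A B A' α, R A B → α.Visible → Step A α A' →
    ∃ B₁ B₂ B', Internals B B₁ ∧ Step B₁ α B₂ ∧ Internals B₂ B' ∧ R A' B'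

/-- Labelled bisimilarity of closed plain processes. -/
def Bisimilar (P Q : Proc) : Prop :=
  ∃ R, IsBisimulation R ∧ R (Config.init P) (Config.init Q)

/-! ## Exam protocols, exam instances and the requirements -/

/-- The restricted names of an exam: the signing keys of the exam authority and of the question
committee, and two private channels between the exam authority (EA) and the timed-release
service (NET). -/
structure Env : Type where
  sskEA : Term
  sskCom : Term
  chEN : Chan
  chNE : Chan

/-- How an examiner marks: the first listed mark for the answer if there is one, and the default
mark otherwise. -/
structure Marking : Type where
  special : List (Term × Term)
  default : Term

/-- The marking that gives the same mark to every answer. -/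
def Marking.const (m : Term) : Marking := ⟨[], m⟩

/-- An exam protocol: the processes of the candidate (with identity and answer), the examiner
(with identity and marking), the question committee (with the question), the collector (with the
assignment of tests, by candidate identity, to examiner identities; a test that is not
assigned may go to any examiner), and the remaining authorities. -/
structure ExamProtocol : Type where
  candidate : Env → Term → Term → Proc
  examiner : Env → Term → Marking → Proc
  committee : Env → Term → Proc
  collector : Env → List (Term × Term) → Proc
  authorities : Env → Proc

/-- The public channel. -/
def pubc : Chan := .pub 0

/-- Creation of the restricted names of an exam and publication of the verification keys. -/
def setup (P : Env → Proc) : Proc :=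
  .new fun sskEA => .out pubc (.spk sskEA) <|
  .new fun sskCom => .out pubc (.spk sskCom) <|
  .newChan fun chEN => .newChan fun chNE => P ⟨sskEA, sskCom, chEN, chNE⟩

/-- The data of an exam instance: the candidates with their answers, the examiners with their
markings, the question, and the assignment of candidates to examiners. Identities,
answers, marks and questions are public names. -/
structure Instance : Type where
  cands : List (ℕ × ℕ)
  examiners : List (ℕ × Marking)
  question : ℕ
  assignment : List (ℕ × ℕ)

/-- The principals of an instance have distinct identities. -/
def Instance.WF (I : Instance) : Prop :=
  (I.cands.map Prod.fst ++ I.examiners.map Prod.fst).Nodup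

/-- The marking that gives to each listed answer the listed mark, and to others the default. -/
def mkMarking (l : List (ℕ × ℕ)) (m : ℕ) : Marking :=
  ⟨l.map fun am => (.pub am.1, .pub am.2), .pub m⟩

/-- The markings of an instance are given by public names. -/
def Instance.PublicMarks (I : Instance) : Prop :=
  ∀ x ∈ I.examiners, ∃ l m, x.2 = mkMarking l m

namespace ExamProtocol

/-- The exam instance with the given data. -/
def inst (P : ExamProtocol) (I : Instance) : Proc :=
  setup fun V =>
    .par (parList (I.cands.map fun x => P.candidate V (.pub x.1) (.pub x.2))) <|
    .par (parList (I.examiners.map fun x => P.examiner V (.pub x.1) x.2)) <|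
    .par (P.committee V (.pub I.question)) <|
    .par (P.collector V (I.assignment.map fun x => (.pub x.1, .pub x.2))) <|
    P.authorities V

/-- The exam process with unboundedly many exams, each with a fresh question and unboundedly many
candidates and examiners, who have fresh identities, answers and marks. -/
def unbounded (P : ExamProtocol) : Proc :=
  .repl <| setup fun V =>
    .par (.repl (.new fun id => .new fun a => P.candidate V id a)) <|
    .par (.repl (.new fun id => .new fun m => P.examiner V id (.const m))) <|
    .par (.new fun q => P.committee V q) <|
    .par (P.collector V []) <|
    P.authorities V

/-- The exam processes of a protocol. -/
def ExamProcs (P : ExamProtocol) : Set Proc :=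
  {P.unbounded} ∪ {EP | ∃ I : Instance, I.WF ∧ I.PublicMarks ∧ EP = P.inst I}

/-- A property of event traces holds on all execution traces of all exam processes. -/
def OnAllTraces (P : ExamProtocol) (Φ : List Event → Prop) : Prop :=
  ∀ EP ∈ P.ExamProcs, ∀ es B, Exec (Config.init EP) es B → Φ es

/-- `submitted(c, h, q, a) ⇝ inj registered(c)`. -/
def CandidateAuthorisation (P : ExamProtocol) : Prop :=
  P.OnAllTraces fun es =>
    InjCorr es (fun e => ∃ c h q a, e = .submitted c h q a)
      (fun e e' => ∃ c h q a, e = .submitted c h q a ∧ e'.Eqv (.registered c))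

/-- `collected(c, h, q, a) ⇝ inj submitted(c, h, q, a)`. -/
def AnswerAuthenticity (P : ExamProtocol) : Prop :=
  P.OnAllTraces fun es =>
    InjCorr es (fun e => ∃ c h q a, e = .collected c h q a)
      (fun e e' => ∃ c h q a, e = .collected c h q a ∧ e'.Eqv (.submitted c h q a))

/-- `collected(c, h, q, a) ⇝ inj registered(c)`. -/
def TestOriginAuthentication (P : ExamProtocol) : Prop :=
  P.OnAllTraces fun es =>
    InjCorr es (fun e => ∃ c h q a, e = .collected c h q a)
      (fun e e' => ∃ c h q a, e = .collected c h q a ∧ e'.Eqv (.registered c))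

/-- `marked(q, a, m, t, x, h) ⇝ inj collected(c, h, q, a) ∪ inj distributed(c, h, q, a, t, x)`
for some `c`. -/
def TestAuthenticity (P : ExamProtocol) : Prop :=
  P.OnAllTraces fun es =>
    InjCorr₂ es (fun e => ∃ q a m t x h, e = .marked q a m t x h)
      (fun e e₁ e₂ => ∃ q a m t x h c, e = .marked q a m t x h ∧
        e₁.Eqv (.collected c h q a) ∧ e₂.Eqv (.distributed c h q a t x))

/-- `notified(c, h, m) ⇝ inj distributed(c, h, q, a, t, x) ∪ inj marked(q, a, m, t, x, h)`
for some `q`, `a`, `t`, `x`. -/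
def MarkAuthenticity (P : ExamProtocol) : Prop :=
  P.OnAllTraces fun es =>
    InjCorr₂ es (fun e => ∃ c h m, e = .notified c h m)
      (fun e e₁ e₂ => ∃ c h m q a t x, e = .notified c h m ∧
        e₁.Eqv (.distributed c h q a t x) ∧ e₂.Eqv (.marked q a m t x h))

/-- Until after preparation, exams that differ only in the question are bisimilar. -/
def QuestionIndistinguishability (P : ExamProtocol) : Prop :=
  ∀ (I : Instance) (q₁ q₂ : ℕ), I.WF → I.PublicMarks →
    Bisimilar ((P.inst { I with question := q₁ }).prune Event.isRegistered)
      ((P.inst { I with question := q₂ }).prune Event.isRegistered)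

/-- Until after marking, exams in which two candidates swap their answers are bisimilar. -/
def AnonymousMarking (P : ExamProtocol) : Prop :=
  ∀ (I : Instance) (id₁ id₂ a₁ a₂ : ℕ),
    Instance.WF { I with cands := (id₁, a₁) :: (id₂, a₂) :: I.cands } → I.PublicMarks →
    Bisimilar
      ((P.inst { I with cands := (id₁, a₁) :: (id₂, a₂) :: I.cands }).prune Event.isMarked)
      ((P.inst { I with cands := (id₁, a₂) :: (id₂, a₁) :: I.cands }).prune Event.isMarked)

/-- Exams in which the tests of two candidates are assigned to two examiners are bisimilar to the
exams in which the two assignments, and the two marks, are swapped. -/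
def AnonymousExaminer (P : ExamProtocol) : Prop :=
  ∀ (I : Instance) (id₁ id₂ a₁ a₂ x₁ x₂ m₁ m₂ : ℕ),
    Instance.WF { I with
      cands := (id₁, a₁) :: (id₂, a₂) :: I.cands
      examiners := (x₁, mkMarking [] m₁) :: (x₂, mkMarking [] m₂) :: I.examiners } →
    I.PublicMarks →
    Bisimilar
      (P.inst { I with
        cands := (id₁, a₁) :: (id₂, a₂) :: I.cands
        examiners := (x₁, mkMarking [] m₁) :: (x₂, mkMarking [] m₂) :: I.examiners
        assignment := (id₁, x₁) :: (id₂, x₂) :: I.assignment })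
      (P.inst { I with
        cands := (id₁, a₁) :: (id₂, a₂) :: I.cands
        examiners := (x₁, mkMarking [] m₂) :: (x₂, mkMarking [] m₁) :: I.examiners
        assignment := (id₁, x₂) :: (id₂, x₁) :: I.assignment })

/-- Exams in which an examiner gives different marks are bisimilar. -/
def MarkPrivacy (P : ExamProtocol) : Prop :=
  ∀ (I : Instance) (x m₁ m₂ : ℕ),
    Instance.WF { I with examiners := (x, mkMarking [] m₁) :: I.examiners } → I.PublicMarks →
    Bisimilar
      (P.inst { I with examiners := (x, mkMarking [] m₁) :: I.examiners })
      (P.inst { I with examiners := (x, mkMarking [] m₂) :: I.examiners })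

/-- Exams in which an examiner, who is assigned the tests of two candidates, swaps the marks of
their two answers are bisimilar. -/
def MarkAnonymity (P : ExamProtocol) : Prop :=
  ∀ (I : Instance) (id₁ id₂ a₁ a₂ x m₁ m₂ m : ℕ), a₁ ≠ a₂ →
    Instance.WF { I with
      cands := (id₁, a₁) :: (id₂, a₂) :: I.cands
      examiners := (x, mkMarking [(a₁, m₁), (a₂, m₂)] m) :: I.examiners } →
    I.PublicMarks →
    Bisimilar
      (P.inst { I with
        cands := (id₁, a₁) :: (id₂, a₂) :: I.cands
        examiners := (x, mkMarking [(a₁, m₁), (a₂, m₂)] m) :: I.examiners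
        assignment := (id₁, x) :: (id₂, x) :: I.assignment })
      (P.inst { I with
        cands := (id₁, a₁) :: (id₂, a₂) :: I.cands
        examiners := (x, mkMarking [(a₁, m₂), (a₂, m₁)] m) :: I.examiners
        assignment := (id₁, x) :: (id₂, x) :: I.assignment })

end ExamProtocol

/-! ## Parts common to both versions of the protocol -/

/-- Marking of the answer `a`: continue with the mark. -/
def markWith (l : List (Term × Term)) (m a : Term) (P : Term → Proc) : Proc :=
  match l with
  | [] => P m
  | (a', m') :: l => .ite a a' (P m') (markWith l m a P)

/-- Choice of an examiner `(t, q)` who registered for the exam `h`, for the test of the candidate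
with pseudonym `p'`. -/
def chooseExaminer (test : List (Term × Term)) (p' h : Term) (P : Term → Term → Proc) : Proc :=
  match test with
  | [] => lookup .examiner [none, none, some h, none, none] fun e => P (e 0) (e 1)
  | (idC, idE) :: test =>
      .get .owner [some p', some idC]
        (fun _ => lookup .examiner [none, none, some h, none, some idE] fun e => P (e 0) (e 1))
        (chooseExaminer test p' h P)

/-- The question committee publishes the signed question. -/
def committee (V : Env) (q : Term) : Proc :=
  .out pubc (tup [q, .sign q V.sskCom]) .nil

/-- The EA registers an examiner. -/
def examinerReg (h s : Term) : Proc :=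
  lookup .keys [some .gE, none] fun k =>
  let pkE := k 1
  let qTilde := Term.exp pkE s
  .out pubc (tup [qTilde, pkE]) <|
  .insert .zkpeq [qTilde, pkE] <|
  recv pubc [none, none] fun m =>
  let q := m 0
  let q' := m 1
  .out pubc (.xproof q q' .g h s) <|
  recv pubc [none, some q, some q'] fun m =>
  let t := m 0
  cond (.exp q s) q' <|
  .inp pubc fun zkp =>
  cond (.zkpsec2 zkp t q) .tt .nil

/-- Key generation and preparation phase of an examiner; the continuation gets the secret key, the
exam `h` and the pseudonym `(t, q)`. -/
def examinerPrep (V : Env) (id : Term) (P : (sk h t q : Term) → Proc) : Proc :=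
  .new fun sk =>
  let pkE := Term.exp .g sk
  .out pubc (tup [id, pkE]) <|
  .insert .keys [.gE, pkE] <|
  recv pubc [none, none] fun m =>
  let h := m 0
  let sh := m 1
  cond h (.checksign sh (.spk V.sskEA)) <|
  .new fun α =>
  lookup .zkpeq [none, some pkE] fun k =>
  let q' := Term.exp (k 0) α
  let t := Term.exp .g α
  let q := Term.exp t sk
  .out pubc (tup [q, q']) <|
  .inp pubc fun zproof =>
  cond (.checkproof zproof q q' .g h) .tt <|
  let zkp := Term.zkpProof2 t q sk
  .out pubc (tup [t, q, q']) <|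
  .out pubc zkp <|
  .insert .examiner [t, q, h, zkp, id] <|
  P sk h t q

/-- Key generation and preparation phase of a candidate, up to the receipt of a signed question;
the continuation gets the public key, the exam `h`, the pseudonym `(r, p, p')`, the proof of
knowledge, and the question. -/
def candidatePrep (V : Env) (id : Term) (P : (pkC h r p p' zkp quest : Term) → Proc) : Proc :=
  .new fun sk =>
  let pkC := Term.exp .g sk
  .out pubc (tup [id, pkC]) <|
  .insert .keys [.gC, pkC] <|
  recv pubc [none, none] fun m =>
  let h := m 0
  let sh := m 1
  cond h (.checksign sh (.spk V.sskEA)) <|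
  lookup .zkpeq [none, some pkC] fun k =>
  lookup .zkpeqnet [some (k 0), none, none] fun k =>
  let r := k 1
  let p' := k 2
  .insert .owner [p', id] <|
  let p := Term.exp r sk
  .out pubc (tup [p, p']) <|
  .inp pubc fun zproof =>
  cond (.checkproof zproof p p' .g h) .tt <|
  let zkp := Term.zkpProof2 r p sk
  .out pubc (tup [r, p, p']) <|
  .out pubc zkp <|
  recv pubc [none, none] fun m =>
  let quest := m 0
  let squest := m 1
  cond quest (.checksign squest (.spk V.sskCom)) <|
  P pkC h r p p' zkp quest

/-- The EA waits for the mark of the examiner with pseudonym `(t, q)`, de-anonymises the candidate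
with the help of the NET, and stores the mark. -/
def storeMark (V : Env) (h p' t q : Term) : Proc :=
  lookup .zkpeq [none, some (.spk V.sskEA)] fun k =>
  let hma := k 0
  recv pubc [none, some hma, none, none, some t, some q] fun m =>
  let mark := m 0
  let hmaE := m 2
  let zkpHma := m 3
  cond (.checkproof zkpHma hma hmaE t q) .tt <|
  .out pubc p' <|
  recv pubc [some p', none] fun m =>
  lookup .regCand [none, some (m 1), some h] fun k =>
  .insert .marks [k 0, mark, hma, hmaE, zkpHma, t, q] .nil

/-- The examiner with secret key `sk` returns the mark, with the hash `hma` that binds it to the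
test and a proof that the examiner computed it. -/
def returnMark (V : Env) (sk t q mark hma : Term) : Proc :=
  let hmaE := Term.exp hma sk
  .insert .zkpeq [hma, .spk V.sskEA] <|
  .out pubc (tup [mark, hma, hmaE, .xproof hma hmaE t q sk, t, q]) .nil

/-- The candidate with public key `pkC` looks up a mark, checks it against the receipt of marking
(the hash `hash (rec mark)`), and accepts it. -/
def acceptMark (V : Env) (pkC h p' : Term) (rec : Term → Term) : Proc :=
  lookup .marks [some pkC, none, none, none, none, none, none] fun k =>
  let mark := k 1
  let hma := k 2
  lookup .zkpeq [some hma, some (.spk V.sskEA)] fun _ =>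
  cond (.hash (rec mark)) hma <|
  cond (.checkproof (k 4) hma (k 3) (k 5) (k 6)) .tt <|
  .event (.notified p' h mark) .nil

/-! ## The original protocol -/

namespace HusztiPetho

/-- The candidate. -/
def candidate (V : Env) (id answ : Term) : Proc :=
  candidatePrep V id fun pkC h r p p' zkp quest =>
  .event (.submitted p' h quest answ) <|
  .out pubc (tup [r, p, answ]) <|
  .inp pubc fun receipt =>
  cond (.hash (tup [r, p, p', zkp, quest, answ])) receipt <|
  acceptMark V pkC h p' fun mark => tup [mark, answ]

/-- The examiner. -/
def examiner (V : Env) (id : Term) (M : Marking) : Proc :=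
  examinerPrep V id fun sk h t q =>
  recv pubc [none, none] fun m =>
  let quest := m 0
  let squest := m 1
  cond quest (.checksign squest (.spk V.sskCom)) <|
  recv pubc [none, none] fun m =>
  let eap := m 0
  let answer := m 1
  markWith M.special M.default answer fun mark =>
  .event (.marked quest answer mark eap q h) <|
  returnMark V sk t q mark (.hash (tup [mark, answer]))

/-- The EA in the phases of testing, marking and notification. -/
def exam (V : Env) (test : List (Term × Term)) (h s quest squest : Term) : Proc :=
  recv pubc [none, none, none] fun m =>
  let r := m 0
  let p := m 1
  let p' := m 2
  cond (.exp p s) p' <|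
  .inp pubc fun zkp =>
  cond (.zkpsec2 zkp r p) .tt <|
  cond quest (.checksign squest (.spk V.sskCom)) <|
  .out pubc (tup [quest, squest]) <|
  recv pubc [some r, some p, none] fun m =>
  let answer := m 2
  .event (.collected p' h quest answer) <|
  .out pubc (.hash (tup [r, p, p', zkp, quest, answer])) <|
  chooseExaminer test p' h fun t q =>
  .new fun eap =>
  .event (.distributed p' h quest answer eap q) <|
  .out pubc (tup [eap, answer]) <|
  storeMark V h p' t q

/-- The EA registers a candidate, and then runs the exam. -/
def candidateReg (V : Env) (test : List (Term × Term)) (h s quest squest : Term) : Proc :=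
  lookup .keys [some .gC, none] fun k =>
  let pkC := k 1
  let pTilde := Term.exp pkC s
  .insert .regCand [pkC, pTilde, h] <|
  .out pubc (tup [pTilde, .gC]) <|
  .insert .zkpeq [pTilde, pkC] <|
  recv pubc [none, none] fun m =>
  .out pubc (.xproof (m 0) (m 1) .g h s) <|
  exam V test h s quest squest

/-- The exam authority, which is also the collector. -/
def examAuthority (V : Env) (test : List (Term × Term)) : Proc :=
  .new fun s =>
  let h := Term.exp .g s
  .out pubc (tup [h, .sign h V.sskEA]) <|
  recv pubc [none, none] fun m =>
  .par (.repl (examinerReg h s)) (.repl (candidateReg V test h s (m 0) (m 1)))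

/-- The NET. -/
def net : Proc :=
  recv pubc [none, some .gC] fun m =>
  let pTilde := m 0
  .new fun ro =>
  let p' := Term.exp pTilde ro
  let r := Term.exp .g ro
  .event (.registered p') <|
  .out pubc (tup [p', r]) <|
  .insert .zkpeqnet [pTilde, r, p'] <|
  .inp pubc fun x =>
  cond x p' <|
  .out pubc (tup [p', pTilde]) .nil

end HusztiPetho

/-- The original protocol. All messages use the public anonymous channel. -/
def husztiPetho : ExamProtocol where
  candidate := HusztiPetho.candidate
  examiner := HusztiPetho.examiner
  committee := committee
  collector V test := .repl (HusztiPetho.examAuthority V test)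
  authorities _ := .repl HusztiPetho.net

/-! ## The modified protocol -/

namespace ModifiedHP

/-- The receipt of submission, which contains the test identifier `eap`. -/
def receipt (h r p p' zkp quest answer eap : Term) : Term :=
  .hash (tup [h, r, p, p', zkp, quest, answer, eap])

/-- The test that the EA signs: identifier, exam, question, answer, chosen examiner. -/
def test (eap h quest answer q : Term) : Term :=
  tup [eap, h, quest, answer, q]

/-- The candidate: the receipt of submission is checked to be signed by the EA, and the test
identifier in it has to be the one in the receipt of marking. -/
def candidate (V : Env) (id answ : Term) : Proc :=
  candidatePrep V id fun pkC h r p p' zkp quest =>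
  .event (.submitted p' h quest answ) <|
  .out pubc (tup [r, p, answ]) <|
  recv pubc [none, none] fun m =>
  let eap := m 0
  cond (.checksign (m 1) (.spk V.sskEA)) (receipt h r p p' zkp quest answ eap) <|
  acceptMark V pkC h p' fun mark => tup [mark, answ, eap]

/-- The examiner: only a test that is signed by the EA is marked. -/
def examiner (V : Env) (id : Term) (M : Marking) : Proc :=
  examinerPrep V id fun sk h t q =>
  recv pubc [none, none] fun m =>
  let quest := m 0
  let squest := m 1
  cond quest (.checksign squest (.spk V.sskCom)) <|
  recv pubc [none, none, none] fun m =>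
  let eap := m 0
  let answer := m 1
  cond (.checksign (m 2) (.spk V.sskEA)) (test eap h quest answer q) <|
  markWith M.special M.default answer fun mark =>
  .event (.marked quest answer mark eap q h) <|
  returnMark V sk t q mark (.hash (tup [mark, answer, eap]))

/-- The EA in the phases of testing, marking and notification; only the eligible pseudonym `p'` is
accepted, the receipt contains the test identifier and is signed, and the distributed test
is signed. -/
def exam (V : Env) (asg : List (Term × Term)) (h s quest squest p' : Term) : Proc :=
  recv pubc [none, none, some p'] fun m =>
  let r := m 0
  let p := m 1
  cond (.exp p s) p' <|
  .inp pubc fun zkp =>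
  cond (.zkpsec2 zkp r p) .tt <|
  cond quest (.checksign squest (.spk V.sskCom)) <|
  .out pubc (tup [quest, squest]) <|
  recv pubc [some r, some p, none] fun m =>
  let answer := m 2
  .event (.collected p' h quest answer) <|
  .new fun eap =>
  .out pubc (tup [eap, .sign (receipt h r p p' zkp quest answer eap) V.sskEA]) <|
  chooseExaminer asg p' h fun t q =>
  .event (.distributed p' h quest answer eap q) <|
  .out pubc (tup [eap, answer, .sign (test eap h quest answer q) V.sskEA]) <|
  storeMark V h p' t q

/-- The EA registers a candidate: the partial pseudonym is sent to the NET, and the eligible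
pseudonym received from the NET, over private channels; a proof is issued for it only. -/
def candidateReg (V : Env) (asg : List (Term × Term)) (h s quest squest : Term) : Proc :=
  lookup .keys [some .gC, none] fun k =>
  let pkC := k 1
  let pTilde := Term.exp pkC s
  .insert .regCand [pkC, pTilde, h] <|
  .out V.chEN (tup [pTilde, .gC]) <|
  .insert .zkpeq [pTilde, pkC] <|
  recv V.chNE [some pTilde, none] fun m =>
  let p' := m 1
  recv pubc [none, some p'] fun m =>
  .out pubc (.xproof (m 0) p' .g h s) <|
  exam V asg h s quest squest p'

/-- The exam authority, which is also the collector. -/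
def examAuthority (V : Env) (asg : List (Term × Term)) : Proc :=
  .new fun s =>
  let h := Term.exp .g s
  .out pubc (tup [h, .sign h V.sskEA]) <|
  recv pubc [none, none] fun m =>
  .par (.repl (examinerReg h s)) (.repl (candidateReg V asg h s (m 0) (m 1)))

/-- The NET. -/
def net (V : Env) : Proc :=
  recv V.chEN [none, some .gC] fun m =>
  let pTilde := m 0
  .new fun ro =>
  let p' := Term.exp pTilde ro
  let r := Term.exp .g ro
  .event (.registered p') <|
  .out pubc (tup [p', r]) <|
  .insert .zkpeqnet [pTilde, r, p'] <|
  .out V.chNE (tup [pTilde, p']) <|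
  .inp pubc fun x =>
  cond x p' <|
  .out pubc (tup [p', pTilde]) .nil

end ModifiedHP

/-- The modified protocol. -/
def modifiedHusztiPetho : ExamProtocol where
  candidate := ModifiedHP.candidate
  examiner := ModifiedHP.examiner
  committee := committee
  collector V asg := .repl (ModifiedHP.examAuthority V asg)
  authorities V := .repl (ModifiedHP.net V)

end ExamPi

/-! Equality modulo the theory is decided by a normal form `nf`. All equations are read as
reductions, except the rotation of three exponents over `g`, for which one representative of the
three rotations is chosen. Questions about equality or forgery become questions about head symbols
of normal forms.

Satisfied requirements. An invariant in the style of a separation logic is kept along every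
execution. Each restricted name receives, at its creation, a purpose (candidate or examiner key,
exam secret, NET exponent, test identifier together with the data of the test, ...) and five
one-time permissions. A process is `Safe` if it sends and stores only admissible data and pays for
its events with permissions that it owns. Permissions are never duplicated, and pass between
processes only over private channels. `Safe.trace` concludes that every event is justified by
earlier ones and that different events have paid with different permissions. The second clause gives
injectivity: two occurrences with the same witness would have used the same permission. The payer is
found from the event, because a pseudonym determines the candidate's key and the NET's exponent: the
purposes exclude the nontrivial rotations (`Pseudo.unique`). In the original protocol only
`submitted` is controlled; this rests on the tables, which the attacker cannot write. In the
modified one the private channel hands the permissions of the NET's exponent to the EA, and the EA's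
signatures, which cannot be forged (`GoodMsg.signed`), tie tests and receipts to a test identifier,
whose purpose records the data of the test.

Violated correspondences. Explicit attacks, written as scripts and checked by simplification
(`attacks`). The check of `p ^ s = p'` is passed by a power of `g` and the same power of `h`,
without any registration. Unsigned tests are marked whoever made them. The receipts of the original
protocol do not contain the test identifier. In both protocols a third party can send an answer once
a candidate has shown its proof of knowledge.

Violated privacy. The environment tests whether the first or third component of a message is a given
name. For the question and for a single mark, one process can output such a name and the other
cannot (`not_bisimilar_of_guarded`). For the swaps both processes can output the same names, but not
in the same order: in the first process a telling name can appear while a certain principal has not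
yet started; in the second that principal must start before. If the second process hides this start
in an internal communication, the principal's identity can never be shown afterwards, while the
first process can still show it (`not_bisimilar_of_flip`). As bisimulations answer an input by an
input with the same recipe, attackers with a restricted set of recipes suffice. -/

namespace ExamPi

/-! ## Normal forms -/

namespace Term

open Classical in
/-- Normalising application of `fst` to a normal form. -/
noncomputable def mkFst (a : Term) : Term :=
  if h : ∃ x y, a = pair x y then h.choose else fst a

open Classical in
/-- Normalising application of `snd` to a normal form. -/
noncomputable def mkSnd (a : Term) : Term :=
  if h : ∃ y x, a = pair x y then h.choose else snd a

open Classical in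
/-- Normalising application of `decrypt` to normal forms. -/
noncomputable def mkDecrypt (a k : Term) : Term :=
  if h : ∃ m r, a = encrypt m (pk k) r then h.choose else decrypt a k

open Classical in
/-- Normalising application of `getmess` to a normal form. -/
noncomputable def mkGetmess (a : Term) : Term :=
  if h : ∃ m k, a = sign m k then h.choose else getmess a

open Classical in
/-- Normalising application of `checksign` to normal forms. -/
noncomputable def mkChecksign (a v : Term) : Term :=
  if h : ∃ m k, a = sign m k ∧ v = spk k then h.choose else checksign a v

/-- Two triples of exponents agree up to a rotation. -/
def Rot (t t' : Term × Term × Term) : Prop :=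
  t' = t ∨ t' = (t.2.1, t.2.2, t.1) ∨ t' = (t.2.2, t.1, t.2.1)

/-- Triples of exponents up to rotation. -/
def rotSetoid : Setoid (Term × Term × Term) where
  r := Rot
  iseqv := by
    refine ⟨fun _ => .inl rfl, ?_, ?_⟩
    · rintro ⟨a, b, c⟩ ⟨a', b', c'⟩ h
      simp only [Rot, Prod.mk.injEq] at *
      grind
    · rintro ⟨a, b, c⟩ ⟨a', b', c'⟩ ⟨a'', b'', c''⟩ h h'
      simp only [Rot, Prod.mk.injEq] at *
      grind

/-- A fixed representative of the rotations of a triple. -/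
noncomputable def canon (t : Term × Term × Term) : Term × Term × Term :=
  (Quotient.mk rotSetoid t).out

theorem canon_rot (t : Term × Term × Term) : Rot (canon t) t :=
  Quotient.exact (s := rotSetoid) (Quotient.out_eq _)

theorem canon_eq_iff {t t' : Term × Term × Term} : canon t = canon t' ↔ Rot t t' := by
  constructor
  · intro h
    refine rotSetoid.trans (rotSetoid.symm (canon_rot t)) ?_
    rw [h]
    exact canon_rot t'
  · intro h
    simp only [canon]
    congr 1
    exact Quotient.sound (s := rotSetoid) h

/-- The normal form of `g` to three exponents. -/
noncomputable def tri (x y z : Term) : Term :=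
  exp (exp (exp g (canon (x, y, z)).1) (canon (x, y, z)).2.1) (canon (x, y, z)).2.2

/-- The one place where an equation that is not a reduction enters: an equality of threefold powers
of `g` splits into three cases. -/
theorem tri_eq_iff {x y z x' y' z' : Term} :
    tri x y z = tri x' y' z' ↔ Rot (x, y, z) (x', y', z') := by
  rw [← canon_eq_iff, Prod.ext_iff, Prod.ext_iff]
  simp only [tri, exp.injEq, true_and, and_assoc]

theorem tri_rotate (x y z : Term) : tri x y z = tri y z x :=
  tri_eq_iff.2 (.inr (.inl rfl))

theorem tri_eqv (x y z : Term) : tri x y z ≈ₑ exp (exp (exp g x) y) z := by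
  have h := canon_rot (x, y, z)
  rw [tri]
  generalize canon (x, y, z) = t at *
  obtain ⟨a, b, c⟩ := t
  simp only [Rot, Prod.mk.injEq] at h
  rcases h with ⟨rfl, rfl, rfl⟩ | ⟨rfl, rfl, rfl⟩ | ⟨rfl, rfl, rfl⟩
  · exact .refl _
  · exact .exp_rotate _ _ _
  · exact (Eqv.exp_rotate _ _ _).trans (.exp_rotate _ _ _)

open Classical in
/-- Normalising application of `exp` to normal forms. -/
noncomputable def mkExp (a z : Term) : Term :=
  if h : ∃ x y, a = exp (exp g x) y then tri h.choose h.choose_spec.choose z else exp a z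

open Classical in
/-- Normalising application of `zkpsec` to normal forms. -/
noncomputable def mkZkpsec (a v : Term) : Term :=
  if ∃ e₁ e₂, v = exp (exp g e₁) e₂ ∧ a = zkpProof v e₂ then tt else zkpsec a v

open Classical in
/-- Normalising application of `zkpsec2` to normal forms. -/
noncomputable def mkZkpsec2 (a u v : Term) : Term :=
  if ∃ e₁ e₂, u = exp g e₁ ∧ v = exp u e₂ ∧ a = zkpProof2 u v e₂ then tt else zkpsec2 a u v

open Classical in
/-- Normalising application of `checkproof` to normal forms. -/
noncomputable def mkCheckproof (a p p' t d : Term) : Term :=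
  -- The power is normalised, because it may be a rotated threefold power of `g`.
  if ∃ e, a = xproof p p' t d e ∧ d = mkExp t e then tt else checkproof a p p' t d

/-- The normal form of a term modulo the equational theory. -/
noncomputable def nf : Term → Term
  | var i => var i
  | pub n => pub n
  | priv n => priv n
  | g => g
  | gC => gC
  | gE => gE
  | tt => tt
  | unit => unit
  | pair a b => pair a.nf b.nf
  | fst a => mkFst a.nf
  | snd a => mkSnd a.nf
  | hash a => hash a.nf
  | pk a => pk a.nf
  | encrypt a b c => encrypt a.nf b.nf c.nf
  | decrypt a b => mkDecrypt a.nf b.nf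
  | spk a => spk a.nf
  | sign a b => sign a.nf b.nf
  | getmess a => mkGetmess a.nf
  | checksign a b => mkChecksign a.nf b.nf
  | exp a b => mkExp a.nf b.nf
  | zkpProof a b => zkpProof a.nf b.nf
  | zkpsec a b => mkZkpsec a.nf b.nf
  | zkpProof2 a b c => zkpProof2 a.nf b.nf c.nf
  | zkpsec2 a b c => mkZkpsec2 a.nf b.nf c.nf
  | xproof a b c d e => xproof a.nf b.nf c.nf d.nf e.nf
  | checkproof a b c d e => mkCheckproof a.nf b.nf c.nf d.nf e.nf

/-! ### Reduction rules of the normalising operations -/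

@[simp] theorem mkFst_pair (a b : Term) : mkFst (pair a b) = a := by
  have h : ∃ x y, pair a b = pair x y := ⟨a, b, rfl⟩
  rw [mkFst, dif_pos h]
  obtain ⟨y, hy⟩ := h.choose_spec
  exact (pair.inj hy).1.symm

@[simp] theorem mkSnd_pair (a b : Term) : mkSnd (pair a b) = b := by
  have h : ∃ y x, pair a b = pair x y := ⟨b, a, rfl⟩
  rw [mkSnd, dif_pos h]
  obtain ⟨y, hy⟩ := h.choose_spec
  exact (pair.inj hy).2.symm

@[simp] theorem mkDecrypt_encrypt (m k r : Term) : mkDecrypt (encrypt m (pk k) r) k = m := by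
  have h : ∃ m' r', encrypt m (pk k) r = encrypt m' (pk k) r' := ⟨m, r, rfl⟩
  rw [mkDecrypt, dif_pos h]
  obtain ⟨y, hy⟩ := h.choose_spec
  exact (encrypt.inj hy).1.symm

@[simp] theorem mkGetmess_sign (m k : Term) : mkGetmess (sign m k) = m := by
  have h : ∃ m' k', sign m k = sign m' k' := ⟨m, k, rfl⟩
  rw [mkGetmess, dif_pos h]
  obtain ⟨y, hy⟩ := h.choose_spec
  exact (sign.inj hy).1.symm

@[simp] theorem mkChecksign_sign (m k : Term) : mkChecksign (sign m k) (spk k) = m := by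
  have h : ∃ m' k', sign m k = sign m' k' ∧ spk k = spk k' := ⟨m, k, rfl, rfl⟩
  rw [mkChecksign, dif_pos h]
  obtain ⟨y, hy, -⟩ := h.choose_spec
  exact (sign.inj hy).1.symm

@[simp] theorem mkExp_exp (x y z : Term) : mkExp (exp (exp g x) y) z = tri x y z := by
  have h : ∃ x' y', exp (exp g x) y = exp (exp g x') y' := ⟨x, y, rfl⟩
  rw [mkExp, dif_pos h]
  have := h.choose_spec.choose_spec
  generalize h.choose_spec.choose = y' at *
  generalize h.choose = x' at *
  simp only [exp.injEq, true_and] at this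
  rw [this.1, this.2]

theorem mkExp_of_not {a : Term} (z : Term) (h : ¬ ∃ x y, a = exp (exp g x) y) :
    mkExp a z = exp a z := by rw [mkExp, dif_neg h]

@[simp] theorem mkExp_g (z : Term) : mkExp g z = exp g z := mkExp_of_not _ (by simp)

@[simp] theorem mkExp_exp_g (y z : Term) : mkExp (exp g y) z = exp (exp g y) z :=
  mkExp_of_not _ (by simp)

@[simp] theorem mkExp_hash (x w : Term) : mkExp (hash x) w = exp (hash x) w :=
  mkExp_of_not _ (by simp)

/-- A normalised exponentiation is an exponentiation. -/
theorem mkExp_eq_exp (a z : Term) : ∃ x y, mkExp a z = exp x y := by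
  unfold mkExp
  split
  · exact ⟨_, _, rfl⟩
  · exact ⟨_, _, rfl⟩

@[simp] theorem mkZkpsec_proof (e₁ e₂ : Term) :
    mkZkpsec (zkpProof (exp (exp g e₁) e₂) e₂) (exp (exp g e₁) e₂) = tt :=
  if_pos ⟨e₁, e₂, rfl, rfl⟩

@[simp] theorem mkZkpsec2_proof (e₁ e₂ : Term) :
    mkZkpsec2 (zkpProof2 (exp g e₁) (exp (exp g e₁) e₂) e₂) (exp g e₁) (exp (exp g e₁) e₂) = tt :=
  if_pos ⟨e₁, e₂, rfl, rfl, rfl⟩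

theorem mkCheckproof_xproof (p p' t e : Term) :
    mkCheckproof (xproof p p' t (mkExp t e) e) p p' t (mkExp t e) = tt :=
  if_pos ⟨e, rfl, rfl⟩

/-- Equal terms have the same normal form. -/
theorem Eqv.nf_eq {a b : Term} (h : a ≈ₑ b) : a.nf = b.nf := by
  induction h with
  | refl => rfl
  | symm _ ih => exact ih.symm
  | trans _ _ ih₁ ih₂ => exact ih₁.trans ih₂
  | fst_pair | snd_pair | decrypt_encrypt | getmess_sign | checksign_sign => simp [nf]
  | exp_rotate x y z => simp [nf, tri_rotate x.nf]
  | zkpsec_proof => simp [nf]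
  | zkpsec2_proof => simp [nf]
  | checkproof_xproof => simp only [nf, mkCheckproof_xproof]
  | _ => simp_all [nf]

/-! ### Soundness of normalisation -/

theorem mkFst_eqv (a : Term) : mkFst a ≈ₑ fst a := by
  by_cases h : ∃ x y, a = pair x y
  · obtain ⟨x, y, rfl⟩ := h
    rw [mkFst_pair]
    exact (Eqv.fst_pair _ _).symm
  · rw [mkFst, dif_neg h]
    exact .refl _

theorem mkSnd_eqv (a : Term) : mkSnd a ≈ₑ snd a := by
  by_cases h : ∃ y x, a = pair x y
  · obtain ⟨x, y, rfl⟩ := h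
    rw [mkSnd_pair]
    exact (Eqv.snd_pair _ _).symm
  · rw [mkSnd, dif_neg h]
    exact .refl _

theorem mkDecrypt_eqv (a k : Term) : mkDecrypt a k ≈ₑ decrypt a k := by
  by_cases h : ∃ m r, a = encrypt m (pk k) r
  · obtain ⟨x, y, rfl⟩ := h
    rw [mkDecrypt_encrypt]
    exact (Eqv.decrypt_encrypt _ _ _).symm
  · rw [mkDecrypt, dif_neg h]
    exact .refl _

theorem mkGetmess_eqv (a : Term) : mkGetmess a ≈ₑ getmess a := by
  by_cases h : ∃ m k, a = sign m k
  · obtain ⟨x, y, rfl⟩ := h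
    rw [mkGetmess_sign]
    exact (Eqv.getmess_sign _ _).symm
  · rw [mkGetmess, dif_neg h]
    exact .refl _

theorem mkChecksign_eqv (a v : Term) : mkChecksign a v ≈ₑ checksign a v := by
  by_cases h : ∃ m k, a = sign m k ∧ v = spk k
  · obtain ⟨x, y, rfl, rfl⟩ := h
    rw [mkChecksign_sign]
    exact (Eqv.checksign_sign _ _).symm
  · rw [mkChecksign, dif_neg h]
    exact .refl _

theorem mkExp_eqv (a z : Term) : mkExp a z ≈ₑ exp a z := by
  by_cases h : ∃ x y, a = exp (exp g x) y
  · obtain ⟨x, y, rfl⟩ := h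
    rw [mkExp_exp]
    exact tri_eqv x y z
  · rw [mkExp_of_not _ h]
    exact .refl _

theorem mkZkpsec_eqv (a v : Term) : mkZkpsec a v ≈ₑ zkpsec a v := by
  unfold mkZkpsec
  split_ifs with h
  · obtain ⟨e₁, e₂, rfl, rfl⟩ := h
    exact (Eqv.zkpsec_proof _ _).symm
  · exact .refl _

theorem mkZkpsec2_eqv (a u v : Term) : mkZkpsec2 a u v ≈ₑ zkpsec2 a u v := by
  unfold mkZkpsec2
  split_ifs with h
  · obtain ⟨e₁, e₂, rfl, rfl, rfl⟩ := h
    exact (Eqv.zkpsec2_proof _ _).symm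
  · exact .refl _

theorem mkCheckproof_eqv (a p p' t d : Term) :
    mkCheckproof a p p' t d ≈ₑ checkproof a p p' t d := by
  unfold mkCheckproof
  split_ifs with h
  · obtain ⟨e, rfl, rfl⟩ := h
    have := mkExp_eqv t e
    exact ((Eqv.checkproof (.xproof (.refl _) (.refl _) (.refl _) this (.refl _))
      (.refl _) (.refl _) (.refl _) this).trans (.checkproof_xproof p p' t e)).symm
  · exact .refl _

/-- A term equals its normal form. -/
theorem nf_eqv (a : Term) : a.nf ≈ₑ a := by
  induction a with
  | var | pub | priv | g | gC | gE | tt | unit => exact .refl _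
  | pair _ _ h₁ h₂ => exact .pair h₁ h₂
  | fst _ h => exact (mkFst_eqv _).trans (.fst h)
  | snd _ h => exact (mkSnd_eqv _).trans (.snd h)
  | hash _ h => exact .hash h
  | pk _ h => exact .pk h
  | encrypt _ _ _ h₁ h₂ h₃ => exact .encrypt h₁ h₂ h₃
  | decrypt _ _ h₁ h₂ => exact (mkDecrypt_eqv _ _).trans (.decrypt h₁ h₂)
  | spk _ h => exact .spk h
  | sign _ _ h₁ h₂ => exact .sign h₁ h₂
  | getmess _ h => exact (mkGetmess_eqv _).trans (.getmess h)
  | checksign _ _ h₁ h₂ => exact (mkChecksign_eqv _ _).trans (.checksign h₁ h₂)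
  | exp _ _ h₁ h₂ => exact (mkExp_eqv _ _).trans (.exp h₁ h₂)
  | zkpProof _ _ h₁ h₂ => exact .zkpProof h₁ h₂
  | zkpsec _ _ h₁ h₂ => exact (mkZkpsec_eqv _ _).trans (.zkpsec h₁ h₂)
  | zkpProof2 _ _ _ h₁ h₂ h₃ => exact .zkpProof2 h₁ h₂ h₃
  | zkpsec2 _ _ _ h₁ h₂ h₃ => exact (mkZkpsec2_eqv _ _ _).trans (.zkpsec2 h₁ h₂ h₃)
  | xproof _ _ _ _ _ h₁ h₂ h₃ h₄ h₅ => exact .xproof h₁ h₂ h₃ h₄ h₅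
  | checkproof _ _ _ _ _ h₁ h₂ h₃ h₄ h₅ =>
      exact (mkCheckproof_eqv _ _ _ _ _).trans (.checkproof h₁ h₂ h₃ h₄ h₅)

/-- Equality modulo the equational theory is equality of normal forms. -/
theorem eqv_iff {a b : Term} : a ≈ₑ b ↔ a.nf = b.nf :=
  ⟨Eqv.nf_eq, fun h => (nf_eqv a).symm.trans (h ▸ nf_eqv b)⟩

/-! ## Terms built under restrictions on names and signatures -/

/-- Terms in which public names satisfy `pubOK` and restricted names satisfy `privOK`, with the
exception of `spk k` for `spkOK k` and of `sign m k` for `keyOK m k`; all other signatures satisfy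
`guard`. -/
inductive Built (pubOK privOK : ℕ → Prop) (spkOK guard : Term → Prop)
    (keyOK : Term → Term → Prop) : Term → Prop
  | var {n} : Built _ _ _ _ _ (var n)
  | pub {n} : pubOK n → Built _ _ _ _ _ (pub n)
  | priv {n} : privOK n → Built _ _ _ _ _ (priv n)
  | g : Built _ _ _ _ _ g
  | gC : Built _ _ _ _ _ gC
  | gE : Built _ _ _ _ _ gE
  | tt : Built _ _ _ _ _ tt
  | unit : Built _ _ _ _ _ unit
  | pair {a b} : Built pubOK privOK spkOK guard keyOK a → Built pubOK privOK spkOK guard keyOK b →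
      Built _ _ _ _ _ (pair a b)
  | fst {a} : Built pubOK privOK spkOK guard keyOK a → Built _ _ _ _ _ (fst a)
  | snd {a} : Built pubOK privOK spkOK guard keyOK a → Built _ _ _ _ _ (snd a)
  | hash {a} : Built pubOK privOK spkOK guard keyOK a → Built _ _ _ _ _ (hash a)
  | pk {a} : Built pubOK privOK spkOK guard keyOK a → Built _ _ _ _ _ (pk a)
  | encrypt {a b c} : Built pubOK privOK spkOK guard keyOK a →
      Built pubOK privOK spkOK guard keyOK b → Built pubOK privOK spkOK guard keyOK c →
      Built _ _ _ _ _ (encrypt a b c)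
  | decrypt {a b} : Built pubOK privOK spkOK guard keyOK a →
      Built pubOK privOK spkOK guard keyOK b → Built _ _ _ _ _ (decrypt a b)
  | spk {a} : Built pubOK privOK spkOK guard keyOK a → Built _ _ _ _ _ (spk a)
  | spkKey {a} : spkOK a → Built _ _ _ _ _ (spk a)
  | sign {a b} : Built pubOK privOK spkOK guard keyOK a →
      Built pubOK privOK spkOK guard keyOK b → guard a → Built _ _ _ _ _ (sign a b)
  | signKey {a b} : Built pubOK privOK spkOK guard keyOK a → keyOK a b →
      Built _ _ _ _ _ (sign a b)
  | getmess {a} : Built pubOK privOK spkOK guard keyOK a → Built _ _ _ _ _ (getmess a)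
  | checksign {a b} : Built pubOK privOK spkOK guard keyOK a →
      Built pubOK privOK spkOK guard keyOK b → Built _ _ _ _ _ (checksign a b)
  | exp {a b} : Built pubOK privOK spkOK guard keyOK a →
      Built pubOK privOK spkOK guard keyOK b → Built _ _ _ _ _ (exp a b)
  | zkpProof {a b} : Built pubOK privOK spkOK guard keyOK a →
      Built pubOK privOK spkOK guard keyOK b → Built _ _ _ _ _ (zkpProof a b)
  | zkpsec {a b} : Built pubOK privOK spkOK guard keyOK a →
      Built pubOK privOK spkOK guard keyOK b → Built _ _ _ _ _ (zkpsec a b)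
  | zkpProof2 {a b c} : Built pubOK privOK spkOK guard keyOK a →
      Built pubOK privOK spkOK guard keyOK b → Built pubOK privOK spkOK guard keyOK c →
      Built _ _ _ _ _ (zkpProof2 a b c)
  | zkpsec2 {a b c} : Built pubOK privOK spkOK guard keyOK a →
      Built pubOK privOK spkOK guard keyOK b → Built pubOK privOK spkOK guard keyOK c →
      Built _ _ _ _ _ (zkpsec2 a b c)
  | xproof {a b c d e} : Built pubOK privOK spkOK guard keyOK a →
      Built pubOK privOK spkOK guard keyOK b → Built pubOK privOK spkOK guard keyOK c →
      Built pubOK privOK spkOK guard keyOK d → Built pubOK privOK spkOK guard keyOK e →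
      Built _ _ _ _ _ (xproof a b c d e)
  | checkproof {a b c d e} : Built pubOK privOK spkOK guard keyOK a →
      Built pubOK privOK spkOK guard keyOK b → Built pubOK privOK spkOK guard keyOK c →
      Built pubOK privOK spkOK guard keyOK d → Built pubOK privOK spkOK guard keyOK e →
      Built _ _ _ _ _ (checkproof a b c d e)

namespace Built

variable {pubOK privOK : ℕ → Prop} {spkOK guard : Term → Prop} {keyOK : Term → Term → Prop}

local notation "B" => Built pubOK privOK spkOK guard keyOK

theorem mono {pubOK' privOK' : ℕ → Prop} {spkOK' guard' : Term → Prop}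
    {keyOK' : Term → Term → Prop} (h₁ : ∀ n, pubOK n → pubOK' n) (h₂ : ∀ n, privOK n → privOK' n)
    (h₃ : ∀ a, spkOK a → spkOK' a) (h₄ : ∀ a, guard a → guard' a)
    (h₅ : ∀ a b, keyOK a b → keyOK' a b) {a : Term} (h : B a) :
    Built pubOK' privOK' spkOK' guard' keyOK' a := by
  induction h with
  | pub h => exact .pub (h₁ _ h)
  | priv h => exact .priv (h₂ _ h)
  | spkKey h => exact .spkKey (h₃ _ h)
  | sign _ _ h i₁ i₂ => exact .sign i₁ i₂ (h₄ _ h)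
  | signKey _ h i => exact .signKey i (h₅ _ _ h)
  | _ => constructor <;> assumption

theorem tri {x y z : Term} (hx : B x) (hy : B y) (hz : B z) : B (tri x y z) := by
  have h := canon_rot (x, y, z)
  rw [Term.tri]
  generalize canon (x, y, z) = t at *
  obtain ⟨a, b, c⟩ := t
  simp only [Rot, Prod.mk.injEq] at h
  rcases h with ⟨rfl, rfl, rfl⟩ | ⟨rfl, rfl, rfl⟩ | ⟨rfl, rfl, rfl⟩ <;>
    exact .exp (.exp (.exp .g ‹_›) ‹_›) ‹_›

/-- The restrictions are preserved by normalisation. -/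
theorem nf (h₃ : ∀ a, spkOK a → spkOK a.nf) (h₄ : ∀ a, guard a → guard a.nf)
    (h₅ : ∀ a b, keyOK a b → keyOK a.nf b.nf) {a : Term} (h : B a) : B a.nf := by
  induction h with
  | @fst a _ ih =>
    rw [Term.nf]
    by_cases h : ∃ x y, a.nf = .pair x y
    · obtain ⟨x, y, e⟩ := h
      rw [e] at ih ⊢
      rw [mkFst_pair]
      cases ih; assumption
    · rw [mkFst, dif_neg h]; exact .fst ih
  | @snd a _ ih =>
    rw [Term.nf]
    by_cases h : ∃ y x, a.nf = .pair x y
    · obtain ⟨x, y, e⟩ := h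
      rw [e] at ih ⊢
      rw [mkSnd_pair]
      cases ih; assumption
    · rw [mkSnd, dif_neg h]; exact .snd ih
  | @decrypt a k _ _ ih ih' =>
    rw [Term.nf]
    by_cases h : ∃ m r, a.nf = .encrypt m (.pk k.nf) r
    · obtain ⟨x, y, e⟩ := h
      rw [e] at ih ⊢
      rw [mkDecrypt_encrypt]
      cases ih; assumption
    · rw [mkDecrypt, dif_neg h]; exact .decrypt ih ih'
  | @getmess a _ ih =>
    rw [Term.nf]
    by_cases h : ∃ m k, a.nf = .sign m k
    · obtain ⟨x, y, e⟩ := h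
      rw [e] at ih ⊢
      rw [mkGetmess_sign]
      cases ih <;> assumption
    · rw [mkGetmess, dif_neg h]; exact .getmess ih
  | @checksign a v _ _ ih ih' =>
    rw [Term.nf]
    by_cases h : ∃ m k, a.nf = .sign m k ∧ v.nf = .spk k
    · obtain ⟨x, y, e, e'⟩ := h
      rw [e] at ih ⊢
      rw [e', mkChecksign_sign]
      cases ih <;> assumption
    · rw [mkChecksign, dif_neg h]; exact .checksign ih ih'
  | @exp a z _ _ ih ih' =>
    rw [Term.nf]
    by_cases h : ∃ x y, a.nf = .exp (.exp .g x) y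
    · obtain ⟨x, y, e⟩ := h
      rw [e] at ih ⊢
      rw [mkExp_exp]
      cases ih with | exp h₁ h₂ => cases h₁ with | exp _ h₃ => exact h₃.tri h₂ ih'
    · rw [mkExp_of_not _ h]; exact .exp ih ih'
  | zkpsec _ _ ih ih' =>
    simp only [Term.nf, mkZkpsec]
    split_ifs
    · exact .tt
    · exact .zkpsec ih ih'
  | zkpsec2 _ _ _ ih ih' ih'' =>
    simp only [Term.nf, mkZkpsec2]
    split_ifs
    · exact .tt
    · exact .zkpsec2 ih ih' ih''
  | checkproof =>
    simp only [Term.nf, mkCheckproof]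
    split_ifs
    · exact .tt
    · apply Built.checkproof <;> assumption
  | spkKey h => exact .spkKey (h₃ _ h)
  | sign _ _ h i₁ i₂ => exact .sign i₁ i₂ (h₄ _ h)
  | signKey _ h i => exact .signKey i (h₅ _ _ h)
  | pub h => exact .pub h
  | priv h => exact .priv h
  | _ => constructor <;> assumption

/-- The instance of a recipe is built like the messages of the frame. -/
theorem subst {guard' : Term → Prop} {φ : List Term} (hφ : ∀ M ∈ φ, B M)
    (hg : ∀ a, guard' a → guard (a.subst φ)) {M : Term}
    (h : Built pubOK (fun _ => False) (fun _ => False) guard' (fun _ _ => False) M) :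
    B (M.subst φ) := by
  induction h with
  | @var i =>
    simp only [Term.subst]
    rw [List.getD_eq_getElem?_getD]
    rcases h : φ[i]? with _ | M
    -- An index beyond the frame stays a variable, and variables are always admissible.
    · exact .var
    · exact hφ M (List.mem_of_getElem? h)
  | pub h => exact .pub h
  | priv h | spkKey h => exact h.elim
  | sign _ _ h i₁ i₂ => exact .sign i₁ i₂ (hg _ h)
  | signKey _ h i => exact h.elim
  | _ => simp only [Term.subst]; constructor <;> assumption

/-- An arbitrary recipe is built without restricted names. -/
theorem of_isRecipe {n : ℕ} {M : Term} (h : M.IsRecipe n) :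
    Built (fun _ => True) (fun _ => False) (fun _ => False) (fun _ => True) (fun _ _ => False)
      M := by
  induction M with
  | priv => exact h.elim
  | var => exact .var
  | pub => exact .pub trivial
  | sign a b ha hb => exact .sign (ha h.1) (hb h.2) trivial
  | fst a ha => exact .fst (ha h)
  | snd a ha => exact .snd (ha h)
  | hash a ha => exact .hash (ha h)
  | pk a ha => exact .pk (ha h)
  | spk a ha => exact .spk (ha h)
  | getmess a ha => exact .getmess (ha h)
  | pair _ _ ha hb => exact .pair (ha h.1) (hb h.2)
  | decrypt _ _ ha hb => exact .decrypt (ha h.1) (hb h.2)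
  | checksign _ _ ha hb => exact .checksign (ha h.1) (hb h.2)
  | exp _ _ ha hb => exact .exp (ha h.1) (hb h.2)
  | zkpProof _ _ ha hb => exact .zkpProof (ha h.1) (hb h.2)
  | zkpsec _ _ ha hb => exact .zkpsec (ha h.1) (hb h.2)
  | encrypt _ _ _ ha hb hc => exact .encrypt (ha h.1) (hb h.2.1) (hc h.2.2)
  | zkpProof2 _ _ _ ha hb hc => exact .zkpProof2 (ha h.1) (hb h.2.1) (hc h.2.2)
  | zkpsec2 _ _ _ ha hb hc => exact .zkpsec2 (ha h.1) (hb h.2.1) (hc h.2.2)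
  | xproof _ _ _ _ _ ha hb hc hd he =>
    exact .xproof (ha h.1) (hb h.2.1) (hc h.2.2.1) (hd h.2.2.2.1) (he h.2.2.2.2)
  | checkproof _ _ _ _ _ ha hb hc hd he =>
    exact .checkproof (ha h.1) (hb h.2.1) (hc h.2.2.1) (hd h.2.2.2.1) (he h.2.2.2.2)
  | _ => constructor

theorem tup {l : List Term} (h : ∀ a ∈ l, B a) : B (tup l) := by
  induction l with
  | nil => exact .unit
  | cons a l ih => exact .pair (h a (by simp)) (ih fun b hb => h b (by simp [hb]))

theorem proj {a : Term} (h : B a) (i : ℕ) : B (proj i a) := by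
  induction i generalizing a with
  | zero => exact .fst h
  | succ i ih => exact ih (.snd h)

end Built

/-- If a signature is verified with the public key of `k`, it is a signature with `k`. -/
theorem nf_eq_sign_of_checksign {s k m : Term} (h : m ≈ₑ checksign s (spk k))
    (hm : ∀ a b, m.nf ≠ checksign a b) : s.nf = sign m.nf k.nf := by
  have h := h.nf_eq
  simp only [nf] at h
  by_cases h' : ∃ m k', s.nf = .sign m k' ∧ Term.spk k.nf = .spk k'
  · obtain ⟨m', k', e, e'⟩ := h'
    rw [e, e', mkChecksign_sign] at h
    rw [e, h, (spk.inj e')]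
  -- A failed verification is an irreducible `checksign` term, to which `m` could be equal; this is
  -- what `hm` excludes.
  · rw [mkChecksign, dif_neg h'] at h
    exact absurd h (hm _ _)

end Term


/-! ## A resource discipline for processes -/

/-- The data of a test that the collector attaches to the test identifier. -/
structure TestData : Type where
  c : Term
  h : Term
  q : Term
  a : Term

/-- The purpose for which a restricted name is created. -/
inductive Info : Type
  | ea
  | key
  | secret
  | net
  | chEN
  | chNE
  | eap (d : TestData)
  | other

/-- The one-time permissions that come with a restricted name. -/
abbrev Tok : Type := ℕ × Fin 5

/-- The purposes of the restricted names created so far, and the events so far. -/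
structure World : Type where
  info : ℕ → Option Info
  es : List Event

namespace World

/-- Later worlds. -/
instance : Preorder World where
  le W W' := (∀ n i, W.info n = some i → W'.info n = some i) ∧ W.es <+: W'.es
  le_refl _ := ⟨fun _ _ h => h, List.prefix_refl _⟩
  le_trans _ _ _ h h' := ⟨fun n i k => h'.1 n i (h.1 n i k), h.2.trans h'.2⟩

theorem mem_of_le {W W' : World} (h : W ≤ W') {e} (he : e ∈ W.es) : e ∈ W'.es := h.2.subset he

/-- The world after the creation of a name. -/
def upd (W : World) (n : ℕ) (i : Info) : World := ⟨Function.update W.info n (some i), W.es⟩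

/-- The world after an event. -/
def add (W : World) (e : Event) : World := ⟨W.info, W.es ++ [e]⟩

theorem le_upd (W : World) {n : ℕ} (i : Info) (h : W.info n = none) : W ≤ W.upd n i := by
  refine ⟨fun m j hm => ?_, List.prefix_refl _⟩
  have : m ≠ n := by rintro rfl; simp [h] at hm
  simpa [upd, this] using hm

theorem le_add (W : World) (e : Event) : W ≤ W.add e := ⟨fun _ _ h => h, List.prefix_append _ _⟩

@[simp] theorem upd_info_self (W : World) (n : ℕ) (i : Info) :
    (W.upd n i).info n = some i := by simp [upd]

theorem mem_add (W : World) (e : Event) : e ∈ (W.add e).es := by simp [add]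

/-- Used to transport an old justification to the current purposes while its history of events stays
truncated. -/
theorem le_of_info_le {f f' : ℕ → Option Info} {es es' : List Event}
    (h : (⟨f, es⟩ : World) ≤ ⟨f', es'⟩) (es'' : List Event) :
    (⟨f, es''⟩ : World) ≤ ⟨f', es''⟩ := ⟨h.1, List.prefix_refl _⟩

end World

/-- All permissions of a name. -/
def allToks (n : ℕ) : Multiset Tok := (Finset.univ : Finset (Fin 5)).val.map fun k => (n, k)

theorem mem_allToks {n : ℕ} {t : Tok} : t ∈ allToks n ↔ t.1 = n := by
  obtain ⟨m, k⟩ := t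
  simp only [allToks, Multiset.mem_map, Prod.mk.injEq]
  exact ⟨fun ⟨_, _, h, _⟩ => h.symm, fun h => ⟨k, Finset.mem_univ k, h.symm, rfl⟩⟩

theorem allToks_nodup (n : ℕ) : (allToks n).Nodup :=
  Multiset.Nodup.map (fun a b h => by simpa using h) Finset.univ.nodup

/-- Invariants for messages on public channels, table entries, messages on private channels (which
may carry permissions) and events (which use up permissions). -/
structure Discipline : Type where
  Good : World → Term → Prop
  TableOK : World → Table → List Term → Prop
  MsgOK : World → ℕ → Term → Multiset Tok → Prop
  Just : World → Event → Multiset Tok → Prop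
  good_mono : ∀ {W W' M}, W ≤ W' → Good W M → Good W' M
  table_mono : ∀ {W W' tb Ms}, W ≤ W' → TableOK W tb Ms → TableOK W' tb Ms
  msg_mono : ∀ {W W' n M R}, W ≤ W' → MsgOK W n M R → MsgOK W' n M R
  just_mono : ∀ {W W' e R}, W ≤ W' → Just W e R → Just W' e R
  recipe : ∀ {W : World} {φ : List Term} {M : Term}, (∀ N ∈ φ, Good W N) → M.IsRecipe φ.length → Good W (M.subst φ)

namespace Discipline

variable (D : Discipline)

/-- The process respects the discipline when it owns the given permissions. -/
def Safe : Proc → World → Multiset Tok → Prop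
  | .nil, _, _ => True
  | .par P Q, W, R => ∃ R₁ R₂, R₁ + R₂ ≤ R ∧ Safe P W R₁ ∧ Safe Q W R₂
  -- Copies own nothing; otherwise permissions would be duplicated.
  | .repl P, W, _ => Safe P W 0
  -- The purpose is ghost data, chosen in the proof when the name is created.
  | .new P, W, R => ∀ W', W ≤ W' → ∀ n, W'.info n = none →
      ∃ i, Safe (P (.priv n)) (W'.upd n i) (R + allToks n)
  | .newChan P, W, R => ∀ W', W ≤ W' → ∀ n, W'.info n = none →
      ∃ i, Safe (P (.priv n)) (W'.upd n i) (R + allToks n)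
  | .ite M N P Q, W, R => (M ≈ₑ N → Safe P W R) ∧ (¬ M ≈ₑ N → Safe Q W R)
  -- Public messages carry no permissions, since the attacker can replay them; private messages may
  -- carry some.
  | .inp (.pub _) P, W, R => ∀ W', W ≤ W' → ∀ x, D.Good W' x → Safe (P x) W' R
  | .inp (.priv n) P, W, R => ∀ W', W ≤ W' → ∀ x Rm, D.MsgOK W' n x Rm → Safe (P x) W' (R + Rm)
  | .out (.pub _) M P, W, R => D.Good W M ∧ Safe P W R
  | .out (.priv n) M P, W, R => ∃ Rm R', Rm + R' ≤ R ∧ D.MsgOK W n M Rm ∧ Safe P W R'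
  | .event e P, W, R => ∀ W', W ≤ W' →
      ∃ Re R', Re + R' ≤ R ∧ D.Just W' e Re ∧ Safe P (W'.add e) R'
  | .insert tb Ms P, W, R => D.TableOK W tb Ms ∧ Safe P W R
  | .get tb pats P Q, W, R =>
      (∀ W', W ≤ W' → ∀ Ms, D.TableOK W' tb Ms → Matches pats Ms → Safe (P Ms) W' R) ∧
        Safe Q W R

variable {D}

/-- The clauses for inputs, lookups, restrictions and events already quantify over later worlds, and
permissions may be left unused. -/
theorem Safe.mono {P : Proc} {W W' : World} {R R' : Multiset Tok} (h : D.Safe P W R)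
    (hW : W ≤ W') (hR : R ≤ R') : D.Safe P W' R' := by
  induction P generalizing W W' R R' with
  | nil => trivial
  | par P Q hP hQ =>
    obtain ⟨R₁, R₂, h, h₁, h₂⟩ := h
    exact ⟨R₁, R₂, h.trans hR, hP h₁ hW le_rfl, hQ h₂ hW le_rfl⟩
  | repl P hP => exact hP h hW le_rfl
  | new P hP | newChan P hP =>
    intro W'' hW'' n hn
    obtain ⟨i, hi⟩ := h W'' (hW.trans hW'') n hn
    exact ⟨i, hP _ hi le_rfl (by gcongr)⟩
  | ite M N P Q hP hQ => exact ⟨fun e => hP (h.1 e) hW hR, fun e => hQ (h.2 e) hW hR⟩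
  | inp u P hP =>
    cases u with
    | pub n => exact fun W'' hW'' x hx => hP _ (h W'' (hW.trans hW'') x hx) le_rfl hR
    | priv n =>
      exact fun W'' hW'' x Rm hx => hP _ (h W'' (hW.trans hW'') x Rm hx) le_rfl (by gcongr)
  | out u M P hP =>
    cases u with
    | pub n => exact ⟨D.good_mono hW h.1, hP h.2 hW hR⟩
    | priv n =>
      obtain ⟨Rm, R₁, h₁, h₂, h₃⟩ := h
      exact ⟨Rm, R₁, h₁.trans hR, D.msg_mono hW h₂, hP h₃ hW le_rfl⟩
  | event e P hP =>
    intro W'' hW''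
    obtain ⟨Re, R₁, h₁, h₂, h₃⟩ := h W'' (hW.trans hW'')
    exact ⟨Re, R₁, h₁.trans hR, h₂, h₃⟩
  | insert tb Ms P hP => exact ⟨D.table_mono hW h.1, hP h.2 hW hR⟩
  | get tb pats P Q hP hQ =>
    exact ⟨fun W'' hW'' Ms h₁ h₂ => hP _ (h.1 W'' (hW.trans hW'') Ms h₁ h₂) le_rfl hR,
      hQ h.2 hW hR⟩

variable (D)

/-- The invariant of executions: each process owns permissions, each event has used up permissions,
and nothing is owned or used up twice. -/
structure Core (W : World) (u : Finset ℕ) (T : Table → Set (List Term)) (φ : List Term)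
    (ts : List (Multiset Tok)) (A : Multiset (Proc × Multiset Tok)) : Prop where
  safe : ∀ x ∈ A, D.Safe x.1 W x.2
  nodup : (ts.sum + (A.map Prod.snd).sum).Nodup
  fresh : ∀ t ∈ ts.sum + (A.map Prod.snd).sum, t.1 ∈ u
  used : ∀ n, n ∈ u ↔ W.info n ≠ none
  table : ∀ tb, ∀ Ms ∈ T tb, D.TableOK W tb Ms
  frame : ∀ M ∈ φ, D.Good W M
  length : ts.length = W.es.length
  -- The purposes are the current ones, but only the events before the `i`-th may be used.
  just : ∀ i e, W.es[i]? = some e → ∃ R, ts[i]? = some R ∧ D.Just ⟨W.info, W.es.take i⟩ e R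

variable {D}

/-! ### Preservation of the invariant -/

namespace Core

variable {W : World} {u : Finset ℕ} {T : Table → Set (List Term)} {φ : List Term}
  {ts : List (Multiset Tok)} {A A' : Multiset (Proc × Multiset Tok)}

/-- Covers the rewriting of processes in all steps without a new name or event: the owned
permissions can only shrink. -/
theorem replace (h : D.Core W u T φ ts (A + A')) {B : Multiset (Proc × Multiset Tok)}
    (hB : ∀ x ∈ B, D.Safe x.1 W x.2) (hle : (B.map Prod.snd).sum ≤ (A.map Prod.snd).sum) :
    D.Core W u T φ ts (B + A') := by
  have hle' : ts.sum + ((B + A').map Prod.snd).sum ≤ ts.sum + ((A + A').map Prod.snd).sum := by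
    simp only [Multiset.map_add, Multiset.sum_add]
    gcongr
  refine { h with safe := ?_, nodup := ?_, fresh := ?_ }
  · intro x hx
    rcases Multiset.mem_add.1 hx with hx | hx
    · exact hB x hx
    · exact h.safe x (Multiset.mem_add.2 (.inr hx))
  · exact Multiset.nodup_of_le hle' h.nodup
  · exact fun t ht => h.fresh t (Multiset.mem_of_le hle' ht)

theorem replace_head {x : Proc × Multiset Tok} (h : D.Core W u T φ ts (x ::ₘ A'))
    {B : Multiset (Proc × Multiset Tok)}
    (hB : ∀ x ∈ B, D.Safe x.1 W x.2) (hle : (B.map Prod.snd).sum ≤ x.2) :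
    D.Core W u T φ ts (B + A') := by
  rw [← Multiset.singleton_add] at h
  exact h.replace hB (by simpa using hle)

theorem replace_two {x y x' y' : Proc × Multiset Tok} (h : D.Core W u T φ ts (x ::ₘ y ::ₘ A'))
    (hx : D.Safe x'.1 W x'.2) (hy : D.Safe y'.1 W y'.2) (hle : x'.2 + y'.2 ≤ x.2 + y.2) :
    D.Core W u T φ ts (x' ::ₘ y' ::ₘ A') := by
  have e : ∀ a b : Proc × Multiset Tok, a ::ₘ b ::ₘ A' = {a, b} + A' := by
    intro a b; simp
  rw [e] at h ⊢
  refine h.replace ?_ (by simpa using hle)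
  simpa using ⟨hx, hy⟩

theorem replace_one {P : Proc} {R : Multiset Tok} (h : D.Core W u T φ ts ((P, R) ::ₘ A'))
    {P' : Proc} (hP' : D.Safe P' W R) : D.Core W u T φ ts ((P', R) ::ₘ A') := by
  rw [← Multiset.singleton_add] at h ⊢
  exact h.replace (by simpa using hP') le_rfl

theorem safe_head {x : Proc × Multiset Tok} (h : D.Core W u T φ ts (x ::ₘ A')) :
    D.Safe x.1 W x.2 := h.safe x (by simp)

/-- The new permissions are disjoint from the old ones, because every permission in circulation
belongs to a used name. -/
theorem new {P P' : Proc} {R : Multiset Tok} (h : D.Core W u T φ ts ((P, R) ::ₘ A'))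
    {n : ℕ} (hn : n ∉ u) {i : Info} (hs : D.Safe P' (W.upd n i) (R + allToks n)) :
    D.Core (W.upd n i) (insert n u) T φ ts ((P', R + allToks n) ::ₘ A') := by
  have hi : W.info n = none := by simpa [hn] using h.used n
  have hW := W.le_upd i hi
  have e : ts.sum + (((P', R + allToks n) ::ₘ A').map Prod.snd).sum =
      (ts.sum + (((P, R) ::ₘ A').map Prod.snd).sum) + allToks n := by
    simp only [Multiset.map_cons, Multiset.sum_cons]; abel
  refine ⟨?_, ?_, ?_, ?_, fun tb Ms hm => D.table_mono hW (h.table tb Ms hm),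
    fun M hM => D.good_mono hW (h.frame M hM), h.length, ?_⟩
  · intro x hx
    rcases Multiset.mem_cons.1 hx with rfl | hx
    · exact hs
    · exact (h.safe x (by simp [hx])).mono hW le_rfl
  · rw [e, Multiset.nodup_add]
    refine ⟨h.nodup, allToks_nodup n, ?_⟩
    rw [Multiset.disjoint_left]
    intro t ht ht'
    rw [mem_allToks] at ht'
    exact hn (ht' ▸ h.fresh t ht)
  · intro t ht
    rw [e, Multiset.mem_add, mem_allToks] at ht
    rcases ht with ht | ht
    · exact Finset.mem_insert_of_mem (h.fresh t ht)
    · exact ht ▸ Finset.mem_insert_self _ _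
  · intro m
    by_cases hm : m = n
    · subst hm; simp
    · simp [World.upd, hm, h.used m]
  · intro j e hj
    obtain ⟨R', h₁, h₂⟩ := h.just j e hj
    exact ⟨R', h₁, D.just_mono (World.le_of_info_le hW _) h₂⟩

/-- The permissions `Re` move from the process to the ledger `ts`, at the index of the new event;
the total does not grow. -/
theorem event {P P' : Proc} {R Re R' : Multiset Tok} (h : D.Core W u T φ ts ((P, R) ::ₘ A'))
    {e : Event} (hle : Re + R' ≤ R) (hj : D.Just W e Re) (hs : D.Safe P' (W.add e) R') :
    D.Core (W.add e) u T φ (ts ++ [Re]) ((P', R') ::ₘ A') := by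
  have hW := W.le_add e
  have e' : (ts ++ [Re]).sum + (((P', R') ::ₘ A').map Prod.snd).sum ≤
      ts.sum + (((P, R) ::ₘ A').map Prod.snd).sum := by
    simp only [Multiset.map_cons, Multiset.sum_cons, List.sum_append, List.sum_singleton]
    calc ts.sum + Re + (R' + (A'.map Prod.snd).sum)
        = ts.sum + ((Re + R') + (A'.map Prod.snd).sum) := by abel
      _ ≤ _ := by gcongr
  refine ⟨?_, Multiset.nodup_of_le e' h.nodup, fun t ht => h.fresh t (Multiset.mem_of_le e' ht),
    h.used, fun tb Ms hm => D.table_mono hW (h.table tb Ms hm),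
    fun M hM => D.good_mono hW (h.frame M hM), by simp [World.add, h.length], ?_⟩
  · intro x hx
    rcases Multiset.mem_cons.1 hx with rfl | hx
    · exact hs
    · exact (h.safe x (by simp [hx])).mono hW le_rfl
  · intro j e₁ hj'
    simp only [World.add] at hj' ⊢
    by_cases hlt : j < W.es.length
    · rw [List.getElem?_append_left hlt] at hj'
      obtain ⟨R₁, h₁, h₂⟩ := h.just j e₁ hj'
      refine ⟨R₁, ?_, ?_⟩
      · rw [List.getElem?_append_left (h.length ▸ hlt), h₁]
      · rwa [List.take_append_of_le_length hlt.le]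
    · rw [List.getElem?_append_right (not_lt.1 hlt)] at hj'
      have hj0 : j = W.es.length := by
        by_contra hne
        have : j - W.es.length = (j - W.es.length - 1) + 1 := by omega
        rw [this] at hj'
        simp at hj'
      subst hj0
      simp only [Nat.sub_self, List.getElem?_cons_zero, Option.some.injEq] at hj'
      subst hj'
      refine ⟨Re, ?_, ?_⟩
      · rw [← h.length, List.getElem?_append_right le_rfl]; simp
      · simpa using hj

end Core

theorem exists_cons_of_map {P : Proc} {S : Multiset Proc} {A : Multiset (Proc × Multiset Tok)}
    (h : A.map Prod.fst = P ::ₘ S) : ∃ R A', A = (P, R) ::ₘ A' ∧ A'.map Prod.fst = S := by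
  classical
  obtain ⟨⟨P', R⟩, hm, rfl, hS⟩ := (Multiset.map_eq_cons _ _ _ _).2 h
  exact ⟨R, A.erase (P', R), (Multiset.cons_erase hm).symm, hS⟩

/-- The events after a step. -/
def _root_.ExamPi.Label.events : Label → List Event
  | .event e => [e]
  | _ => []

variable (D)

/-- The invariant of a configuration. -/
def Inv (es : List Event) (c : Config) : Prop :=
  ∃ W ts A, W.es = es ∧ A.map Prod.fst = c.procs ∧ D.Core W c.used c.tables c.frame ts A

variable {D}

theorem mem_addEntry {T : Table → Set (List Term)} {tb tb' : Table} {Ms Ms' : List Term}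
    (h : Ms' ∈ addEntry T tb Ms tb') : tb' = tb ∧ Ms' = Ms ∨ Ms' ∈ T tb' := by
  unfold addEntry at h
  split_ifs at h with e
  · rcases h with h | h
    · exact .inl ⟨e, h⟩
    · exact .inr h
  · exact .inr h

/-- The world changes only with a new name or an event. In a communication on a private channel, the
permissions of the message pass from the sender to the receiver. -/
theorem Inv.step {es : List Event} {c c' : Config} {l : Label} (h : D.Inv es c)
    (s : Step c l c') : D.Inv (es ++ l.events) c' := by
  obtain ⟨W, ts, A, rfl, hA, hC⟩ := h
  cases s with
  | nil =>
    obtain ⟨R, A', rfl, hA'⟩ := exists_cons_of_map hA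
    refine ⟨W, ts, A', by simp [Label.events], hA', ?_⟩
    simpa using hC.replace_head (B := 0) (by simp) (by simp)
  | @par _ _ _ _ P Q =>
    obtain ⟨R, A', rfl, hA'⟩ := exists_cons_of_map hA
    obtain ⟨R₁, R₂, hle, h₁, h₂⟩ := hC.safe_head
    refine ⟨W, ts, (P, R₁) ::ₘ (Q, R₂) ::ₘ A', by simp [Label.events], by simp [hA'], ?_⟩
    simpa using hC.replace_head (B := {(P, R₁), (Q, R₂)}) (by simpa using ⟨h₁, h₂⟩)
      (by simpa using hle)
  | @repl _ _ _ _ P =>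
    obtain ⟨R, A', rfl, hA'⟩ := exists_cons_of_map hA
    have h₁ := hC.safe_head
    -- The replication keeps its permissions, which it cannot use; the copy gets none.
    refine ⟨W, ts, (P, 0) ::ₘ (.repl P, R) ::ₘ A', by simp [Label.events], by simp [hA'], ?_⟩
    simpa using hC.replace_head (B := {(P, 0), (.repl P, R)})
      (by simpa using And.intro (show D.Safe P W 0 from h₁) h₁) (by simp)
  | new n hn | newChan n hn =>
    obtain ⟨R, A', rfl, hA'⟩ := exists_cons_of_map hA
    obtain ⟨i, hi⟩ := hC.safe_head W le_rfl n (by simpa [hn] using hC.used n)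
    exact ⟨_, ts, _, by simp [Label.events, World.upd], by simp [hA'], hC.new hn hi⟩
  | iteTrue e =>
    obtain ⟨R, A', rfl, hA'⟩ := exists_cons_of_map hA
    exact ⟨W, ts, _, by simp [Label.events], by simp [hA'], hC.replace_one (hC.safe_head.1 e)⟩
  | iteFalse e =>
    obtain ⟨R, A', rfl, hA'⟩ := exists_cons_of_map hA
    exact ⟨W, ts, _, by simp [Label.events], by simp [hA'], hC.replace_one (hC.safe_head.2 e)⟩
  | @comm _ _ _ _ ch M P Q =>
    obtain ⟨R, A', rfl, hA'⟩ := exists_cons_of_map hA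
    obtain ⟨R', A'', rfl, hA''⟩ := exists_cons_of_map hA'
    have h₁ := hC.safe_head
    have h₂ := hC.safe (.inp ch Q, R') (by simp)
    cases ch with
    | pub n =>
      exact ⟨W, ts, (P, R) ::ₘ (Q M, R') ::ₘ A'', by simp [Label.events], by simp [hA''],
        hC.replace_two h₁.2 (h₂ W le_rfl M h₁.1) le_rfl⟩
    | priv n =>
      obtain ⟨Rm, R₁, h₁, h₃, h₄⟩ := h₁
      refine ⟨W, ts, (P, R₁) ::ₘ (Q M, R' + Rm) ::ₘ A'', by simp [Label.events], by simp [hA''],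
        hC.replace_two h₄ (h₂ W le_rfl M Rm h₃) ?_⟩
      calc R₁ + (R' + Rm) = (Rm + R₁) + R' := by abel
        _ ≤ _ := by dsimp only; gcongr
  | insert =>
    obtain ⟨R, A', rfl, hA'⟩ := exists_cons_of_map hA
    refine ⟨W, ts, _, by simp [Label.events], by simp [hA'],
      { hC.replace_one hC.safe_head.2 with table := ?_ }⟩
    intro tb Ms hMs
    rcases mem_addEntry hMs with ⟨rfl, rfl⟩ | hMs
    · exact hC.safe_head.1
    · exact hC.table tb Ms hMs
  | getSome Ms hMs hm =>
    obtain ⟨R, A', rfl, hA'⟩ := exists_cons_of_map hA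
    exact ⟨W, ts, _, by simp [Label.events], by simp [hA'],
      hC.replace_one (hC.safe_head.1 W le_rfl Ms (hC.table _ Ms hMs) hm)⟩
  | getNone =>
    obtain ⟨R, A', rfl, hA'⟩ := exists_cons_of_map hA
    exact ⟨W, ts, _, by simp [Label.events], by simp [hA'], hC.replace_one hC.safe_head.2⟩
  | event =>
    obtain ⟨R, A', rfl, hA'⟩ := exists_cons_of_map hA
    obtain ⟨Re, R', h₁, h₂, h₃⟩ := hC.safe_head W le_rfl
    exact ⟨_, _, _, by simp [Label.events, World.add], by simp [hA'], hC.event h₁ h₂ h₃⟩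
  | inp n M hM =>
    obtain ⟨R, A', rfl, hA'⟩ := exists_cons_of_map hA
    exact ⟨W, ts, _, by simp [Label.events], by simp [hA'],
      hC.replace_one (hC.safe_head W le_rfl _ (D.recipe hC.frame hM))⟩
  | out n =>
    obtain ⟨R, A', rfl, hA'⟩ := exists_cons_of_map hA
    refine ⟨W, ts, _, by simp [Label.events], by simp [hA'],
      { hC.replace_one hC.safe_head.2 with frame := ?_ }⟩
    intro N hN
    simp only [List.mem_append, List.mem_singleton] at hN
    rcases hN with hN | rfl
    · exact hC.frame N hN
    · exact hC.safe_head.1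

/-- The empty world. -/
def _root_.ExamPi.World.empty : World := ⟨fun _ => none, []⟩

theorem Inv.init {P : Proc} (h : D.Safe P .empty 0) : D.Inv [] (Config.init P) := by
  refine ⟨.empty, [], {(P, 0)}, rfl, rfl, ?_⟩
  constructor <;> simp [Config.init, World.empty]
  exact h

theorem Inv.exec {es es' : List Event} {A B : Config} (h : D.Inv es A) (hx : Exec A es' B) :
    D.Inv (es ++ es') B := by
  induction hx with
  | refl => simpa using h
  | tau _ s ih | inp _ s ih | out _ s ih => simpa [Label.events] using ih.step s
  | event _ s ih => simpa [Label.events] using ih.step s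

/-- On a trace of a process that respects the discipline, every event is justified by the events
before it, and the permissions used up by the events are pairwise distinct. -/
theorem Safe.trace {P : Proc} (h : D.Safe P .empty 0) {es : List Event} {B : Config}
    (hx : Exec (Config.init P) es B) :
    ∃ (info : ℕ → Option Info) (tok : ℕ → Multiset Tok),
      (∀ i e, es[i]? = some e → D.Just ⟨info, es.take i⟩ e (tok i)) ∧
      ∀ i j t, t ∈ tok i → t ∈ tok j → i = j := by
  obtain ⟨W, ts, A, hW, -, hC⟩ := (Inv.init h).exec hx
  simp only [List.nil_append] at hW
  subst hW
  -- If the sum of a list of multisets has no duplicates, an element determines the index of the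
  -- multiset that contains it.
  have key : ∀ (ts : List (Multiset Tok)), ts.sum.Nodup →
      ∀ i j t, t ∈ ts.getD i 0 → t ∈ ts.getD j 0 → i = j := by
    intro ts hts
    induction ts with
    | nil => intro i j t hi; simp at hi
    | cons a ts ih =>
      rw [List.sum_cons, Multiset.nodup_add] at hts
      have hmem : ∀ i t, t ∈ ts.getD i 0 → t ∈ ts.sum := by
        intro i t ht
        rw [List.getD_eq_getElem?_getD] at ht
        rcases hi : ts[i]? with _ | R
        · simp [hi] at ht
        · have := List.single_le_sum (l := ts) (by simp) R (List.mem_of_getElem? hi)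
          simp only [hi, Option.getD_some] at ht
          exact Multiset.mem_of_le this ht
      intro i j t hi hj
      rcases i with _ | i <;> rcases j with _ | j
      · rfl
      · exact absurd (hmem j t (by simpa using hj))
          (Multiset.disjoint_left.1 hts.2.2 (by simpa using hi))
      · exact absurd (hmem i t (by simpa using hi))
          (Multiset.disjoint_left.1 hts.2.2 (by simpa using hj))
      · rw [ih hts.2.1 i j t (by simpa using hi) (by simpa using hj)]
  refine ⟨W.info, fun i => ts.getD i 0, fun i e he => ?_, key ts ?_⟩
  · obtain ⟨R, h₁, h₂⟩ := hC.just i e he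
    simpa [List.getD_eq_getElem?_getD, h₁] using h₂
  · exact Multiset.nodup_of_le (Multiset.le_add_right _ _) hC.nodup

end Discipline


open Term Proc

/-! ## The discipline of the two protocols -/

/-- The term `c` is a pseudonym made from the candidate key `k` and the NET exponent `ro`. -/
def Pseudo (W : World) (c : Term) (k ro : ℕ) : Prop :=
  ∃ s, W.info k = some .key ∧ W.info s = some .secret ∧ W.info ro = some .net ∧
    c ≈ₑ .exp (.exp (.exp .g (.priv k)) (.priv s)) (.priv ro)

theorem Pseudo.mono {W W' : World} (hW : W ≤ W') {c k ro} (h : Pseudo W c k ro) :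
    Pseudo W' c k ro := by
  obtain ⟨s, h₁, h₂, h₃, h₄⟩ := h
  exact ⟨s, hW.1 _ _ h₁, hW.1 _ _ h₂, hW.1 _ _ h₃, h₄⟩

theorem Pseudo.congr {W : World} {c c' k ro} (h : Pseudo W c k ro) (e : c' ≈ₑ c) :
    Pseudo W c' k ro := by
  obtain ⟨s, h₁, h₂, h₃, h₄⟩ := h
  exact ⟨s, h₁, h₂, h₃, e.trans h₄⟩

/-- A nontrivial rotation would identify a candidate key with an exam secret, against their
purposes. -/
theorem Pseudo.unique {W : World} {c c' : Term} {k k' ro ro' : ℕ} (h : Pseudo W c k ro)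
    (h' : Pseudo W c' k' ro') (e : c ≈ₑ c') : k = k' ∧ ro = ro' := by
  obtain ⟨s, h₁, h₂, h₃, h₄⟩ := h
  obtain ⟨s', h₁', h₂', h₃', h₄'⟩ := h'
  have := (h₄.symm.trans (e.trans h₄')).nf_eq
  simp only [nf, mkExp_g, mkExp_exp_g, mkExp_exp, tri_eq_iff, Rot, Prod.mk.injEq,
    priv.injEq] at this
  rcases this with ⟨rfl, rfl, rfl⟩ | ⟨rfl, rfl, rfl⟩ | ⟨rfl, rfl, rfl⟩
  · exact ⟨rfl, rfl⟩
  · simp [h₂] at h₁'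
  · simp [h₁] at h₂'

/-- The messages that the EA signs. -/
def Signed (W : World) (X : Term) : Prop :=
  (∃ a b, X ≈ₑ .exp a b) ∨
  (∃ e d r p zkp, W.info e = some (.eap d) ∧
    X ≈ₑ ModifiedHP.receipt d.h r p d.c zkp d.q d.a (.priv e)) ∨
  (∃ e d x, W.info e = some (.eap d) ∧ .distributed d.c d.h d.q d.a (.priv e) x ∈ W.es ∧
    X ≈ₑ ModifiedHP.test (.priv e) d.h d.q d.a x)

theorem Signed.mono {W W' : World} (hW : W ≤ W') {X} (h : Signed W X) : Signed W' X := by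
  rcases h with h | ⟨e, d, r, p, z, h₁, h₂⟩ | ⟨e, d, x, h₁, h₂, h₃⟩
  · exact .inl h
  · exact .inr (.inl ⟨e, d, r, p, z, hW.1 _ _ h₁, h₂⟩)
  · exact .inr (.inr ⟨e, d, x, hW.1 _ _ h₁, World.mem_of_le hW h₂, h₃⟩)

theorem Signed.congr {W : World} {X Y} (h : Signed W X) (hXY : Y ≈ₑ X) : Signed W Y := by
  rcases h with ⟨a, b, h⟩ | ⟨e, d, r, p, z, h₁, h₂⟩ | ⟨e, d, x, h₁, h₂, h₃⟩
  · exact .inl ⟨a, b, hXY.trans h⟩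
  · exact .inr (.inl ⟨e, d, r, p, z, h₁, hXY.trans h₂⟩)
  · exact .inr (.inr ⟨e, d, x, h₁, h₂, hXY.trans h₃⟩)

/-- The messages that may occur on public channels: signing keys of the EA occur only in
verification keys and signatures (in the modified protocol, of the messages in `Signed`). -/
def GoodMsg (md : Prop) (W : World) : Term → Prop :=
  Built (fun _ => True) (fun n => md → ∃ i, W.info n = some i ∧ i ≠ .ea)
    (fun a => ∃ n, a = .priv n ∧ W.info n = some .ea) (fun _ => True)
    (fun m k => ∃ n, k = .priv n ∧ W.info n = some .ea ∧ Signed W m)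

theorem GoodMsg.mono {md : Prop} {W W' : World} (hW : W ≤ W') {M} (h : GoodMsg md W M) :
    GoodMsg md W' M :=
  Built.mono (fun _ h => h)
    (fun _ h hm => let ⟨i, hi, h'⟩ := h hm; ⟨i, hW.1 _ _ hi, h'⟩)
    (fun _ ⟨n, h, h'⟩ => ⟨n, h, hW.1 _ _ h'⟩) (fun _ h => h)
    (fun _ _ ⟨n, h, h', h''⟩ => ⟨n, h, hW.1 _ _ h', h''.mono hW⟩) h

theorem GoodMsg.nf {md : Prop} {W : World} {M} (h : GoodMsg md W M) : GoodMsg md W M.nf :=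
  Built.nf (fun _ ⟨n, h, h'⟩ => ⟨n, by rw [h]; rfl, h'⟩) (fun _ h => h)
    (fun _ _ ⟨n, h, h', h''⟩ => ⟨n, by rw [h]; rfl, h', h''.congr (nf_eqv _)⟩) h

theorem GoodMsg.priv {md : Prop} {W : World} {n : ℕ} {i : Info} (h : W.info n = some i)
    (hi : i ≠ .ea) : GoodMsg md W (.priv n) := Built.priv fun _ => ⟨i, h, hi⟩

theorem GoodMsg.tup {md : Prop} {W : World} {l : List Term} (h : ∀ a ∈ l, GoodMsg md W a) :
    GoodMsg md W (tup l) := Built.tup h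

theorem GoodMsg.info {md : Prop} (hmd : md) {W : World} {n : ℕ} (h : GoodMsg md W (.priv n)) :
    ∃ i, W.info n = some i ∧ i ≠ .ea := by
  generalize e : Term.priv n = t at h
  cases h <;> cases e
  rename_i h
  exact h hmd

/-- Signatures of the EA cannot be forged. -/
theorem GoodMsg.signed {md : Prop} (hmd : md) {W : World} {s m : Term} {n : ℕ}
    (h : GoodMsg md W s) (hn : W.info n = some .ea) (hm : m ≈ₑ .checksign s (.spk (.priv n)))
    (hm' : ∀ a b, m.nf ≠ .checksign a b) : Signed W m := by
  have h := h.nf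
  rw [nf_eq_sign_of_checksign hm hm'] at h
  change GoodMsg md W (.sign m.nf (.priv n)) at h
  generalize e : Term.sign m.nf (Term.priv n) = t at h
  cases h <;> cases e
  -- An ordinary signature would contain the key as an admissible term, which its purpose `ea`
  -- forbids.
  · have h₂ : GoodMsg md W (.priv n) := by unfold GoodMsg; assumption
    obtain ⟨i, hi, hi'⟩ := GoodMsg.info hmd h₂
    rw [hn] at hi
    exact absurd (Option.some.inj hi).symm hi'
  · rename_i h₂
    exact h₂.choose_spec.2.2.congr (nf_eqv m).symm

/-- The receipts of marking issued by the examiners. -/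
def MarkHash (W : World) (X : Term) : Prop :=
  ∃ e d x q a m t x' h, W.info e = some (.eap d) ∧
    .distributed d.c d.h d.q d.a (.priv e) x ∈ W.es ∧ .marked q a m t x' h ∈ W.es ∧
    q ≈ₑ d.q ∧ a ≈ₑ d.a ∧ t ≈ₑ .priv e ∧ x' ≈ₑ x ∧ h ≈ₑ d.h ∧ X ≈ₑ .hash (tup [m, a, t])

theorem MarkHash.mono {W W' : World} (hW : W ≤ W') {X} (h : MarkHash W X) : MarkHash W' X := by
  obtain ⟨e, d, x, q, a, m, t, x', h, h₁, h₂, h₃, h₄⟩ := h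
  exact ⟨e, d, x, q, a, m, t, x', h, hW.1 _ _ h₁, World.mem_of_le hW h₂, World.mem_of_le hW h₃, h₄⟩

/-- The invariant of the tables. -/
def TableInv (md : Prop) (W : World) : Table → List Term → Prop
  | .keys, Ms => ∃ A k, Ms = [A, .exp .g (.priv k)] ∧ W.info k = some .key
  -- Partial pseudonyms and receipts of marking share this table; the second component, a power of
  -- `g` or a verification key, tells them apart.
  | .zkpeq, Ms =>
      (∃ X k s, Ms = [X, .exp .g (.priv k)] ∧ X ≈ₑ .exp (.exp .g (.priv k)) (.priv s) ∧
        W.info k = some .key ∧ W.info s = some .secret ∧ GoodMsg md W X) ∨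
      (∃ X v, Ms = [X, .spk v] ∧ (md → MarkHash W X))
  | .zkpeqnet, Ms => ∃ pT ro, Ms = [pT, .exp .g (.priv ro), .exp pT (.priv ro)] ∧
      W.info ro = some .net ∧ .registered (.exp pT (.priv ro)) ∈ W.es ∧ GoodMsg md W pT
  | .examiner, Ms => ∃ t q h zkp id, Ms = [t, q, h, zkp, id] ∧ GoodMsg md W q
  | _, _ => True

/-- The invariant of the messages on the private channels. -/
def MsgInv (md : Prop) (W : World) (n : ℕ) (x : Term) (R : Multiset Tok) : Prop :=
  (W.info n = some .chEN ∧ ∃ k s, W.info k = some .key ∧ W.info s = some .secret ∧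
    x = tup [.exp (.exp .g (.priv k)) (.priv s), .gC]) ∨
  -- Two permissions of `ro` travel with the pseudonym: they pay for the collection and the
  -- distribution of one test.
  (W.info n = some .chNE ∧ ∃ pT c k ro, x = tup [pT, c] ∧ Pseudo W c k ro ∧ GoodMsg md W x ∧
    .registered c ∈ W.es ∧ R = {(ro, 2), (ro, 3)})

/-- What is known when an event occurs. -/
def JustInv (md : Prop) (W : World) : Event → Multiset Tok → Prop
  -- Permissions 0 and 1 of a candidate's key pay for `submitted` and `notified`, 2 and 3 of a NET
  -- exponent for `collected` and `distributed`, and 4 of an examiner's key for `marked`.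
  | .registered _, _ => True
  | .submitted c _ _ _, R => ∃ k ro, Pseudo W c k ro ∧ .registered c ∈ W.es ∧ (k, 0) ∈ R
  | .collected c _ _ _, R => md → ∃ k ro c', Pseudo W c k ro ∧ .registered c' ∈ W.es ∧ c' ≈ₑ c ∧
      (ro, 2) ∈ R
  | .distributed c h q a t _, R => md → ∃ k ro e, Pseudo W c k ro ∧ t = .priv e ∧
      W.info e = some (.eap ⟨c, h, q, a⟩) ∧ .collected c h q a ∈ W.es ∧ (ro, 3) ∈ R
  | .marked q a _ t x h, R => md → ∃ e d x' b k, W.info e = some (.eap d) ∧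
      .distributed d.c d.h d.q d.a (.priv e) x' ∈ W.es ∧ t ≈ₑ .priv e ∧ q ≈ₑ d.q ∧ a ≈ₑ d.a ∧
      h ≈ₑ d.h ∧ x ≈ₑ x' ∧ x ≈ₑ .exp (.exp .g b) (.priv k) ∧ (k, 4) ∈ R
  | .notified c h m, R => md → ∃ k ro e d x q a m' t x' h', Pseudo W c k ro ∧ (k, 1) ∈ R ∧
      W.info e = some (.eap d) ∧ c ≈ₑ d.c ∧ h ≈ₑ d.h ∧ m ≈ₑ m' ∧
      .distributed d.c d.h d.q d.a (.priv e) x ∈ W.es ∧ .marked q a m' t x' h' ∈ W.es ∧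
      q ≈ₑ d.q ∧ a ≈ₑ d.a ∧ t ≈ₑ .priv e ∧ x' ≈ₑ x ∧ h' ≈ₑ d.h

/-- The discipline of the original protocol (`md = False`) and of the modified one
(`md = True`). -/
def examDiscipline (md : Prop) : Discipline where
  Good := GoodMsg md
  TableOK := TableInv md
  MsgOK := MsgInv md
  Just := JustInv md
  good_mono := fun hW h => GoodMsg.mono hW h
  table_mono := by
    intro W W' tb Ms hW h
    cases tb with
    | keys => obtain ⟨A, k, h, h'⟩ := h; exact ⟨A, k, h, hW.1 _ _ h'⟩
    | zkpeq =>
      rcases h with ⟨X, k, s, h₁, h₂, h₃, h₄, h₅⟩ | ⟨X, v, h₁, h₂⟩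
      · exact .inl ⟨X, k, s, h₁, h₂, hW.1 _ _ h₃, hW.1 _ _ h₄, h₅.mono hW⟩
      · exact .inr ⟨X, v, h₁, fun hm => (h₂ hm).mono hW⟩
    | zkpeqnet =>
      obtain ⟨pT, ro, h₁, h₂, h₃, h₄⟩ := h
      exact ⟨pT, ro, h₁, hW.1 _ _ h₂, World.mem_of_le hW h₃, h₄.mono hW⟩
    | examiner =>
      obtain ⟨t, q, h, z, id, h₁, h₂⟩ := h
      exact ⟨t, q, h, z, id, h₁, h₂.mono hW⟩
    | _ => trivial
  msg_mono := by
    rintro W W' n M R hW (⟨h, k, s, h₁, h₂, h₃⟩ | ⟨h, pT, c, k, ro, h₁, h₂, h₃, h₄, h₅⟩)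
    · exact .inl ⟨hW.1 _ _ h, k, s, hW.1 _ _ h₁, hW.1 _ _ h₂, h₃⟩
    · exact .inr ⟨hW.1 _ _ h, pT, c, k, ro, h₁, h₂.mono hW, h₃.mono hW, World.mem_of_le hW h₄, h₅⟩
  just_mono := by
    intro W W' e R hW h
    cases e with
    | registered => trivial
    | submitted =>
      obtain ⟨k, ro, h₁, h₂, h₃⟩ := h
      exact ⟨k, ro, h₁.mono hW, World.mem_of_le hW h₂, h₃⟩
    | collected =>
      intro hm
      obtain ⟨k, ro, c', h₁, h₂, h₃⟩ := h hm
      exact ⟨k, ro, c', h₁.mono hW, World.mem_of_le hW h₂, h₃⟩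
    | distributed =>
      intro hm
      obtain ⟨k, ro, e, h₁, h₂, h₃, h₄, h₅⟩ := h hm
      exact ⟨k, ro, e, h₁.mono hW, h₂, hW.1 _ _ h₃, World.mem_of_le hW h₄, h₅⟩
    | marked =>
      intro hm
      obtain ⟨e, d, x', b, k, h₁, h₂, h₃⟩ := h hm
      exact ⟨e, d, x', b, k, hW.1 _ _ h₁, World.mem_of_le hW h₂, h₃⟩
    | notified =>
      intro hm
      obtain ⟨k, ro, e, d, x, q, a, m', t, x', h', h₁, h₂, h₃, h₄, h₅, h₆, h₇, h₈, h₉⟩ := h hm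
      exact ⟨k, ro, e, d, x, q, a, m', t, x', h', h₁.mono hW, h₂, hW.1 _ _ h₃, h₄, h₅, h₆,
        World.mem_of_le hW h₇, World.mem_of_le hW h₈, h₉⟩
  recipe := by
    intro W φ M hφ hM
    refine Built.subst hφ (guard' := fun _ => True) (fun _ _ => trivial) ?_
    exact Built.of_isRecipe hM

/-! ### Proof rules for safe processes -/

variable {md : Prop} {W : World} {R : Multiset Tok}

/-- The process respects the discipline of the exam. -/
abbrev ESafe (md : Prop) (P : Proc) (W : World) (R : Multiset Tok) : Prop :=
  (examDiscipline md).Safe P W R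

theorem safe_cond {M N : Term} {P : Proc} (h : M ≈ₑ N → ESafe md P W R) :
    ESafe md (cond M N P) W R := ⟨h, fun _ => trivial⟩

theorem safe_inp {P : Term → Proc} (h : ∀ W', W ≤ W' → ∀ x, GoodMsg md W' x → ESafe md (P x) W' R) :
    ESafe md (.inp pubc P) W R := h

theorem safe_recv {pats : List (Option Term)} {P : (ℕ → Term) → Proc}
    (h : ∀ W', W ≤ W' → ∀ m : ℕ → Term, (∀ i, GoodMsg md W' (m i)) → ESafe md (P m) W' R) :
    ESafe md (recv pubc pats P) W R :=
  fun W' hW' _ hx => safe_cond fun _ => h W' hW' _ fun i => Built.proj hx i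

theorem safe_lookup {tb : Table} {pats : List (Option Term)} {P : (ℕ → Term) → Proc}
    (h : ∀ W', W ≤ W' → ∀ Ms, TableInv md W' tb Ms → Matches pats Ms →
      ESafe md (P fun i => Ms.getD i .unit) W' R) :
    ESafe md (lookup tb pats P) W R := ⟨h, trivial⟩

theorem safe_out {M : Term} {P : Proc} (h : GoodMsg md W M) (h' : ESafe md P W R) :
    ESafe md (.out pubc M P) W R := ⟨h, h'⟩

theorem safe_new {P : Term → Proc} (i : Info)
    (h : ∀ W', W ≤ W' → ∀ n, W'.info n = some i → ESafe md (P (.priv n)) W' (R + allToks n)) :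
    ESafe md (.new P) W R :=
  fun W' hW' n hn => ⟨i, h _ (hW'.trans (W'.le_upd i hn)) n (by simp)⟩

theorem safe_newChan {P : Chan → Proc} (i : Info)
    (h : ∀ W', W ≤ W' → ∀ n, W'.info n = some i → ESafe md (P (.priv n)) W' R) :
    ESafe md (.newChan P) W R := fun W' hW' n hn =>
  ⟨i, (h _ (hW'.trans (W'.le_upd i hn)) n (by simp)).mono le_rfl (Multiset.le_add_right _ _)⟩

theorem safe_insert {tb : Table} {Ms : List Term} {P : Proc} (h : TableInv md W tb Ms)
    (h' : ESafe md P W R) : ESafe md (.insert tb Ms P) W R := ⟨h, h'⟩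

theorem safe_par {P Q : Proc} (h : ESafe md P W 0) (h' : ESafe md Q W 0) : ESafe md (.par P Q) W R :=
  ⟨0, 0, by simp, h, h'⟩

theorem safe_parList {l : List Proc} (h : ∀ P ∈ l, ESafe md P W 0) : ESafe md (parList l) W R := by
  induction l generalizing R with
  | nil => trivial
  | cons P l ih => exact safe_par (h P (by simp)) (ih fun Q hQ => h Q (by simp [hQ]))

/-- The restricted names of an exam. -/
def EnvOK (W : World) (V : Env) : Prop :=
  ∃ k k' n n', V = ⟨.priv k, .priv k', .priv n, .priv n'⟩ ∧ W.info k = some .ea ∧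
    W.info k' = some .other ∧ W.info n = some .chEN ∧ W.info n' = some .chNE

theorem EnvOK.mono {W W' : World} (hW : W ≤ W') {V : Env} (h : EnvOK W V) : EnvOK W' V := by
  obtain ⟨k, k', n, n', h, h₁, h₂, h₃, h₄⟩ := h
  exact ⟨k, k', n, n', h, hW.1 _ _ h₁, hW.1 _ _ h₂, hW.1 _ _ h₃, hW.1 _ _ h₄⟩

theorem EnvOK.good_com {V : Env} (h : EnvOK W V) : GoodMsg md W V.sskCom := by
  obtain ⟨k, k', n, n', rfl, h₁, h₂, -⟩ := h
  exact GoodMsg.priv h₂ (by simp)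

theorem EnvOK.good_sign {V : Env} (h : EnvOK W V) {M : Term} (hM : GoodMsg md W M)
    (hs : Signed W M) : GoodMsg md W (.sign M V.sskEA) := by
  obtain ⟨k, k', n, n', rfl, h₁, -⟩ := h
  exact .signKey hM ⟨k, rfl, h₁, hs⟩

theorem EnvOK.signed (hmd : md) {V : Env} (h : EnvOK W V) {s m : Term} (hs : GoodMsg md W s)
    (hm : m ≈ₑ .checksign s (.spk V.sskEA)) (hm' : ∀ a b, m.nf ≠ .checksign a b) :
    Signed W m := by
  obtain ⟨k, k', n, n', rfl, h₁, -⟩ := h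
  exact hs.signed hmd h₁ hm hm'

/-- Only the EA's signing key gets a protected purpose. The committee's key may be treated as known:
none of the correspondences to be proved relies on its signatures. -/
theorem safe_setup {P : Env → Proc} (h : ∀ W', W ≤ W' → ∀ V, EnvOK W' V → ESafe md (P V) W' 0) :
    ESafe md (setup P) W R := by
  refine safe_new .ea fun W₁ l₁ k hk => safe_out (.spkKey ⟨k, rfl, hk⟩) ?_
  refine safe_new .other fun W₂ l₂ k' hk' => safe_out (.spk (.priv ?_)) ?_
  · exact fun _ => ⟨_, hk', by simp⟩
  refine safe_newChan .chEN fun W₃ l₃ n hn => safe_newChan .chNE fun W₄ l₄ n' hn' => ?_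
  refine (h W₄ (l₁.trans (l₂.trans (l₃.trans l₄))) _ ⟨k, k', n, n', rfl, ?_, ?_, ?_, hn'⟩).mono
    le_rfl (Multiset.zero_le _)
  · exact (l₂.trans (l₃.trans l₄)).1 _ _ hk
  · exact (l₃.trans l₄).1 _ _ hk'
  · exact l₄.1 _ _ hn

theorem safe_committee {V : Env} (hV : EnvOK W V) {q : Term} (hq : GoodMsg md W q) :
    ESafe md (committee V q) W R :=
  safe_out (.pair hq (.pair (.sign hq hV.good_com trivial) .unit)) trivial

theorem matches_two {a b : Option Term} {Ms : List Term} (h : Matches [a, b] Ms) :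
    ∃ x y, Ms = [x, y] ∧ (∀ N, a = some N → N ≈ₑ x) ∧ ∀ N, b = some N → N ≈ₑ y := by
  unfold Matches at h
  obtain _ | ⟨h₁, h₂⟩ := h
  obtain _ | ⟨h₃, h₄⟩ := h₂
  cases h₄
  exact ⟨_, _, rfl, h₁, h₃⟩

theorem key_eq {k k' : ℕ} (h : Term.exp .g (.priv k) ≈ₑ .exp .g (.priv k')) : k = k' := by
  have := h.nf_eq
  simpa [nf] using this

/-- Separates the two kinds of entries of the table `zkpeq`. -/
theorem key_ne_spk {k : ℕ} {v : Term} (h : Term.exp .g (.priv k) ≈ₑ .spk v) : False := by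
  have := h.nf_eq
  simp [nf] at this

theorem safe_examinerReg {s : ℕ} (hs : W.info s = some .secret) :
    ESafe md (examinerReg (.exp .g (.priv s)) (.priv s)) W R := by
  have hg : ∀ {W'}, W ≤ W' → GoodMsg md W' (.priv s) := fun hW =>
    GoodMsg.priv (hW.1 _ _ hs) (by simp)
  refine safe_lookup fun W₁ l₁ Ms hMs _ => ?_
  obtain ⟨A, k, rfl, hk⟩ := hMs
  have hk' : GoodMsg md W₁ (.exp .g (.priv k)) := .exp .g (GoodMsg.priv hk (by simp))
  refine safe_out (.pair (.exp hk' (hg l₁)) (.pair hk' .unit)) <| safe_insert ?_ ?_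
  · exact .inl ⟨_, k, s, rfl, .refl _, hk, l₁.1 _ _ hs, .exp hk' (hg l₁)⟩
  refine safe_recv fun W₂ l₂ m hm => safe_out ?_ <| safe_recv fun _ _ _ _ => safe_cond fun _ =>
    safe_inp fun _ _ _ _ => safe_cond fun _ => trivial
  have hs' := hg (l₁.trans l₂)
  exact .xproof (hm 0) (hm 1) .g (.exp .g hs') hs'

/-- The continuation owns the permissions of the key `k` and knows the shape of `q`, from which `k`
can be read off. -/
theorem safe_examinerPrep {V : Env} {id : Term} {P : (sk h t q : Term) → Proc}
    (hid : GoodMsg md W id)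
    (hP : ∀ W', W ≤ W' → ∀ k h b q, W'.info k = some .key → W'.info b = some .other →
      q = .exp (.exp .g (.priv b)) (.priv k) →
      ESafe md (P (.priv k) h (.exp .g (.priv b)) q) W' (allToks k)) :
    ESafe md (examinerPrep V id P) W R := by
  refine safe_new .key fun W₁ l₁ k hk => ?_
  have hgk : ∀ {W'}, W₁ ≤ W' → GoodMsg md W' (.priv k) := fun hW =>
    GoodMsg.priv (hW.1 _ _ hk) (by simp)
  refine safe_out (.pair (hid.mono l₁) (.pair (.exp .g (hgk le_rfl)) .unit)) ?_
  refine safe_insert ⟨_, k, rfl, hk⟩ ?_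
  refine safe_recv fun W₂ l₂ m hm => safe_cond fun _ => ?_
  refine safe_new .other fun W₃ l₃ b hb => safe_lookup fun W₄ l₄ Ms hMs hMs' => ?_
  have hb' := fun {W'} (hW : W₃ ≤ W') => GoodMsg.priv (md := md) (hW.1 _ _ hb) (by simp)
  rcases hMs with ⟨X, k', s, rfl, hX, hk', hs', hgX⟩ | ⟨X, v, rfl, -⟩
  swap
  -- A receipt of marking cannot match the examiner's public key.
  · obtain ⟨x, y, hxy, -, h⟩ := matches_two hMs'
    simp only [List.cons.injEq, and_true] at hxy
    exact (key_ne_spk (hxy.2 ▸ h _ rfl)).elim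
  have l₁₄ := l₂.trans (l₃.trans l₄)
  have hq : GoodMsg md W₄ (.exp (.exp .g (.priv b)) (.priv k)) :=
    .exp (.exp .g (hb' l₄)) (hgk l₁₄)
  refine safe_out (.pair hq (.pair (.exp hgX (hb' l₄)) .unit)) ?_
  refine safe_inp fun W₅ l₅ x hx => safe_cond fun _ => ?_
  have hq' := hq.mono l₅
  have ht : GoodMsg md W₅ (.exp .g (.priv b)) := .exp .g (hb' (l₄.trans l₅))
  refine safe_out (.pair ht (.pair hq' (.pair (.exp (hgX.mono l₅) (hb' (l₄.trans l₅))) .unit))) ?_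
  refine safe_out (.zkpProof2 ht hq' (hgk (l₁₄.trans l₅))) ?_
  refine safe_insert ⟨_, _, _, _, _, rfl, hq'⟩ ?_
  refine (hP W₅ (l₁.trans (l₁₄.trans l₅)) k (m 0) b _ ((l₁₄.trans l₅).1 _ _ hk)
    ((l₄.trans l₅).1 _ _ hb) rfl).mono le_rfl ?_
  rw [add_right_comm, add_comm]
  exact Multiset.le_add_right _ _

/-- The source of candidate authorisation. The attacker writes neither of the two tables: the first
entry is a power of the candidate's own public key, and the second one is stored only after
`registered`, whoever sent the partial pseudonym to the NET. -/
theorem safe_candidatePrep {V : Env} {id : Term}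
    {P : (pkC h r p p' zkp quest : Term) → Proc} (hid : GoodMsg md W id)
    (hP : ∀ W', W ≤ W' → ∀ pkC h r p p' zkp quest k ro, GoodMsg md W' r → GoodMsg md W' p →
      Pseudo W' p' k ro → .registered p' ∈ W'.es →
      ESafe md (P pkC h r p p' zkp quest) W' (allToks k)) :
    ESafe md (candidatePrep V id P) W R := by
  refine safe_new .key fun W₁ l₁ k hk => ?_
  have hgk : ∀ {W'}, W₁ ≤ W' → GoodMsg md W' (.priv k) := fun hW =>
    GoodMsg.priv (hW.1 _ _ hk) (by simp)
  refine safe_out (.pair (hid.mono l₁) (.pair (.exp .g (hgk le_rfl)) .unit)) ?_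
  refine safe_insert ⟨_, k, rfl, hk⟩ ?_
  refine safe_recv fun W₂ l₂ m hm => safe_cond fun _ => safe_lookup fun W₃ l₃ Ms hMs hMs' => ?_
  obtain ⟨x, y, rfl, -, hy⟩ := matches_two hMs'
  have hy := hy _ rfl
  rcases hMs with ⟨X, k', s, e, hX, -, hs, -⟩ | ⟨X, v, e, -⟩ <;>
    simp only [List.cons.injEq, and_true] at e <;> obtain ⟨rfl, rfl⟩ := e
  swap
  · exact (key_ne_spk hy).elim
  obtain rfl := key_eq hy
  refine safe_lookup fun W₄ l₄ Ms hMs hMs' => ?_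
  obtain ⟨pT, ro, rfl, hro, hreg, hpT⟩ := hMs
  have hpT' : x ≈ₑ pT := by
    unfold Matches at hMs'
    obtain _ | ⟨h₁, h₂⟩ := hMs'
    exact h₁ _ rfl
  have hgro : ∀ {W'}, W₄ ≤ W' → GoodMsg md W' (.priv ro) := fun hW =>
    GoodMsg.priv (hW.1 _ _ hro) (by simp)
  have l₁₄ := l₂.trans (l₃.trans l₄)
  -- The term `pT` that the NET received equals the partial pseudonym only modulo the theory.
  have hps : Pseudo W₄ (.exp pT (.priv ro)) k ro := by
    refine ⟨s, l₁₄.1 _ _ hk, l₄.1 _ _ hs, hro, .exp (hpT'.symm.trans hX) (.refl _)⟩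
  have hr : ∀ {W'}, W₄ ≤ W' → GoodMsg md W' (.exp .g (.priv ro)) := fun hW => .exp .g (hgro hW)
  have hp : ∀ {W'}, W₄ ≤ W' → GoodMsg md W' (.exp (.exp .g (.priv ro)) (.priv k)) :=
    fun hW => .exp (hr hW) (hgk (l₁₄.trans hW))
  have hp' : ∀ {W'}, W₄ ≤ W' → GoodMsg md W' (.exp pT (.priv ro)) :=
    fun hW => .exp (hpT.mono hW) (hgro hW)
  refine safe_insert trivial <| safe_out (.pair (hp le_rfl) (.pair (hp' le_rfl) .unit)) ?_
  refine safe_inp fun W₅ l₅ z hz => safe_cond fun _ => ?_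
  refine safe_out (.pair (hr l₅) (.pair (hp l₅) (.pair (hp' l₅) .unit))) ?_
  refine safe_out (.zkpProof2 (hr l₅) (hp l₅) (hgk (l₁₄.trans l₅))) ?_
  refine safe_recv fun W₆ l₆ m hm => safe_cond fun _ => ?_
  have l := l₅.trans l₆
  refine (hP W₆ (l₁.trans (l₁₄.trans l)) _ _ _ _ _ _ _ k ro (hr l) (hp l) (hps.mono l)
    (World.mem_of_le l hreg)).mono le_rfl ?_
  rw [add_comm]
  exact Multiset.le_add_right _ _


open Term Proc

variable {md : Prop} {W : World} {R : Multiset Tok}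

theorem safe_event {e : Event} {P : Proc} {Re R' : Multiset Tok} (hle : Re + R' ≤ R)
    (hj : ∀ W', W ≤ W' → JustInv md W' e Re)
    (hP : ∀ W', W ≤ W' → e ∈ W'.es → ESafe md P W' R') : ESafe md (.event e P) W R :=
  fun W' hW' => ⟨Re, R', hle, hj W' hW', hP _ (hW'.trans (W'.le_add e)) (W'.mem_add e)⟩

theorem toks_le {n : ℕ} {a b : Fin 5} (hab : a ≠ b) :
    ({(n, a)} + {(n, b)} : Multiset Tok) ≤ allToks n := by
  rw [Multiset.le_iff_subset (by simpa using hab)]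
  intro t ht
  rw [mem_allToks]
  simp only [Multiset.mem_add, Multiset.mem_singleton] at ht
  rcases ht with rfl | rfl <;> rfl

theorem GoodMsg.exp_g {s : ℕ} {i : Info} (h : W.info s = some i) (hi : i ≠ .ea) :
    GoodMsg md W (.exp .g (.priv s)) := .exp .g (GoodMsg.priv h hi)

/-! ### Parts common to both versions -/

/-- Nothing is known about the table of marks; all that the candidate learns comes from the entry of
`zkpeq` that equals the hash of its own data. -/
theorem safe_acceptMark {V : Env} {pkC h p' : Term} {rec : Term → Term}
    (hj : ∀ W', W ≤ W' → ∀ mark, (md → MarkHash W' (.hash (rec mark))) →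
      JustInv md W' (.notified p' h mark) R) :
    ESafe md (acceptMark V pkC h p' rec) W R := by
  refine safe_lookup fun W₁ l₁ Ms _ _ => safe_lookup fun W₂ l₂ Ms' hMs hMs' => ?_
  obtain ⟨x, y, rfl, hx, hy⟩ := matches_two hMs'
  have hx := hx _ rfl
  have hy := hy _ rfl
  rcases hMs with ⟨X, k, s, e, -⟩ | ⟨X, v, e, hX⟩ <;>
    simp only [List.cons.injEq, and_true] at e <;> obtain ⟨rfl, rfl⟩ := e
  · exact (key_ne_spk hy.symm).elim
  refine safe_cond fun e => safe_cond fun _ => ?_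
  refine safe_event (Re := R) (R' := 0) (by simp) (fun W₃ l₃ => ?_) fun _ _ _ => trivial
  refine hj W₃ (l₁.trans (l₂.trans l₃)) _ fun hm => ?_
  obtain ⟨e', d, x', q, a, m, t, x'', h, h₁, h₂, h₃, h₄, h₅, h₆, h₇, h₈, h₉⟩ := (hX hm).mono l₃
  exact ⟨e', d, x', q, a, m, t, x'', h, h₁, h₂, h₃, h₄, h₅, h₆, h₇, h₈, e.trans (hx.trans h₉)⟩

theorem safe_storeMark {V : Env} {h p' t q : Term} (hp' : GoodMsg md W p') :
    ESafe md (storeMark V h p' t q) W R :=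
  safe_lookup fun _ l₁ _ _ _ => safe_recv fun _ l₂ _ _ => safe_cond fun _ =>
    safe_out (hp'.mono (l₁.trans l₂)) <| safe_recv fun _ _ _ _ => safe_lookup fun _ _ _ _ _ =>
    safe_insert trivial trivial

theorem safe_returnMark {V : Env} {sk t q mark hma : Term} (hsk : GoodMsg md W sk)
    (ht : GoodMsg md W t) (hq : GoodMsg md W q) (hmark : GoodMsg md W mark)
    (hh : GoodMsg md W hma) (hM : md → MarkHash W hma) :
    ESafe md (returnMark V sk t q mark hma) W R := by
  refine safe_insert (.inr ⟨_, _, rfl, hM⟩) <| safe_out ?_ trivial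
  have := Built.exp hh hsk
  exact .pair hmark (.pair hh (.pair this (.pair (.xproof hh this ht hq hsk)
    (.pair ht (.pair hq .unit)))))

/-- The marks of a marking are good. -/
def MarkingOK (md : Prop) (W : World) (M : Marking) : Prop :=
  (∀ x ∈ M.special, GoodMsg md W x.2) ∧ GoodMsg md W M.default

theorem MarkingOK.mono {W W' : World} (hW : W ≤ W') {M : Marking} (h : MarkingOK md W M) :
    MarkingOK md W' M := ⟨fun x hx => (h.1 x hx).mono hW, h.2.mono hW⟩

theorem safe_markWith {M : Marking} (hM : MarkingOK md W M) {a : Term} {P : Term → Proc}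
    (hP : ∀ m, GoodMsg md W m → ESafe md (P m) W R) :
    ESafe md (markWith M.special M.default a P) W R := by
  obtain ⟨l, m⟩ := M
  obtain ⟨h₁, h₂⟩ := hM
  dsimp only at *
  induction l with
  | nil => exact hP m h₂
  | cons x l ih =>
    exact ⟨fun _ => hP _ (h₁ x (by simp)), fun _ => ih fun y hy => h₁ y (by simp [hy])⟩

theorem safe_chooseExaminer {asg : List (Term × Term)} {p' h : Term} {P : Term → Term → Proc}
    (hP : ∀ W', W ≤ W' → ∀ t q, GoodMsg md W' q → ESafe md (P t q) W' R) :
    ESafe md (chooseExaminer asg p' h P) W R := by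
  induction asg generalizing W with
  | nil =>
    refine safe_lookup fun W' hW' Ms hMs _ => ?_
    obtain ⟨t, q, h, z, id, rfl, hq⟩ := hMs
    exact hP W' hW' t q hq
  | cons x l ih =>
    refine ⟨fun W₁ l₁ _ _ _ => safe_lookup fun W' hW' Ms hMs _ => ?_, ih hP⟩
    obtain ⟨t, q, h, z, id, rfl, hq⟩ := hMs
    exact hP W' (l₁.trans hW') t q hq

/-- The roles of a protocol respect the discipline. -/
structure RolesOK (md : Prop) (P : ExamProtocol) : Prop where
  candidate : ∀ W V id a, EnvOK W V → GoodMsg md W id → GoodMsg md W a →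
    ESafe md (P.candidate V id a) W 0
  examiner : ∀ W V id M, EnvOK W V → GoodMsg md W id → MarkingOK md W M →
    ESafe md (P.examiner V id M) W 0
  committee : ∀ W V q, EnvOK W V → GoodMsg md W q → ESafe md (P.committee V q) W 0
  collector : ∀ W V asg, EnvOK W V → ESafe md (P.collector V asg) W 0
  authorities : ∀ W V, EnvOK W V → ESafe md (P.authorities V) W 0

theorem safe_repl {P : Proc} (h : ESafe md P W 0) : ESafe md (.repl P) W R := h

theorem ESafe.weaken {P : Proc} (h : ESafe md P W 0) : ESafe md P W R :=
  h.mono le_rfl (Multiset.zero_le _)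

/-- All roles start without permissions, so they can be composed and replicated freely. -/
theorem RolesOK.safe {P : ExamProtocol} (h : RolesOK md P) {EP : Proc} (hE : EP ∈ P.ExamProcs) :
    ESafe md EP W 0 := by
  have other : ∀ {W : World} {n}, W.info n = some .other → GoodMsg md W (.priv n) :=
    fun hn => GoodMsg.priv hn (by simp)
  rcases hE with rfl | ⟨I, -, hI, rfl⟩
  · refine safe_repl (safe_setup (R := 0) ?_)
    intro W₁ l₁ V hV
    refine safe_par ?_ <| safe_par ?_ <| safe_par ?_ <|
      safe_par (h.collector _ _ _ hV) (h.authorities _ _ hV)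
    · refine safe_repl <| safe_new (R := 0) .other fun W₂ l₂ n hn => safe_new .other fun W₃ l₃ n' hn' => ?_
      exact (h.candidate _ _ _ _ (hV.mono (l₂.trans l₃)) (other (l₃.1 _ _ hn)) (other hn')).weaken
    · refine safe_repl <| safe_new (R := 0) .other fun W₂ l₂ n hn => safe_new .other fun W₃ l₃ n' hn' => ?_
      exact (h.examiner _ _ _ _ (hV.mono (l₂.trans l₃)) (other (l₃.1 _ _ hn))
        ⟨by simp [Marking.const], other hn'⟩).weaken
    · refine safe_new (R := 0) .other fun W₂ l₂ n hn => ?_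
      exact (h.committee _ _ _ (hV.mono l₂) (other hn)).weaken
  · have pub : ∀ {W n}, GoodMsg md W (.pub n) := .pub trivial
    refine safe_setup (R := 0) fun W₁ l₁ V hV => ?_
    refine safe_par (safe_parList ?_) <| safe_par (safe_parList ?_) <|
      safe_par (h.committee _ _ _ hV pub) <|
      safe_par (h.collector _ _ _ hV) (h.authorities _ _ hV)
    · simp only [List.mem_map]
      rintro _ ⟨x, -, rfl⟩
      exact h.candidate _ _ _ _ hV pub pub
    · simp only [List.mem_map]
      rintro _ ⟨x, hx, rfl⟩
      obtain ⟨l, m, hM⟩ := hI x hx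
      rw [hM]
      refine h.examiner _ _ _ _ hV pub ⟨?_, pub⟩
      simp only [mkMarking, List.mem_map]
      rintro _ ⟨y, -, rfl⟩
      exact pub

/-! ### The original protocol -/

/-- For the original protocol no secret is protected; what remains of the discipline is the tables
and the payment for `submitted`. -/
theorem goodMsg_false (M : Term) : GoodMsg False W M := by
  induction M with
  | var => exact .var
  | pub => exact .pub trivial
  | priv => exact Built.priv False.elim
  | sign _ _ h h' => exact .sign h h' trivial
  | spk _ h => exact .spk h
  | _ => constructor <;> assumption

namespace HusztiPetho

theorem safe_candidate {V : Env} {id a : Term} : ESafe False (candidate V id a) W R := by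
  have good := fun {W} => goodMsg_false (W := W)
  refine safe_candidatePrep (good _) fun W₁ l₁ pkC h r p p' zkp quest k ro _ _ hp hreg => ?_
  refine safe_event (toks_le (a := 0) (b := 1) (by decide))
    (fun W₂ l₂ => ⟨k, ro, hp.mono l₂, World.mem_of_le l₂ hreg, by simp⟩) fun W₂ l₂ _ => ?_
  exact safe_out (good _) <| safe_inp fun _ _ _ _ => safe_cond fun _ =>
    safe_acceptMark fun _ _ _ _ => False.elim

theorem safe_examiner {V : Env} {id : Term} {M : Marking} :
    ESafe False (examiner V id M) W R := by
  have good := fun {W} => goodMsg_false (W := W)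
  refine safe_examinerPrep (good _) fun W₁ l₁ k h b q _ _ _ => ?_
  refine safe_recv fun _ _ _ _ => safe_cond fun _ => safe_recv fun _ _ _ _ =>
    safe_markWith ⟨fun _ _ => good _, good _⟩ fun _ _ => ?_
  exact safe_event (Re := 0) (R' := 0) (by simp) (fun _ _ => False.elim) fun _ _ _ =>
    safe_returnMark (good _) (good _) (good _) (good _) (good _) False.elim

theorem safe_exam {V : Env} {asg : List (Term × Term)} {h s quest squest : Term} :
    ESafe False (exam V asg h s quest squest) W R := by
  have good := fun {W} => goodMsg_false (W := W)
  refine safe_recv fun _ _ _ _ => safe_cond fun _ => safe_inp fun _ _ _ _ => safe_cond fun _ =>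
    safe_cond fun _ => safe_out (good _) <| safe_recv fun _ _ _ _ => ?_
  refine safe_event (Re := 0) (R' := 0) (by simp) (fun _ _ => False.elim) fun _ _ _ =>
    safe_out (good _) <| safe_chooseExaminer fun _ _ _ _ _ => safe_new .other fun _ _ _ _ => ?_
  exact safe_event (Re := 0) (R' := 0) (by simp) (fun _ _ => False.elim) fun _ _ _ =>
    safe_out (good _) <| safe_storeMark (good _)

theorem safe_candidateReg {V : Env} {asg : List (Term × Term)} {s : ℕ} {quest squest : Term}
    (hs : W.info s = some .secret) :
    ESafe False (candidateReg V asg (.exp .g (.priv s)) (.priv s) quest squest) W R := by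
  have good := fun {W} => goodMsg_false (W := W)
  refine safe_lookup fun W₁ l₁ Ms hMs _ => ?_
  obtain ⟨A, k, rfl, hk⟩ := hMs
  refine safe_insert trivial <| safe_out (good _) <| safe_insert ?_ <|
    safe_recv fun _ _ _ _ => safe_out (good _) safe_exam
  exact .inl ⟨_, k, s, rfl, .refl _, hk, l₁.1 _ _ hs, good _⟩

theorem safe_examAuthority {V : Env} {asg : List (Term × Term)} :
    ESafe False (examAuthority V asg) W R := by
  have good := fun {W} => goodMsg_false (W := W)
  refine safe_new .secret fun W₁ l₁ s hs => safe_out (good _) <| safe_recv fun W₂ l₂ m _ => ?_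
  exact safe_par (safe_examinerReg (R := 0) (l₂.1 _ _ hs))
    (safe_candidateReg (R := 0) (l₂.1 _ _ hs))

theorem safe_net : ESafe False net W R := by
  have good := fun {W} => goodMsg_false (W := W)
  refine safe_recv fun W₁ l₁ m _ => safe_new .net fun W₂ l₂ ro hro => ?_
  refine safe_event (Re := 0) (R' := 0) (by simp) (fun _ _ => trivial) fun W₃ l₃ hreg => ?_
  refine safe_out (good _) <| safe_insert ⟨_, ro, rfl, l₃.1 _ _ hro, hreg, good _⟩ ?_
  exact safe_inp fun _ _ _ _ => safe_cond fun _ => safe_out (good _) trivial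

theorem rolesOK : RolesOK False husztiPetho where
  candidate _ _ _ _ _ _ _ := safe_candidate
  examiner _ _ _ _ _ _ _ := safe_examiner
  committee _ _ _ hV hq := safe_committee hV hq
  collector _ _ _ _ := safe_examAuthority (R := 0)
  authorities _ _ _ := safe_net (R := 0)

end HusztiPetho

/-! ### The modified protocol -/

namespace ModifiedHP

/-- Of the three kinds of messages signed by the EA, only receipts have a hash as normal form; the
others are exponentials and pairs. -/
theorem signed_receipt {h r p c z q a t : Term} (hs : Signed W (receipt h r p c z q a t)) :
    ∃ e d, W.info e = some (.eap d) ∧ h ≈ₑ d.h ∧ c ≈ₑ d.c ∧ q ≈ₑ d.q ∧ a ≈ₑ d.a ∧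
      t ≈ₑ .priv e := by
  simp only [eqv_iff]
  rcases hs with ⟨x, y, hs⟩ | ⟨e, d, r', p', z', h₁, hs⟩ | ⟨e, d, x, h₁, h₂, hs⟩ <;>
    have hs := hs.nf_eq
  · obtain ⟨x', y', e⟩ := mkExp_eq_exp x.nf y.nf
    simp [receipt, nf, e] at hs
  · simp only [receipt, tup, nf, hash.injEq, pair.injEq] at hs
    exact ⟨e, d, h₁, hs.1, hs.2.2.2.1, hs.2.2.2.2.2.1, hs.2.2.2.2.2.2.1, hs.2.2.2.2.2.2.2.1⟩
  · simp [receipt, test, tup, nf] at hs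

theorem signed_test {t h q a x : Term} (hs : Signed W (test t h q a x)) :
    ∃ e d x', W.info e = some (.eap d) ∧
      .distributed d.c d.h d.q d.a (.priv e) x' ∈ W.es ∧ t ≈ₑ .priv e ∧ h ≈ₑ d.h ∧ q ≈ₑ d.q ∧
      a ≈ₑ d.a ∧ x ≈ₑ x' := by
  simp only [eqv_iff]
  rcases hs with ⟨x', y, hs⟩ | ⟨e, d, r', p', z', h₁, hs⟩ | ⟨e, d, x', h₁, h₂, hs⟩ <;>
    have hs := hs.nf_eq
  · obtain ⟨x', y', e⟩ := mkExp_eq_exp x'.nf y.nf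
    simp [test, tup, nf, e] at hs
  · simp [receipt, test, tup, nf] at hs
  · simp only [test, tup, nf, pair.injEq] at hs
    exact ⟨e, d, x', h₁, h₂, hs.1, hs.2.1, hs.2.2.1, hs.2.2.2.1, hs.2.2.2.2.1⟩

/-- The signed receipt of submission names a test identifier, whose purpose fixes the data of the
test. The receipt of marking has to contain the same identifier, so both concern the same test. -/
theorem safe_candidate {V : Env} {id a : Term} (hV : EnvOK W V) (hid : GoodMsg True W id)
    (ha : GoodMsg True W a) : ESafe True (candidate V id a) W R := by
  refine safe_candidatePrep hid fun W₁ l₁ pkC h r p p' zkp quest k ro hr hp hps hreg => ?_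
  refine safe_event (toks_le (a := 0) (b := 1) (by decide))
    (fun W₂ l₂ => ⟨k, ro, hps.mono l₂, World.mem_of_le l₂ hreg, by simp⟩) fun W₂ l₂ _ => ?_
  refine safe_out (.pair (hr.mono l₂) (.pair (hp.mono l₂) (.pair (ha.mono (l₁.trans l₂)) .unit))) ?_
  refine safe_recv fun W₃ l₃ m hm => safe_cond fun hc => ?_
  have l₁₃ := l₁.trans (l₂.trans l₃)
  obtain ⟨e, d, hd, eh, ec, eq, ea, et⟩ := signed_receipt <|
    (hV.mono l₁₃).signed trivial (hm 1) hc.symm (by simp [receipt, nf])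
  refine safe_acceptMark fun W₄ l₄ mark hM => fun _ => ?_
  obtain ⟨e', d', x, q, a', m', t, x', h', h₁, h₂, h₃, h₄, h₅, h₆, h₇, h₈, h₉⟩ := hM trivial
  have h₉ := h₉.nf_eq
  simp only [tup, nf, hash.injEq, pair.injEq, and_true] at h₉
  -- The identifiers agree by injectivity of the hash; hence so do the data recorded with them.
  have hee : e = e' := by
    have := (et.symm.trans ((eqv_iff.2 h₉.2.2).trans h₆)).nf_eq
    simpa [nf] using this
  subst hee
  obtain rfl : d = d' := by simpa [l₄.1 _ _ hd] using h₁
  exact ⟨k, ro, e, d, x, q, a', m', t, x', h', hps.mono (l₂.trans (l₃.trans l₄)), by simp, h₁, ec,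
    eh, eqv_iff.2 h₉.1, h₂, h₃, h₄, h₅, h₆, h₇, h₈⟩

/-- The signature shows that the test was distributed to this very pseudonym. The event `marked`
uses up the permissions of the key and then justifies the receipt that is stored. -/
theorem safe_examiner {V : Env} {id : Term} {M : Marking} (hV : EnvOK W V)
    (hid : GoodMsg True W id) (hM : MarkingOK True W M) : ESafe True (examiner V id M) W R := by
  refine safe_examinerPrep hid fun W₁ l₁ k h b q hk hb hq => ?_
  refine safe_recv fun W₂ l₂ m hm => safe_cond fun _ => safe_recv fun W₃ l₃ m' hm' =>
    safe_cond fun hc => ?_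
  have l := l₁.trans (l₂.trans l₃)
  obtain ⟨e, d, x', hd, hdist, et, eh, eq, ea, ex⟩ := signed_test <|
    (hV.mono l).signed trivial (hm' 2) hc.symm (by simp [test, tup, nf])
  refine safe_markWith (hM.mono l) fun mark hmark => ?_
  refine safe_event (Re := allToks k) (R' := 0) (by simp) (fun W₄ l₄ _ => ?_)
    fun W₄ l₄ hmk => ?_
  · exact ⟨e, d, x', .priv b, k, l₄.1 _ _ hd, World.mem_of_le l₄ hdist, et, eq, ea, eh, ex,
      hq ▸ .refl _, mem_allToks.2 rfl⟩
  · have hk : GoodMsg True W₄ (.priv k) :=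
      GoodMsg.priv ((l₂.trans (l₃.trans l₄)).1 _ _ hk) (by simp)
    have hb : GoodMsg True W₄ (.priv b) :=
      GoodMsg.priv ((l₂.trans (l₃.trans l₄)).1 _ _ hb) (by simp)
    have hgb := Built.exp .g hb
    refine safe_returnMark hk hgb (hq ▸ .exp hgb hk) (hmark.mono l₄)
      (.hash (.pair (hmark.mono l₄) (.pair ((hm' 1).mono l₄) (.pair ((hm' 0).mono l₄) .unit)))) ?_
    exact fun _ => ⟨e, d, x', _, _, _, _, _, _, l₄.1 _ _ hd, World.mem_of_le l₄ hdist, hmk, eq, ea,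
      et, ex, eh, .refl _⟩

/-- The permissions received with the pseudonym pay for `collected` and `distributed`. As the
purpose of the identifier already records the data of the test, the receipt can be signed before an
examiner is chosen. The registered term `c` is kept apart from `p'`, to which it is equal only
modulo the theory. -/
theorem safe_exam {V : Env} {asg : List (Term × Term)} {h quest squest p' c : Term}
    {s k ro : ℕ} (hV : EnvOK W V) (hs : W.info s = some .secret) (hh : h = .exp .g (.priv s))
    (hq : GoodMsg True W quest) (hsq : GoodMsg True W squest) (hp' : GoodMsg True W p')
    (hps : Pseudo W p' k ro) (hreg : .registered c ∈ W.es) (hc : c ≈ₑ p') :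
    ESafe True (exam V asg h (.priv s) quest squest p') W {(ro, 2), (ro, 3)} := by
  refine safe_recv fun W₁ l₁ m hm => safe_cond fun _ => safe_inp fun W₂ l₂ zkp hz =>
    safe_cond fun _ => safe_cond fun _ => ?_
  have l₂' := l₁.trans l₂
  refine safe_out (.pair (hq.mono l₂') (.pair (hsq.mono l₂') .unit)) <|
    safe_recv fun W₃ l₃ m' hm' => ?_
  have l₃' := l₂'.trans l₃
  refine safe_event (Re := {(ro, 2)}) (R' := {(ro, 3)}) (by simp) (fun W₄ l₄ _ =>
    ⟨k, ro, c, hps.mono (l₃'.trans l₄), World.mem_of_le (l₃'.trans l₄) hreg, hc, by simp⟩)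
    fun W₄ l₄ hcol => ?_
  refine safe_new (.eap ⟨p', h, quest, m' 2⟩) fun W₅ l₅ e he => ?_
  have l₅' := l₃'.trans (l₄.trans l₅)
  have hgh : GoodMsg True W₅ h := hh ▸ GoodMsg.exp_g (l₅'.1 _ _ hs) (by simp)
  have hge : GoodMsg True W₅ (.priv e) := GoodMsg.priv he (by simp)
  have hga := (hm' 2).mono (l₄.trans l₅)
  have hrc : GoodMsg True W₅ (receipt h (m 0) (m 1) p' zkp quest (m' 2) (.priv e)) := by
    refine .hash (GoodMsg.tup ?_)
    have l := l₃.trans (l₄.trans l₅)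
    simp only [List.mem_cons, List.not_mem_nil, or_false, forall_eq_or_imp, forall_eq]
    exact ⟨hgh, (hm 0).mono (l₂.trans l), (hm 1).mono (l₂.trans l), hp'.mono l₅', hz.mono l,
      hq.mono l₅', hga, hge⟩
  refine safe_out (.pair hge (.pair ((hV.mono l₅').good_sign hrc ?_) .unit)) ?_
  · exact .inr (.inl ⟨e, _, _, _, _, he, .refl _⟩)
  refine safe_chooseExaminer fun W₆ l₆ t q hgq => ?_
  refine safe_event (Re := {(ro, 3)}) (R' := 0) (by simp) (fun W₇ l₇ _ => ?_) fun W₇ l₇ hd => ?_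
  · exact ⟨k, ro, e, hps.mono (l₅'.trans (l₆.trans l₇)), rfl, (l₆.trans l₇).1 _ _ he,
      World.mem_of_le (l₅.trans (l₆.trans l₇)) hcol, by simp⟩
  have l := l₆.trans l₇
  have hgt : GoodMsg True W₇ (test (.priv e) h quest (m' 2) q) := by
    refine GoodMsg.tup ?_
    simp only [List.mem_cons, List.not_mem_nil, or_false, forall_eq_or_imp, forall_eq]
    exact ⟨hge.mono l, hgh.mono l, hq.mono (l₅'.trans l), hga.mono l, hgq.mono l₇⟩
  refine safe_out (.pair (hge.mono l) (.pair (hga.mono l)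
    (.pair ((hV.mono (l₅'.trans l)).good_sign hgt ?_) .unit))) ?_
  · exact .inr (.inr ⟨e, _, q, l.1 _ _ he, hd, .refl _⟩)
  · exact safe_storeMark (hp'.mono (l₅'.trans l))

theorem proj_one_tup (a b : Term) : proj 1 (tup [a, b]) ≈ₑ b := by
  rw [eqv_iff]; simp [proj, tup, nf]

theorem proj_zero_tup (a b : Term) : proj 0 (tup [a, b]) ≈ₑ a := by
  rw [eqv_iff]; simp [proj, tup, nf]

/-- Over the private channel comes a pseudonym that the NET has registered, with permissions that no
other session of the EA owns. -/
theorem safe_candidateReg {V : Env} {asg : List (Term × Term)} {s : ℕ} {quest squest : Term}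
    (hV : EnvOK W V) (hs : W.info s = some .secret) (hq : GoodMsg True W quest)
    (hsq : GoodMsg True W squest) :
    ESafe True (candidateReg V asg (.exp .g (.priv s)) (.priv s) quest squest) W R := by
  refine safe_lookup fun W₁ l₁ Ms hMs _ => ?_
  obtain ⟨A, k, rfl, hk⟩ := hMs
  have hV' := hV
  obtain ⟨kE, kC, n, n', rfl, h₁, h₂, hn, hn'⟩ := hV'
  refine safe_insert trivial ⟨0, 0, by simp, .inl ⟨l₁.1 _ _ hn, k, s, hk, l₁.1 _ _ hs, rfl⟩, ?_⟩
  refine safe_insert (.inl ⟨_, k, s, rfl, .refl _, hk, l₁.1 _ _ hs, ?_⟩) ?_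
  · exact .exp (GoodMsg.exp_g hk (by simp)) (GoodMsg.priv (l₁.1 _ _ hs) (by simp))
  -- The purpose of the channel decides between the two forms of private messages.
  rintro W₂ l₂ x Rm (⟨h, -⟩ | ⟨h, pT, c, k', ro, rfl, hps, hgc, hreg, rfl⟩)
  · simp [(l₁.trans l₂).1 _ _ hn'] at h
  refine safe_cond fun _ => ?_
  have hp' := Built.proj hgc 1
  have e := proj_one_tup pT c
  have l₂' := l₁.trans l₂
  refine safe_recv fun W₃ l₃ m hm => ?_
  have hgs : GoodMsg True W₃ (.priv s) := GoodMsg.priv ((l₂'.trans l₃).1 _ _ hs) (by simp)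
  refine safe_out (.xproof (hm 0) (GoodMsg.mono l₃ hp') .g (.exp .g hgs) hgs) ?_
  have l := l₂'.trans l₃
  refine (safe_exam (hV.mono l) (l.1 _ _ hs) rfl (hq.mono l) (hsq.mono l) (GoodMsg.mono l₃ hp')
    ((hps.congr e).mono l₃) (World.mem_of_le l₃ hreg) e.symm).mono le_rfl ?_
  exact Multiset.le_add_left _ _

theorem safe_examAuthority {V : Env} {asg : List (Term × Term)} (hV : EnvOK W V) :
    ESafe True (examAuthority V asg) W R := by
  refine safe_new .secret fun W₁ l₁ s hs => ?_
  have hh : GoodMsg True W₁ (.exp .g (.priv s)) := GoodMsg.exp_g hs (by simp)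
  refine safe_out (.pair hh (.pair ((hV.mono l₁).good_sign hh (.inl ⟨_, _, .refl _⟩)) .unit)) ?_
  refine safe_recv fun W₂ l₂ m hm => ?_
  exact safe_par (safe_examinerReg (R := 0) (l₂.1 _ _ hs))
    (safe_candidateReg (R := 0) (hV.mono (l₁.trans l₂)) (l₂.1 _ _ hs) (hm 0) (hm 1))

/-- The private channel guarantees a genuine partial pseudonym, so the result is a pseudonym in the
sense of `Pseudo`. The NET gets the permissions of `ro` with the name and passes two of them on. -/
theorem safe_net {V : Env} (hV : EnvOK W V) : ESafe True (net V) W R := by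
  obtain ⟨kE, kC, n, n', rfl, h₁, h₂, hn, hn'⟩ := hV
  rintro W₁ l₁ x Rm (⟨-, k, s, hk, hs, rfl⟩ | ⟨h, -⟩)
  swap
  · simp [l₁.1 _ _ hn] at h
  refine safe_cond fun _ => ?_
  have e := proj_zero_tup (.exp (.exp .g (.priv k)) (.priv s)) .gC
  have hx : ∀ {W'}, W₁ ≤ W' → GoodMsg True W' (proj 0 (tup [.exp (.exp .g (.priv k)) (.priv s), .gC])) := fun l =>
    Built.proj (.pair (.exp (GoodMsg.exp_g (l.1 _ _ hk) (by simp))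
      (GoodMsg.priv (l.1 _ _ hs) (by simp))) (.pair .gC .unit)) 0
  refine safe_new .net fun W₂ l₂ ro hro => ?_
  refine safe_event (Re := 0) (R' := allToks ro) (by simp) (fun _ _ => trivial) fun W₃ l₃ hreg => ?_
  have l₂₃ := l₂.trans l₃
  have hgro : ∀ {W'}, W₃ ≤ W' → GoodMsg True W' (.priv ro) := fun l =>
    GoodMsg.priv ((l₃.trans l).1 _ _ hro) (by simp)
  have hp := Built.exp (hx l₂₃) (hgro le_rfl)
  refine safe_out (.pair hp (.pair (.exp .g (hgro le_rfl)) .unit)) ?_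
  refine safe_insert ⟨_, ro, rfl, l₃.1 _ _ hro, hreg, hx l₂₃⟩ ?_
  refine ⟨{(ro, 2)} + {(ro, 3)}, 0, by simpa using toks_le (by decide), .inr
    ⟨(l₁.trans l₂₃).1 _ _ hn', _, _, k, ro, rfl, ?_, .pair (hx l₂₃) (.pair hp .unit), hreg, rfl⟩, ?_⟩
  · exact ⟨s, l₂₃.1 _ _ hk, l₂₃.1 _ _ hs, l₃.1 _ _ hro, .exp e (.refl _)⟩
  refine safe_inp fun W₄ l₄ x hx' => safe_cond fun _ => safe_out ?_ trivial
  have := hx (l₂₃.trans l₄)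
  exact .pair (.exp this (hgro l₄)) (.pair this .unit)

theorem rolesOK : RolesOK True modifiedHusztiPetho where
  candidate _ _ _ _ hV hid ha := safe_candidate hV hid ha
  examiner _ _ _ _ hV hid hM := safe_examiner hV hid hM
  committee _ _ _ hV hq := safe_committee hV hq
  collector _ _ _ hV := safe_examAuthority (R := 0) hV
  authorities _ _ hV := safe_net (R := 0) hV

end ModifiedHP

/-! ### The authentication requirements -/

theorem mem_take_iff {es : List Event} {i : ℕ} {e : Event} :
    e ∈ es.take i ↔ ∃ j < i, es[j]? = some e := by
  rw [List.mem_iff_getElem?]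
  simp only [List.getElem?_take]
  constructor
  · rintro ⟨j, hj⟩
    split_ifs at hj with h
    exact ⟨j, h, hj⟩
  · rintro ⟨j, h, hj⟩
    exact ⟨j, by rw [if_pos h, hj]⟩

/-- A correspondence is injective if occurrences with the same witness are equal. -/
theorem injCorr_of {es : List Event} {L : Event → Prop} {Rel : Event → Event → Prop}
    (h : ∀ i e, es[i]? = some e → L e → ∃ e' ∈ es.take i, Rel e e')
    (hinj : ∀ (i i' : ℕ) (e e' e'' : Event), es[i]? = some e → es[i']? = some e' → L e → L e' → Rel e e'' →
      Rel e' e'' → i = i') : InjCorr es L Rel := by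
  classical
  have h' : ∀ i : ℕ, ∃ j : ℕ, ∀ e, es[i]? = some e → L e → j < i ∧ ∃ e', es[j]? = some e' ∧ Rel e e' := by
    intro i
    by_cases hi : ∃ e, es[i]? = some e ∧ L e
    · obtain ⟨e, he, hL⟩ := hi
      obtain ⟨e', he', hR⟩ := h i e he hL
      obtain ⟨j, hj, hj'⟩ := mem_take_iff.1 he'
      refine ⟨j, fun e₁ he₁ _ => ⟨hj, e', hj', ?_⟩⟩
      obtain rfl := Option.some.inj (he.symm.trans he₁)
      exact hR
    · exact ⟨0, fun e he hL => absurd ⟨e, he, hL⟩ hi⟩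
  choose f hf using h'
  refine ⟨f, ?_, fun i e he hL => hf i e he hL⟩
  rintro i ⟨e, he, hL⟩ i' ⟨e', he', hL'⟩ hii
  obtain ⟨-, e₁, h₁, h₂⟩ := hf i e he hL
  obtain ⟨-, e₂, h₃, h₄⟩ := hf i' e' he' hL'
  rw [← hii, h₁] at h₃
  obtain rfl := Option.some.inj h₃
  exact hinj i i' e e' e₁ he he' hL hL' h₂ h₄

/-- A correspondence with two events is injective if occurrences that share one of the two
witnesses are equal. -/
theorem injCorr₂_of {es : List Event} {L : Event → Prop} {Rel : Event → Event → Event → Prop}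
    (h : ∀ i e, es[i]? = some e → L e → ∃ e₁ ∈ es.take i, ∃ e₂ ∈ es.take i, Rel e e₁ e₂)
    (hinj : ∀ (i i' : ℕ) (e e' e₁ e₂ e₁' e₂' : Event), es[i]? = some e → es[i']? = some e' → L e → L e' →
      e₁ ∈ es → e₂ ∈ es → e₁' ∈ es → e₂' ∈ es →
      Rel e e₁ e₂ → Rel e' e₁' e₂' → (e₁ = e₁' ∨ e₂ = e₂') → i = i') : InjCorr₂ es L Rel := by
  classical
  have h' : ∀ i : ℕ, ∃ j j' : ℕ, ∀ e, es[i]? = some e → L e → j < i ∧ j' < i ∧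
      ∃ e₁ e₂, es[j]? = some e₁ ∧ es[j']? = some e₂ ∧ Rel e e₁ e₂ := by
    intro i
    by_cases hi : ∃ e, es[i]? = some e ∧ L e
    · obtain ⟨e, he, hL⟩ := hi
      obtain ⟨e₁, he₁, e₂, he₂, hR⟩ := h i e he hL
      obtain ⟨j, hj, hj'⟩ := mem_take_iff.1 he₁
      obtain ⟨k, hk, hk'⟩ := mem_take_iff.1 he₂
      refine ⟨j, k, fun e' he' _ => ⟨hj, hk, e₁, e₂, hj', hk', ?_⟩⟩
      obtain rfl := Option.some.inj (he.symm.trans he')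
      exact hR
    · exact ⟨0, 0, fun e he hL => absurd ⟨e, he, hL⟩ hi⟩
  choose f f' hf using h'
  have key : ∀ i i' e e', es[i]? = some e → es[i']? = some e' → L e → L e' →
      (f i = f i' ∨ f' i = f' i') → i = i' := by
    intro i i' e e' he he' hL hL' hii
    obtain ⟨-, -, e₁, e₂, h₁, h₂, h₃⟩ := hf i e he hL
    obtain ⟨-, -, e₃, e₄, h₄, h₅, h₆⟩ := hf i' e' he' hL'
    refine hinj i i' e e' e₁ e₂ e₃ e₄ he he' hL hL' (List.mem_of_getElem? h₁)
      (List.mem_of_getElem? h₂) (List.mem_of_getElem? h₄) (List.mem_of_getElem? h₅) h₃ h₆ ?_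
    rcases hii with hii | hii
    · rw [← hii, h₁] at h₄
      exact .inl (Option.some.inj h₄)
    · rw [← hii, h₂] at h₅
      exact .inr (Option.some.inj h₅)
  refine ⟨f, f', ?_, ?_, fun i e he hL => hf i e he hL⟩
  · rintro i ⟨e, he, hL⟩ i' ⟨e', he', hL'⟩ hii
    exact key i i' e e' he he' hL hL' (.inl hii)
  · rintro i ⟨e, he, hL⟩ i' ⟨e', he', hL'⟩ hii
    exact key i i' e e' he he' hL hL' (.inr hii)


/-- A trace all of whose events are justified, with distinct permissions. -/
structure GoodTrace (md : Prop) (info : ℕ → Option Info) (tok : ℕ → Multiset Tok)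
    (es : List Event) : Prop where
  just : ∀ i e, es[i]? = some e → JustInv md ⟨info, es.take i⟩ e (tok i)
  tok_inj : ∀ i j t, t ∈ tok i → t ∈ tok j → i = j

theorem RolesOK.trace {P : ExamProtocol} (h : RolesOK md P) {EP : Proc} (hE : EP ∈ P.ExamProcs)
    {es : List Event} {B : Config} (hx : Exec (Config.init EP) es B) :
    ∃ info tok, GoodTrace md info tok es := by
  obtain ⟨info, tok, h₁, h₂⟩ := (h.safe hE).trace hx
  exact ⟨info, tok, h₁, h₂⟩

/-- Pseudonyms do not depend on the events. -/
theorem Pseudo.events {info : ℕ → Option Info} {es es' : List Event} {c k ro}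
    (h : Pseudo ⟨info, es⟩ c k ro) : Pseudo ⟨info, es'⟩ c k ro := h

theorem Event.eqv_registered {e : Event} {c : Term} (h : e.Eqv (.registered c)) :
    ∃ c', e = .registered c' ∧ c' ≈ₑ c := by
  cases e <;> simp_all [Event.Eqv]

theorem Event.eqv_collected {e : Event} {c h q a : Term} (H : e.Eqv (.collected c h q a)) :
    ∃ c' h' q' a', e = .collected c' h' q' a' ∧ c' ≈ₑ c := by
  cases e <;> simp_all [Event.Eqv]

theorem Event.eqv_distributed {e : Event} {c h q a t x : Term}
    (H : e.Eqv (.distributed c h q a t x)) :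
    ∃ c' h' q' a' t' x', e = .distributed c' h' q' a' t' x' ∧ c' ≈ₑ c ∧ t' ≈ₑ t ∧ x' ≈ₑ x := by
  cases e <;> simp_all [Event.Eqv]

theorem Event.eqv_marked {e : Event} {q a m t x h : Term} (H : e.Eqv (.marked q a m t x h)) :
    ∃ q' a' m' t' x' h', e = .marked q' a' m' t' x' h' ∧ t' ≈ₑ t := by
  cases e <;> simp_all [Event.Eqv]

/-- Submissions with the same registration have equal pseudonyms, hence the same candidate key, and
its permission 0 is spent only once. -/
theorem RolesOK.candidateAuthorisation {P : ExamProtocol} (H : RolesOK md P) :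
    P.CandidateAuthorisation := by
  intro EP hE es B hx
  obtain ⟨info, tok, hT⟩ := H.trace hE hx
  refine injCorr_of ?_ ?_
  · rintro i _ he ⟨c, h, q, a, rfl⟩
    obtain ⟨k, ro, h₁, h₂, h₃⟩ := hT.just i _ he
    exact ⟨_, h₂, c, h, q, a, rfl, .refl c⟩
  · rintro i i' _ _ e he he' ⟨c, h, q, a, rfl⟩ ⟨c', h', q', a', rfl⟩ ⟨_, _, _, _, e₁, h₁⟩
      ⟨_, _, _, _, e₂, h₂⟩
    cases e₁; cases e₂
    obtain ⟨k, ro, h₃, -, h₄⟩ := hT.just i _ he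
    obtain ⟨k', ro', h₃', -, h₄'⟩ := hT.just i' _ he'
    obtain ⟨d, rfl, h₁⟩ := Event.eqv_registered h₁
    obtain ⟨d', e, h₂⟩ := Event.eqv_registered h₂
    cases e
    obtain ⟨rfl, -⟩ := h₃.unique h₃'.events (h₁.symm.trans h₂)
    exact hT.tok_inj _ _ _ h₄ h₄'

/-- The same argument, with the NET exponent and its permission 2 in place of the key. -/
theorem RolesOK.testOriginAuthentication {P : ExamProtocol} (H : RolesOK True P) :
    P.TestOriginAuthentication := by
  intro EP hE es B hx
  obtain ⟨info, tok, hT⟩ := H.trace hE hx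
  refine injCorr_of ?_ ?_
  · rintro i _ he ⟨c, h, q, a, rfl⟩
    obtain ⟨k, ro, c', h₁, h₂, h₃, h₄⟩ := hT.just i _ he trivial
    exact ⟨_, h₂, c, h, q, a, rfl, h₃⟩
  · rintro i i' _ _ e he he' ⟨c, h, q, a, rfl⟩ ⟨c', h', q', a', rfl⟩ ⟨_, _, _, _, e₁, h₁⟩
      ⟨_, _, _, _, e₂, h₂⟩
    cases e₁; cases e₂
    obtain ⟨k, ro, _, h₃, -, -, h₄⟩ := hT.just i _ he trivial
    obtain ⟨k', ro', _, h₃', -, -, h₄'⟩ := hT.just i' _ he' trivial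
    obtain ⟨d, rfl, h₁⟩ := Event.eqv_registered h₁
    obtain ⟨d', e, h₂⟩ := Event.eqv_registered h₂
    cases e
    obtain ⟨-, rfl⟩ := h₃.unique h₃'.events (h₁.symm.trans h₂)
    exact hT.tok_inj _ _ _ h₄ h₄'

/-- Distributed tests of the same candidate are the same. -/
theorem GoodTrace.distributed_unique {info : ℕ → Option Info} {tok : ℕ → Multiset Tok}
    {es : List Event} (hT : GoodTrace True info tok es) {c h q a t x c' h' q' a' t' x' : Term}
    (he : Event.distributed c h q a t x ∈ es) (he' : Event.distributed c' h' q' a' t' x' ∈ es)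
    (hc : c ≈ₑ c') : Event.distributed c h q a t x = .distributed c' h' q' a' t' x' := by
  obtain ⟨j, hj⟩ := List.mem_iff_getElem?.1 he
  obtain ⟨j', hj'⟩ := List.mem_iff_getElem?.1 he'
  obtain ⟨k, ro, e, h₃, -, -, -, h₄⟩ := hT.just j _ hj trivial
  obtain ⟨k', ro', e', h₃', -, -, -, h₄'⟩ := hT.just j' _ hj' trivial
  obtain ⟨-, rfl⟩ := h₃.unique h₃'.events hc
  obtain rfl := hT.tok_inj _ _ _ h₄ h₄'
  exact Option.some.inj (hj.symm.trans hj')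

/-- The test identifier determines the distributed test. -/
theorem GoodTrace.distributed_id {info : ℕ → Option Info} {tok : ℕ → Multiset Tok}
    {es : List Event} (hT : GoodTrace True info tok es) {c h q a t x c' h' q' a' t' x' : Term}
    (he : Event.distributed c h q a t x ∈ es) (he' : Event.distributed c' h' q' a' t' x' ∈ es)
    (ht : t ≈ₑ t') : c = c' := by
  obtain ⟨j, hj⟩ := List.mem_iff_getElem?.1 he
  obtain ⟨j', hj'⟩ := List.mem_iff_getElem?.1 he'
  obtain ⟨k, ro, e, -, rfl, h₁, -⟩ := hT.just j _ hj trivial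
  obtain ⟨k', ro', e', -, rfl, h₂, -⟩ := hT.just j' _ hj' trivial
  obtain rfl : e = e' := by simpa [nf] using ht.nf_eq
  have : some (Info.eap ⟨c, h, q, a⟩) = some (.eap ⟨c', h', q', a'⟩) := h₁.symm.trans h₂
  simp only [Option.some.injEq, Info.eap.injEq, TestData.mk.injEq] at this
  exact this.1

/-- Supplies the collection that a marked test needs from its distribution. -/
theorem GoodTrace.distributed_data {info : ℕ → Option Info} {tok : ℕ → Multiset Tok}
    {es : List Event} (hT : GoodTrace True info tok es) {i : ℕ} {c h q a t x : Term}
    (he : Event.distributed c h q a t x ∈ es.take i) : Event.collected c h q a ∈ es.take i := by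
  obtain ⟨j, hji, hj⟩ := mem_take_iff.1 he
  obtain ⟨k, ro, e, -, -, -, h, -⟩ := hT.just j _ hj trivial
  obtain ⟨l, hl, hl'⟩ := mem_take_iff.1 h
  exact mem_take_iff.2 ⟨l, hl.trans hji, hl'⟩

/-- A shared collection or distribution gives equal candidates, hence the same distributed test and
the same examiner, whose key pays for one marking only. -/
theorem RolesOK.testAuthenticity {P : ExamProtocol} (H : RolesOK True P) :
    P.TestAuthenticity := by
  intro EP hE es B hx
  obtain ⟨info, tok, hT⟩ := H.trace hE hx
  refine injCorr₂_of ?_ ?_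
  · rintro i _ he ⟨q, a, m, t, x, h, rfl⟩
    obtain ⟨e, d, x', b, k, h₁, h₂, ht, hq, ha, hh, hx', -⟩ := hT.just i _ he trivial
    exact ⟨_, hT.distributed_data h₂, _, h₂, q, a, m, t, x, h, d.c, rfl,
      ⟨.refl _, hh.symm, hq.symm, ha.symm⟩,
      ⟨.refl _, hh.symm, hq.symm, ha.symm, ht.symm, hx'.symm⟩⟩
  · rintro i i' _ _ e₁ e₂ e₁' e₂' he he' ⟨q, a, m, t, x, h, rfl⟩ ⟨q', a', m', t', x', h', rfl⟩
      he₁ he₂ he₁' he₂' ⟨_, _, _, _, _, _, c, e, h₁, h₂⟩ ⟨_, _, _, _, _, _, c', e', h₁', h₂'⟩ hor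
    cases e; cases e'
    obtain ⟨c₁, _, _, _, _, x₁, rfl, hc₁, -, hx₁⟩ := Event.eqv_distributed h₂
    obtain ⟨c₁', _, _, _, _, x₁', rfl, hc₁', -, hx₁'⟩ := Event.eqv_distributed h₂'
    have hcc : c ≈ₑ c' := by
      rcases hor with rfl | e
      · obtain ⟨d, _, _, _, rfl, hd⟩ := Event.eqv_collected h₁
        obtain ⟨d', _, _, _, e, hd'⟩ := Event.eqv_collected h₁'
        cases e
        exact hd.symm.trans hd'
      · cases e
        exact hc₁.symm.trans hc₁'
    have hxx : x ≈ₑ x' := by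
      cases hT.distributed_unique he₂ he₂' (hc₁.trans (hcc.trans hc₁'.symm))
      exact hx₁.symm.trans hx₁'
    obtain ⟨e, d, _, b, k, -, -, -, -, -, -, -, hk, h₄⟩ := hT.just i _ he trivial
    obtain ⟨e', d', _, b', k', -, -, -, -, -, -, -, hk', h₄'⟩ := hT.just i' _ he' trivial
    -- Two exponents over `g` do not rotate, so the examiner's key is determined by its pseudonym.
    have := (hk.symm.trans (hxx.trans hk')).nf_eq
    simp only [nf, mkExp_g, mkExp_exp_g, exp.injEq, true_and, priv.injEq] at this
    obtain ⟨-, rfl⟩ := this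
    exact hT.tok_inj _ _ _ h₄ h₄'

/-- A shared distribution gives the same candidate at once, a shared marking gives it through the
test identifier; the candidate's key pays for one notification only. -/
theorem RolesOK.markAuthenticity {P : ExamProtocol} (H : RolesOK True P) :
    P.MarkAuthenticity := by
  intro EP hE es B hx
  obtain ⟨info, tok, hT⟩ := H.trace hE hx
  refine injCorr₂_of ?_ ?_
  · rintro i _ he ⟨c, h, m, rfl⟩
    obtain ⟨k, ro, e, d, x, q, a, m', t, x', h', -, -, -, hc, hh, hm, h₁, h₂, hq, ha, ht, hx',
      hh'⟩ := hT.just i _ he trivial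
    exact ⟨_, h₁, _, h₂, c, h, m, d.q, d.a, .priv e, x, rfl,
      ⟨hc.symm, hh.symm, .refl _, .refl _, .refl _, .refl _⟩,
      ⟨hq, ha, hm.symm, ht, hx', hh'.trans hh.symm⟩⟩
  · rintro i i' _ _ e₁ e₂ e₁' e₂' he he' ⟨c, h, m, rfl⟩ ⟨c', h', m', rfl⟩
      he₁ he₂ he₁' he₂' ⟨_, _, _, q, a, t, x, e, h₁, h₂⟩ ⟨_, _, _, q', a', t', x', e', h₁', h₂'⟩ hor
    cases e; cases e'
    obtain ⟨c₁, _, _, _, t₁, x₁, rfl, hc₁, ht₁, hx₁⟩ := Event.eqv_distributed h₁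
    obtain ⟨c₁', _, _, _, t₁', x₁', rfl, hc₁', ht₁', hx₁'⟩ := Event.eqv_distributed h₁'
    have hcc : c₁ = c₁' := by
      rcases hor with e | rfl
      · cases e
        rfl
      · obtain ⟨_, _, _, s, _, _, rfl, hs⟩ := Event.eqv_marked h₂
        obtain ⟨_, _, _, s', _, _, e, hs'⟩ := Event.eqv_marked h₂'
        cases e
        exact hT.distributed_id he₁ he₁' (ht₁.trans (hs.symm.trans (hs'.trans ht₁'.symm)))
    obtain ⟨k, ro, e, d, _, _, _, _, _, _, _, hp, h₄, -⟩ := hT.just i _ he trivial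
    obtain ⟨k', ro', e', d', _, _, _, _, _, _, _, hp', h₄', -⟩ := hT.just i' _ he' trivial
    obtain ⟨rfl, -⟩ := hp.unique hp'.events (hc₁.symm.trans (hcc ▸ hc₁'))
    exact hT.tok_inj _ _ _ h₄ h₄'


open Term Proc

/-! ## Tests of the environment, and processes that never pass them -/

namespace Term

theorem mkFst_eq_pub {a : Term} {n : ℕ} : mkFst a = pub n ↔ ∃ y, a = pair (pub n) y := by
  constructor
  · intro h
    by_cases h' : ∃ x y, a = pair x y
    · obtain ⟨x, y, rfl⟩ := h'
      rw [mkFst_pair] at h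
      exact ⟨y, by rw [h]⟩
    · simp [mkFst, dif_neg h'] at h
  · rintro ⟨y, rfl⟩
    simp

theorem mkSnd_eq_pair {a x y : Term} (h : mkSnd a = pair x y) : ∃ z, a = pair z (pair x y) := by
  by_cases h' : ∃ y x, a = pair x y
  · obtain ⟨x', y', rfl⟩ := h'
    rw [mkSnd_pair] at h
    exact ⟨y', by rw [h]⟩
  · simp [mkSnd, dif_neg h'] at h

/-- The first component of a message is the name `n`. -/
def FstIs (n : ℕ) (M : Term) : Prop := ∃ y, M.nf = pair (pub n) y

/-- The third component of a message is the name `n`. -/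
def ThdIs (n : ℕ) (M : Term) : Prop := ∃ x y z, M.nf = pair x (pair y (pair (pub n) z))

theorem fstIs_iff {n : ℕ} {M : Term} : FstIs n M ↔ fst M ≈ₑ pub n := by
  rw [eqv_iff]
  exact mkFst_eq_pub.symm

theorem thdIs_iff {n : ℕ} {M : Term} : ThdIs n M ↔ fst (snd (snd M)) ≈ₑ pub n := by
  rw [eqv_iff]
  simp only [nf, mkFst_eq_pub]
  constructor
  · rintro ⟨x, y, z, h⟩
    exact ⟨z, by rw [h]; simp⟩
  · rintro ⟨z, h⟩
    obtain ⟨y, h⟩ := mkSnd_eq_pair h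
    obtain ⟨x, h⟩ := mkSnd_eq_pair h
    exact ⟨x, y, z, h⟩

@[simp] theorem mkExp_ne_pub (a z : Term) (n : ℕ) : mkExp a z ≠ pub n := by
  obtain ⟨x, y, h⟩ := mkExp_eq_exp a z
  simp [h]

@[simp] theorem mkExp_ne_pair (a z x y : Term) : mkExp a z ≠ pair x y := by
  obtain ⟨x, y, h⟩ := mkExp_eq_exp a z
  simp [h]

end Term

/-- A policy: public names that may occur in messages (`name`), that may not be the first
component (`first`) or the third component (`third`) of a message, and that are signed
(`signed`). -/
structure Policy : Type where
  name : ℕ → Prop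
  first : ℕ → Prop
  third : ℕ → Prop
  signed : ℕ → Prop
  disj : ∀ n, signed n → ¬ first n

namespace Policy

/-- The messages under a policy. -/
def Msg (A : Policy) : Term → Prop :=
  Built A.name (fun _ => True) (fun _ => False)
    (fun a => (∃ x y, a ≈ₑ .exp x y) ∨ ∃ n, A.signed n ∧ a ≈ₑ .pub n) (fun _ _ => False)

/-- The recipes under a policy. -/
def Recipe (A : Policy) : Term → Prop :=
  -- The restricted attacker never signs. This replaces the secrecy of the signing keys, about which
  -- `Msg` says nothing.
  Built A.name (fun _ => False) (fun _ => False) (fun _ => False) (fun _ _ => False)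

/-- A message that passes no test of the policy. -/
def Hidden (A : Policy) (M : Term) : Prop :=
  (∀ n, A.first n → ¬ FstIs n M) ∧ ∀ n, A.third n → ¬ ThdIs n M

/-- The table entries under a policy. -/
def Entry (A : Policy) (tb : Table) (Ms : List Term) : Prop :=
  (∀ M ∈ Ms, A.Msg M) ∧
    -- With this shape, neither the first nor the third component of the candidate's message `(r, p,
    -- p')` can be a name.
    (tb = .zkpeqnet → ∃ a b c d e, Ms = [a, .exp b c, .exp d e])

/-- The process outputs only hidden messages. -/
def Guarded (A : Policy) : Proc → Prop
  | .nil => True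
  | .par P Q => Guarded A P ∧ Guarded A Q
  | .repl P => Guarded A P
  | .new P => ∀ n, Guarded A (P (.priv n))
  | .newChan P => ∀ c, Guarded A (P c)
  | .ite M N P Q => (M ≈ₑ N → Guarded A P) ∧ (¬ M ≈ₑ N → Guarded A Q)
  | .inp _ P => ∀ x, A.Msg x → Guarded A (P x)
  | .out _ M P => A.Msg M ∧ A.Hidden M ∧ Guarded A P
  | .event _ P => Guarded A P
  | .insert tb Ms P => A.Entry tb Ms ∧ Guarded A P
  | .get tb pats P Q =>
      (∀ Ms, A.Entry tb Ms → Matches pats Ms → Guarded A (P Ms)) ∧ Guarded A Q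

/-- All outputs of the configuration are hidden. -/
structure Inv (A : Policy) (c : Config) : Prop where
  procs : ∀ P ∈ c.procs, A.Guarded P
  tables : ∀ tb, ∀ Ms ∈ c.tables tb, A.Entry tb Ms
  frame : ∀ M ∈ c.frame, A.Msg M ∧ A.Hidden M

/-- The recipe of an input label satisfies the policy. -/
def Label (A : Policy) : Label → Prop
  | .inp _ M => A.Recipe M
  | _ => True

variable {A B : Policy}

theorem Recipe.subst {φ : List Term} (hφ : ∀ M ∈ φ, A.Msg M) {M : Term} (h : A.Recipe M) :
    A.Msg (M.subst φ) :=
  Built.subst hφ (fun _ h => h.elim) h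

theorem Msg.nf {M : Term} (h : A.Msg M) : A.Msg M.nf := by
  refine Built.nf (fun _ h => h.elim) ?_ (fun _ _ h => h.elim) h
  rintro a (⟨x, y, h⟩ | ⟨n, hn, h⟩)
  · exact .inl ⟨x, y, (nf_eqv a).trans h⟩
  · exact .inr ⟨n, hn, (nf_eqv a).trans h⟩

theorem Inv.step {c c' : Config} {l : ExamPi.Label} (h : A.Inv c) (hl : A.Label l)
    (s : Step c l c') : A.Inv c' := by
  obtain ⟨hp, ht, hf⟩ := h
  cases s <;> simp only [Multiset.mem_cons, forall_eq_or_imp] at hp <;>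
    obtain ⟨h₁, hp⟩ := hp <;> dsimp only at ht hf
  case comm =>
    exact ⟨by simpa using ⟨h₁.2.2, hp.1 _ h₁.1, hp.2⟩, ht, hf⟩
  case insert =>
    refine ⟨by simpa using ⟨h₁.2, hp⟩, ?_, hf⟩
    intro tb Ms hMs
    rcases Discipline.mem_addEntry hMs with ⟨rfl, rfl⟩ | hMs
    · exact h₁.1
    · exact ht tb Ms hMs
  case out =>
    refine ⟨by simpa using ⟨h₁.2.2, hp⟩, ht, ?_⟩
    intro N hN
    simp only [List.mem_append, List.mem_singleton] at hN
    rcases hN with hN | rfl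
    · exact hf N hN
    · exact ⟨h₁.1, h₁.2.1⟩
  case nil => exact ⟨hp, ht, hf⟩
  case par => exact ⟨by simpa using ⟨h₁.1, h₁.2, hp⟩, ht, hf⟩
  case repl => exact ⟨by simpa using ⟨show A.Guarded _ from h₁, h₁, hp⟩, ht, hf⟩
  case new n _ => exact ⟨by simpa using ⟨h₁ n, hp⟩, ht, hf⟩
  case newChan n _ => exact ⟨by simpa using ⟨h₁ _, hp⟩, ht, hf⟩
  case iteTrue e => exact ⟨by simpa using ⟨h₁.1 e, hp⟩, ht, hf⟩
  case iteFalse e => exact ⟨by simpa using ⟨h₁.2 e, hp⟩, ht, hf⟩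
  case getSome Ms hMs hm => exact ⟨by simpa using ⟨h₁.1 Ms (ht _ _ hMs) hm, hp⟩, ht, hf⟩
  case getNone => exact ⟨by simpa using ⟨h₁.2, hp⟩, ht, hf⟩
  case event => exact ⟨by simpa using ⟨show A.Guarded _ from h₁, hp⟩, ht, hf⟩
  case inp n M hM =>
    exact ⟨by simpa using ⟨h₁ _ (Recipe.subst (fun N hN => (hf N hN).1) hl), hp⟩, ht, hf⟩

/-- `A` is a stricter policy than `B`. -/
structure Stricter (A B : Policy) : Prop where
  name : ∀ n, A.name n → B.name n
  first : ∀ n, B.first n → A.first n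
  third : ∀ n, B.third n → A.third n
  signed : ∀ n, A.signed n → B.signed n

theorem Stricter.msg (h : Stricter A B) {M : Term} (hM : A.Msg M) : B.Msg M :=
  Built.mono h.name (fun _ h => h) (fun _ h => h)
    (fun _ h' => h'.imp_right fun ⟨n, hn, e⟩ => ⟨n, h.signed n hn, e⟩) (fun _ _ h => h) hM

theorem Stricter.hidden (h : Stricter A B) {M : Term} (hM : A.Hidden M) : B.Hidden M :=
  ⟨fun n hn => hM.1 n (h.first n hn), fun n hn => hM.2 n (h.third n hn)⟩

theorem Stricter.entry (h : Stricter A B) {tb : Table} {Ms : List Term} (hM : A.Entry tb Ms) :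
    B.Entry tb Ms := ⟨fun M hM' => h.msg (hM.1 M hM'), hM.2⟩

theorem Stricter.label (h : Stricter A B) {l : ExamPi.Label} (hl : A.Label l) : B.Label l := by
  cases l with
  | inp n M => exact Built.mono h.name (fun _ h => h) (fun _ h => h) (fun _ h => h) (fun _ _ h => h) hl
  | _ => trivial

variable (A B) in
/-- A process that outputs only messages that are hidden with respect to `A`, until a certain
principal starts by the output of a message that is not hidden with respect to `B`. -/
inductive Flip : Proc → Prop
  | parL {P Q} : Flip P → A.Guarded Q → B.Guarded Q → Flip (.par P Q)
  | parR {P Q} : A.Guarded P → B.Guarded P → Flip Q → Flip (.par P Q)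
  | new {P : Term → Proc} : (∀ n, Flip (P (.priv n))) → Flip (.new P)
  | newChan {P : Chan → Proc} : (∀ c, Flip (P c)) → Flip (.newChan P)
  | out {u M P} : A.Msg M → A.Hidden M → Flip P → Flip (.out u M P)
  | fire {u M P} : B.Msg M → ¬ B.Hidden M → B.Guarded P → Flip (.out u M P)

variable (A B) in
/-- Configurations in which the principal has not yet started. -/
def Waiting (c : Config) : Prop :=
  ∃ P S, c.procs = P ::ₘ S ∧ Flip A B P ∧ A.Inv ⟨c.used, c.tables, c.frame, S⟩ ∧
    ∀ Q ∈ S, B.Guarded Q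

variable (A B) in
/-- The invariant of a process in which the principal has not yet started, or has started
invisibly, or has started visibly. -/
def Phases (c : Config) : Prop :=
  Waiting A B c ∨ B.Inv c ∨ ∃ M ∈ c.frame, ¬ B.Hidden M

/-- A process in `Flip` is a parallel composition, a restriction or an output; it either takes no
part in the step, or is decomposed, or is the sender. -/
theorem Step.cons_cases {u T φ P S l c'} (hP : Flip A B P) (s : Step ⟨u, T, φ, P ::ₘ S⟩ l c') :
    (∃ u' T' φ' S', c' = ⟨u', T', φ', P ::ₘ S'⟩ ∧ Step ⟨u, T, φ, S⟩ l ⟨u', T', φ', S'⟩) ∨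
    (∃ P₁ P₂, P = .par P₁ P₂ ∧ c' = ⟨u, T, φ, P₁ ::ₘ P₂ ::ₘ S⟩) ∨
    (∃ P₁ u' n, P = .new P₁ ∧ c' = ⟨u', T, φ, P₁ (.priv n) ::ₘ S⟩) ∨
    (∃ P₁ u' n, P = .newChan P₁ ∧ c' = ⟨u', T, φ, P₁ n ::ₘ S⟩) ∨
    (∃ ch M P₁ n, P = .out ch M P₁ ∧ l = .out n ∧ c' = ⟨u, T, φ ++ [M], P₁ ::ₘ S⟩) ∨
    (∃ ch M P₁ Q S', P = .out ch M P₁ ∧ S = .inp ch Q ::ₘ S' ∧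
      c' = ⟨u, T, φ, P₁ ::ₘ Q M ::ₘ S'⟩) := by
  generalize hc : (⟨u, T, φ, P ::ₘ S⟩ : Config) = c at s
  cases s <;> simp only [Config.mk.injEq] at hc <;> obtain ⟨rfl, rfl, rfl, hc⟩ := hc <;>
    rcases Multiset.cons_eq_cons.1 hc with ⟨rfl, rfl⟩ | ⟨-, S', rfl, hS⟩
  case par.inl => exact .inr (.inl ⟨_, _, rfl, rfl⟩)
  case new.inl n _ => exact .inr (.inr (.inl ⟨_, _, n, rfl, rfl⟩))
  case newChan.inl n _ => exact .inr (.inr (.inr (.inl ⟨_, _, _, rfl, rfl⟩)))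
  case out.inl n => exact .inr (.inr (.inr (.inr (.inl ⟨_, _, _, n, rfl, rfl, rfl⟩))))
  case comm.inl => exact .inr (.inr (.inr (.inr (.inr ⟨_, _, _, _, _, rfl, rfl, rfl⟩))))
  case comm.inr ch M P' Q =>
    rcases Multiset.cons_eq_cons.1 hS with ⟨rfl, rfl⟩ | ⟨-, S'', rfl, rfl⟩
    -- An input is not in `Flip`, so the process cannot be the receiver.
    · cases hP
    · refine .inl ⟨_, _, _, P' ::ₘ Q M ::ₘ S'', ?_, .comm⟩
      rw [Multiset.cons_swap P, Multiset.cons_swap P]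
  all_goals try (exfalso; cases hP; done)
  all_goals subst hS; left
  case nil.inr => exact ⟨_, _, _, _, rfl, .nil⟩
  case par.inr =>
    exact ⟨_, _, _, _, by rw [Multiset.cons_swap P, Multiset.cons_swap P], .par⟩
  case repl.inr =>
    exact ⟨_, _, _, _, by rw [Multiset.cons_swap P, Multiset.cons_swap P], .repl⟩
  all_goals refine ⟨_, _, _, _, by rw [Multiset.cons_swap P], ?_⟩
  case new.inr n hn => exact .new n hn
  case newChan.inr n hn => exact .newChan n hn
  case iteTrue.inr e => exact .iteTrue e
  case iteFalse.inr e => exact .iteFalse e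
  case insert.inr => exact .insert
  case getSome.inr Ms h h' => exact .getSome Ms ‹_› ‹_›
  case getNone.inr h => exact .getNone h
  case event.inr => exact .event
  case inp.inr n M h => exact .inp n M h
  case out.inr n => exact .out n

theorem frame_mono {c c' : Config} {l : ExamPi.Label} (s : Step c l c') {M : Term}
    (h : M ∈ c.frame) : M ∈ c'.frame := by
  cases s <;> first | exact h | exact List.mem_append_left _ h

theorem Guarded.step {c c' : Config} {l : ExamPi.Label} (hAB : Stricter A B) (h : A.Inv c)
    (h' : ∀ Q ∈ c.procs, B.Guarded Q) (hl : A.Label l) (s : Step c l c') :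
    ∀ Q ∈ c'.procs, B.Guarded Q :=
  (Inv.step (A := B) ⟨h', fun tb Ms hMs => hAB.entry (h.tables tb Ms hMs),
    fun M hM => ⟨hAB.msg (h.frame M hM).1, hAB.hidden (h.frame M hM).2⟩⟩ (hAB.label hl) s).procs

/-- The telling message is sent once. Output to the environment puts it into the frame for good; an
internal communication consumes it, and from then on all outputs are hidden for `B`. -/
theorem Phases.step {c c' : Config} {l : ExamPi.Label} (hAB : Stricter A B) (h : Phases A B c)
    (hl : A.Label l) (s : Step c l c') : Phases A B c' := by
  rcases h with ⟨P, S, hc, hP, hS, hS'⟩ | h | ⟨M, hM, hM'⟩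
  · obtain ⟨u, T, φ, procs⟩ := c
    dsimp only at hc hS
    subst hc
    have hB : B.Inv ⟨u, T, φ, S⟩ := ⟨hS', fun tb Ms hMs => hAB.entry (hS.tables tb Ms hMs),
      fun M hM => ⟨hAB.msg (hS.frame M hM).1, hAB.hidden (hS.frame M hM).2⟩⟩
    rcases Step.cons_cases hP s with ⟨u', T', φ', S', rfl, s'⟩ | ⟨P₁, P₂, rfl, rfl⟩ |
      ⟨P₁, u', n, rfl, rfl⟩ | ⟨P₁, u', n, rfl, rfl⟩ | ⟨ch, M, P₁, n, rfl, rfl, rfl⟩ |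
      ⟨ch, M, P₁, Q, S', rfl, rfl, rfl⟩
    · exact .inl ⟨P, S', rfl, hP, hS.step hl s', Guarded.step hAB hS hS' hl s'⟩
    · left
      cases hP with
      | parL h₁ h₂ h₃ =>
        refine ⟨P₁, P₂ ::ₘ S, rfl, h₁, ⟨?_, hS.tables, hS.frame⟩, by simpa using ⟨h₃, hS'⟩⟩
        simpa using ⟨h₂, hS.procs⟩
      | parR h₁ h₂ h₃ =>
        refine ⟨P₂, P₁ ::ₘ S, Multiset.cons_swap _ _ _, h₃, ⟨?_, hS.tables, hS.frame⟩,
          by simpa using ⟨h₂, hS'⟩⟩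
        simpa using ⟨h₁, hS.procs⟩
    · cases hP with
      | new h => exact .inl ⟨_, S, rfl, h n, ⟨hS.procs, hS.tables, hS.frame⟩, hS'⟩
    · cases hP with
      | newChan h => exact .inl ⟨_, S, rfl, h n, ⟨hS.procs, hS.tables, hS.frame⟩, hS'⟩
    · cases hP with
      | out h₁ h₂ h₃ =>
        refine .inl ⟨_, S, rfl, h₃, ⟨hS.procs, hS.tables, ?_⟩, hS'⟩
        intro N hN
        simp only [List.mem_append, List.mem_singleton] at hN
        rcases hN with hN | rfl
        · exact hS.frame N hN
        · exact ⟨h₁, h₂⟩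
      | fire h₁ h₂ h₃ => exact .inr (.inr ⟨M, by simp, h₂⟩)
    · have hAQ := hS.procs (.inp ch Q) (by simp)
      have hBQ := hS' (.inp ch Q) (by simp)
      cases hP with
      | out h₁ h₂ h₃ =>
        refine .inl ⟨_, _, rfl, h₃, ⟨?_, hS.tables, hS.frame⟩, ?_⟩
        · intro P hP
          rcases Multiset.mem_cons.1 hP with rfl | hP
          · exact hAQ M h₁
          · exact hS.procs P (by simp [hP])
        · intro P hP
          rcases Multiset.mem_cons.1 hP with rfl | hP
          · exact hBQ M (hAB.msg h₁)
          · exact hS' P (by simp [hP])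
      | fire h₁ h₂ h₃ =>
        refine .inr (.inl ⟨?_, hB.tables, hB.frame⟩)
        intro P hP
        rcases Multiset.mem_cons.1 hP with rfl | hP
        · exact h₃
        rcases Multiset.mem_cons.1 hP with rfl | hP
        · exact hBQ M h₁
        · exact hS' P (by simp [hP])
  · exact .inr (.inl (h.step (hAB.label hl) s))
  · exact .inr (.inr ⟨M, frame_mono s hM, hM'⟩)

end Policy

/-! ## Refuting bisimilarity -/

/-- A step, with events that are not visible, and inputs whose recipes satisfy the policy. -/
def WStep (A : Policy) (c c' : Config) : Prop :=
  Internal c c' ∨ ∃ l, l.Visible ∧ A.Label l ∧ Step c l c'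

theorem Internals.wstep {A : Policy} {c c' : Config} (h : Internals c c') :
    Relation.ReflTransGen (WStep A) c c' :=
  Relation.ReflTransGen.mono (fun _ _ h => Or.inl h) _ _ h

/-- Labels are matched exactly, so a restriction on the recipes of one side carries over to the
other. -/
theorem IsBisimulation.simulate {R : Config → Config → Prop} (hR : IsBisimulation R)
    {A : Policy} {c d c' : Config} (h : R c d) (hc : Relation.ReflTransGen (WStep A) c c') :
    ∃ d', Relation.ReflTransGen (WStep A) d d' ∧ R c' d' := by
  induction hc with
  | refl => exact ⟨d, .refl, h⟩
  | tail _ s ih =>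
    obtain ⟨d₁, hd₁, h₁⟩ := ih
    rcases s with s | ⟨l, hv, hl, s⟩
    · obtain ⟨d₂, hd₂, h₂⟩ := hR.internal _ _ _ h₁ (.single s)
      exact ⟨d₂, hd₁.trans hd₂.wstep, h₂⟩
    · obtain ⟨d₂, d₃, d₄, h₂, h₃, h₄, h₅⟩ := hR.labelled _ _ _ l h₁ hv s
      exact ⟨d₄, hd₁.trans (h₂.wstep.trans (.head (.inr ⟨l, hv, hl, h₃⟩) h₄.wstep)), h₅⟩

/-- The tests of a policy are equations between recipes: a projection compared with a public name.
-/
theorem StaticEquiv.exists_not_hidden {A : Policy} {φ ψ : List Term} (h : StaticEquiv φ ψ)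
    (hφ : ∃ M ∈ φ, ¬ A.Hidden M) : ∃ M ∈ ψ, ¬ A.Hidden M := by
  obtain ⟨M, hM, hA⟩ := hφ
  obtain ⟨i, hi, rfl⟩ := List.mem_iff_getElem.1 hM
  have hi' : i < ψ.length := h.1 ▸ hi
  refine ⟨ψ[i], List.getElem_mem _, fun hA' => hA ?_⟩
  have e : (Term.var i).subst φ = φ[i] := by simp [Term.subst, hi]
  have e' : (Term.var i).subst ψ = ψ[i] := by simp [Term.subst, hi']
  refine ⟨fun n hn hf => hA'.1 n hn ?_, fun n hn hf => hA'.2 n hn ?_⟩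
  · rw [fstIs_iff] at hf ⊢
    rw [← e] at hf
    rw [← e']
    exact (h.2 (.fst (.var i)) (.pub n) hi trivial).1 hf
  · rw [thdIs_iff] at hf ⊢
    rw [← e] at hf
    rw [← e']
    exact (h.2 (.fst (.snd (.snd (.var i)))) (.pub n) hi trivial).1 hf

theorem StaticEquiv.symm {φ ψ : List Term} (h : StaticEquiv φ ψ) : StaticEquiv ψ φ :=
  ⟨h.1.symm, fun M N hM hN => (h.2 M N (h.1 ▸ hM) (h.1 ▸ hN)).symm⟩

theorem WStep.inv {A : Policy} {c c' : Config} (h : A.Inv c)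
    (s : Relation.ReflTransGen (WStep A) c c') : A.Inv c' := by
  induction s with
  | refl => exact h
  | tail _ s ih =>
    rcases s with (s | ⟨e, s⟩) | ⟨l, -, hl, s⟩
    · exact ih.step (l := .tau) trivial s
    · exact ih.step (l := .event e) trivial s
    · exact ih.step hl s

theorem WStep.phases {A B : Policy} (hAB : A.Stricter B) {c c' : Config}
    (h : A.Phases B c) (s : Relation.ReflTransGen (WStep A) c c') : A.Phases B c' := by
  induction s with
  | refl => exact h
  | tail _ s ih =>
    rcases s with (s | ⟨e, s⟩) | ⟨l, -, hl, s⟩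
    · exact ih.step (l := .tau) hAB trivial s
    · exact ih.step (l := .event e) hAB trivial s
    · exact ih.step hAB hl s

/-- A process with only hidden outputs is not bisimilar to one with an output that is not
hidden. -/
theorem not_bisimilar_of_guarded {A : Policy} {P Q : Proc} (hQ : A.Guarded Q) {c : Config}
    (hP : Relation.ReflTransGen (WStep A) (Config.init P) c) (hc : ∃ M ∈ c.frame, ¬ A.Hidden M) :
    ¬ Bisimilar P Q := by
  rintro ⟨R, hR, h⟩
  obtain ⟨d, hd, h'⟩ := hR.simulate h hP
  obtain ⟨M, hM, hA⟩ := (hR.static _ _ h').exists_not_hidden hc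
  refine hA ((WStep.inv ⟨?_, ?_, ?_⟩ hd).frame M hM).2
  · simpa [Config.init] using hQ
  · simp [Config.init]
  · simp [Config.init]

/-- A process in which a principal has to start before the test of `A` is passed is not bisimilar
to one in which the principal visibly starts afterwards. -/
theorem not_bisimilar_of_flip {A B : Policy} (hAB : A.Stricter B) {P Q : Proc}
    (hQ : A.Flip B Q) {c c' : Config}
    (hP : Relation.ReflTransGen (WStep A) (Config.init P) c) (hc : ∃ M ∈ c.frame, ¬ A.Hidden M)
    (hcB : ∀ M ∈ c.frame, B.Hidden M) (hP' : Relation.ReflTransGen (WStep A) c c')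
    (hc' : ∃ M ∈ c'.frame, ¬ B.Hidden M) : ¬ Bisimilar P Q := by
  rintro ⟨R, hR, h⟩
  obtain ⟨d, hd, h'⟩ := hR.simulate h hP
  obtain ⟨d', hd', h''⟩ := hR.simulate h' hP'
  have hs := hR.static _ _ h'
  have hinit : A.Phases B (Config.init Q) := by
    refine .inl ⟨Q, 0, rfl, hQ, ⟨?_, ?_, ?_⟩, ?_⟩ <;> simp [Config.init]
  -- In `d` the principal has started, since a test of `A` is passed, and has done so invisibly,
  -- since no test of `B` is.
  have hB : B.Inv d := by
    rcases WStep.phases hAB hinit hd with ⟨_, _, -, -, h₁, -⟩ | h₁ | h₁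
    · obtain ⟨M, hM, hA⟩ := hs.exists_not_hidden hc
      exact absurd (h₁.frame M hM).2 hA
    · exact h₁
    · obtain ⟨M, hM, hA⟩ := hs.symm.exists_not_hidden h₁
      exact absurd (hcB M hM) hA
  obtain ⟨M, hM, hA⟩ := (hR.static _ _ h'').exists_not_hidden hc'
  refine hA ((WStep.inv hB (Relation.ReflTransGen.mono ?_ _ _ hd')).frame M hM).2
  rintro x y (s | ⟨l, hv, hl, s⟩)
  · exact .inl s
  · exact .inr ⟨l, hv, hAB.label hl, s⟩


open Term Proc

/-! ## The roles of the original protocol output only hidden messages -/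

namespace Policy

variable {A B : Policy}

theorem Guarded.prune {cut : Event → Bool} {P : Proc} (h : A.Guarded P) :
    A.Guarded (P.prune cut) := by
  induction P with
  | nil => trivial
  | par P Q hP hQ => exact ⟨hP h.1, hQ h.2⟩
  | repl P hP => exact hP h
  | new P hP => exact fun n => hP _ (h n)
  | newChan P hP => exact fun c => hP _ (h c)
  | ite M N P Q hP hQ => exact ⟨fun e => hP (h.1 e), fun e => hQ (h.2 e)⟩
  | inp u P hP => exact fun x hx => hP x (h x hx)
  | out u M P hP => exact ⟨h.1, h.2.1, hP h.2.2⟩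
  | event e P hP =>
    show A.Guarded (if _ then _ else _)
    split_ifs
    · trivial
    · exact hP h
  | insert tb Ms P hP => exact ⟨h.1, hP h.2⟩
  | get tb pats P Q hP hQ => exact ⟨fun Ms hMs hm => hP Ms (h.1 Ms hMs hm), hQ h.2⟩

theorem Flip.prune {cut : Event → Bool} {P : Proc} (h : A.Flip B P) :
    A.Flip B (P.prune cut) := by
  induction h with
  | parL _ h h' ih => exact .parL ih h.prune h'.prune
  | parR h h' _ ih => exact .parR h.prune h'.prune ih
  | new _ ih => exact .new ih
  | newChan _ ih => exact .newChan ih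
  | out h h' _ ih => exact .out h h' ih
  | fire h h' h'' => exact .fire h h' h''.prune

theorem guarded_cond {M N : Term} {P : Proc} (h : M ≈ₑ N → A.Guarded P) :
    A.Guarded (cond M N P) := ⟨h, fun _ => trivial⟩

theorem guarded_recv {u : Chan} {pats : List (Option Term)} {P : (ℕ → Term) → Proc}
    (h : ∀ m : ℕ → Term, (∀ i, A.Msg (m i)) → A.Guarded (P m)) : A.Guarded (recv u pats P) :=
  fun _ hx => guarded_cond fun _ => h _ fun i => Built.proj hx i

theorem Entry.getD {tb : Table} {Ms : List Term} (h : A.Entry tb Ms) (i : ℕ) :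
    A.Msg (Ms.getD i .unit) := by
  rw [List.getD_eq_getElem?_getD]
  rcases hi : Ms[i]? with _ | M
  · exact .unit
  · exact h.1 M (List.mem_of_getElem? hi)

theorem guarded_lookup {tb : Table} {pats : List (Option Term)} {P : (ℕ → Term) → Proc}
    (h : ∀ Ms, A.Entry tb Ms → A.Guarded (P fun i => Ms.getD i .unit)) :
    A.Guarded (lookup tb pats P) := ⟨fun Ms hMs _ => h Ms hMs, trivial⟩

theorem guarded_insert {tb : Table} {Ms : List Term} {P : Proc} (hMs : ∀ M ∈ Ms, A.Msg M)
    (htb : tb ≠ .zkpeqnet) (h : A.Guarded P) : A.Guarded (.insert tb Ms P) :=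
  ⟨⟨hMs, fun h => absurd h htb⟩, h⟩

theorem msg_exp_g (n : ℕ) : A.Msg (.exp .g (.priv n)) := .exp .g (.priv trivial)

theorem msg_priv (n : ℕ) : A.Msg (.priv n) := .priv trivial

theorem hidden_pub {n : ℕ} {M : Term} (h : ¬ A.first n) : A.Hidden (tup [.pub n, M]) := by
  refine ⟨fun m hm => ?_, fun m _ => ?_⟩
  · rintro ⟨y, hy⟩
    simp only [tup, nf, pair.injEq, pub.injEq] at hy
    exact h (hy.1 ▸ hm)
  · simp [ThdIs, tup, nf]

/-- A message is hidden if its normal form is not a pair. -/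
theorem hidden_of_nf {M : Term} (h : ∀ a b, M.nf ≠ .pair a b) : A.Hidden M :=
  ⟨fun _ _ ⟨_, h'⟩ => h _ _ h', fun _ _ ⟨_, _, _, h'⟩ => h _ _ h'⟩

/-- A verified message that is output with its signature is hidden. -/
theorem hidden_of_checksign {quest squest k : Term} (h : A.Msg squest)
    (e : quest ≈ₑ .checksign squest (.spk k)) : A.Hidden (tup [quest, squest]) := by
  refine ⟨fun n hn => ?_, fun n _ => by simp [ThdIs, tup, nf]⟩
  rintro ⟨y, hy⟩
  simp only [tup, nf, pair.injEq] at hy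
  have h' := nf_eq_sign_of_checksign e (by simp [hy.1])
  have h := h.nf
  rw [h', hy.1] at h
  cases h with
  | sign _ _ hg =>
    rcases hg with ⟨a, b, e⟩ | ⟨m, hm, e⟩
    · have := e.nf_eq
      simp only [nf] at this
      exact mkExp_ne_pub _ _ _ this.symm
    · have := e.nf_eq
      simp only [nf, pub.injEq] at this
      exact A.disj m hm (this ▸ hn)
  | signKey _ hk => exact hk.elim

/-- The marks of a marking may be output. -/
def Marks (A : Policy) (M : Marking) : Prop :=
  (∀ x ∈ M.special, (∃ n, x.1 = .pub n ∧ ¬ A.name n) ∨ ∃ n, x.2 = .pub n ∧ A.name n ∧ ¬ A.first n) ∧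
    ∃ n, M.default = .pub n ∧ A.name n ∧ ¬ A.first n

/-- An answer whose name may not occur in messages is never matched, so its mark does not matter. -/
theorem guarded_markWith {M : Marking} (hM : A.Marks M) {a : Term} (ha : A.Msg a)
    {P : Term → Proc} (hP : ∀ n, A.name n → ¬ A.first n → A.Guarded (P (.pub n))) :
    A.Guarded (markWith M.special M.default a P) := by
  obtain ⟨l, m⟩ := M
  obtain ⟨h₁, n, h₂, hn, hn'⟩ := hM
  dsimp only at *
  subst h₂
  induction l with
  | nil => exact hP n hn hn'
  | cons x l ih =>
    refine ⟨fun e => ?_, fun _ => ih fun y hy => h₁ y (by simp [hy])⟩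
    rcases h₁ x (by simp) with ⟨n', h, hn'⟩ | ⟨n', h, hn, hn'⟩
    · rw [h] at e
      have := ha.nf
      rw [e.nf_eq] at this
      cases this with
      | pub h => exact absurd h hn'
    · rw [h]
      exact hP n' hn hn'

theorem guarded_chooseExaminer {asg : List (Term × Term)} {p' h : Term} {P : Term → Term → Proc}
    (hP : ∀ t q, A.Msg t → A.Msg q → A.Guarded (P t q)) :
    A.Guarded (chooseExaminer asg p' h P) := by
  induction asg with
  | nil => exact guarded_lookup fun Ms hMs => hP _ _ (hMs.getD 0) (hMs.getD 1)
  | cons x l ih =>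
    exact ⟨fun _ _ _ => guarded_lookup fun Ms hMs => hP _ _ (hMs.getD 0) (hMs.getD 1), ih⟩

theorem guarded_parList {L : List Proc} (h : ∀ P ∈ L, A.Guarded P) : A.Guarded (parList L) := by
  induction L with
  | nil => trivial
  | cons P L ih => exact ⟨h P (by simp), ih fun Q hQ => h Q (by simp [hQ])⟩

theorem guarded_committee {V : Env} (hV : A.Msg V.sskCom) {q : ℕ} (hq : A.name q)
    (hs : A.signed q) : A.Guarded (committee V (.pub q)) := by
  refine ⟨.pair (.pub hq) (.pair (.sign (.pub hq) hV (.inr ⟨q, hs, .refl _⟩)) .unit),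
    hidden_pub (A.disj q hs), trivial⟩

theorem guarded_acceptMark {V : Env} {pkC h p' : Term} {rec : Term → Term} :
    A.Guarded (acceptMark V pkC h p' rec) :=
  guarded_lookup fun _ _ => guarded_lookup fun _ _ => guarded_cond fun _ => guarded_cond fun _ =>
    trivial

theorem hidden_exp {M N a b : Term} (h : M ≈ₑ .exp a b) : A.Hidden (tup [M, N]) := by
  have h := h.nf_eq
  simp only [nf] at h
  refine ⟨fun n _ => ?_, fun n _ => ?_⟩ <;> simp [FstIs, ThdIs, tup, nf, h]

theorem hidden_exp₃ {a b c d e f : Term} :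
    A.Hidden (tup [.exp a b, .exp c d, .exp e f]) := by
  refine ⟨fun n _ => ?_, fun n _ => ?_⟩ <;> simp [FstIs, ThdIs, tup, nf]

/-- Splits off the output of the identity, the only one whose first component can be a name; the
rest is hidden whatever the identity, provided that the answer is no forbidden third component. -/
theorem candidate_eq {V : Env} {id answ : ℕ} (hid : A.name id) (ha : A.name answ)
    (ha' : ¬ A.third answ) : ∃ K : Term → Proc, HusztiPetho.candidate V (.pub id) (.pub answ) =
      (.new fun sk => .out pubc (tup [.pub id, .exp .g sk]) (K sk)) ∧
      ∀ n, A.Guarded (K (.priv n)) := by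
  refine ⟨_, rfl, fun sk => ?_⟩
  have hpk : A.Msg (.exp .g (.priv sk)) := msg_exp_g sk
  have hid' : A.Msg (.pub id) := .pub hid
  have hgC : A.Msg .gC := .gC
  refine guarded_insert (by simp [hpk, hgC]) (by simp) <| guarded_recv fun m hm =>
    guarded_cond fun _ => guarded_lookup fun Ms₁ hMs₁ => guarded_lookup fun Ms₂ hMs₂ => ?_
  obtain ⟨hMs₂, e⟩ := hMs₂
  obtain ⟨a, b, c, d, e, rfl⟩ := e rfl
  simp only [List.mem_cons, List.not_mem_nil, or_false, forall_eq_or_imp, forall_eq] at hMs₂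
  obtain ⟨-, h₁, h₂⟩ := hMs₂
  have hp : A.Msg (.exp (.exp b c) (.priv sk)) := .exp h₁ (msg_priv sk)
  refine guarded_insert (by simp [h₂, hid']) (by simp) ?_
  refine ⟨.pair hp (.pair h₂ .unit), hidden_exp (.refl _), fun z hz => guarded_cond fun _ => ?_⟩
  refine ⟨.pair h₁ (.pair hp (.pair h₂ .unit)), hidden_exp₃, ?_⟩
  refine ⟨.zkpProof2 h₁ hp (msg_priv sk), hidden_of_nf (by simp [nf]), ?_⟩
  refine guarded_recv fun m' hm' => guarded_cond fun _ => ?_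
  refine ⟨.pair h₁ (.pair hp (.pair (.pub ha) .unit)), ⟨fun n _ => ?_, fun n hn => ?_⟩,
    fun _ _ => guarded_cond fun _ => guarded_acceptMark⟩
  · simp [FstIs, tup, nf]
  · rintro ⟨x, y, z, h⟩
    simp only [tup, nf, pair.injEq, pub.injEq] at h
    exact ha' (h.2.2.1 ▸ hn)

/-- As for the candidate; here the critical later output is the last one, which starts with the
mark. -/
theorem examiner_eq {V : Env} (hV : A.Msg V.sskEA) {id : ℕ} {M : Marking} (hid : A.name id) (hM : A.Marks M) :
    ∃ K : Term → Proc, HusztiPetho.examiner V (.pub id) M =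
      (.new fun sk => .out pubc (tup [.pub id, .exp .g sk]) (K sk)) ∧
      ∀ n, A.Guarded (K (.priv n)) := by
  refine ⟨_, rfl, fun sk => ?_⟩
  have hsk := msg_priv (A := A) sk
  have hpk : A.Msg (.exp .g (.priv sk)) := msg_exp_g sk
  have hid' : A.Msg (.pub id) := .pub hid
  have hgE : A.Msg .gE := .gE
  refine guarded_insert (by simp [hpk, hgE]) (by simp) <| guarded_recv fun m hm =>
    guarded_cond fun _ => fun α => guarded_lookup fun Ms hMs => ?_
  have ht : A.Msg (.exp .g (.priv α)) := msg_exp_g α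
  have hq : A.Msg (.exp (.exp .g (.priv α)) (.priv sk)) := .exp ht hsk
  have hq' : A.Msg (.exp (Ms.getD 0 .unit) (.priv α)) := .exp (hMs.getD 0) (msg_priv α)
  have hz : A.Msg (.zkpProof2 (.exp .g (.priv α)) (.exp (.exp .g (.priv α)) (.priv sk))
    (.priv sk)) := .zkpProof2 ht hq hsk
  refine ⟨.pair hq (.pair hq' .unit), hidden_exp (.refl _), fun z _ => guarded_cond fun _ => ?_⟩
  refine ⟨.pair ht (.pair hq (.pair hq' .unit)), hidden_exp₃, hz, hidden_of_nf (by simp [nf]), ?_⟩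
  refine guarded_insert (by simp [ht, hq, hm, hz, hid']) (by simp) ?_
  refine guarded_recv fun m' hm' => guarded_cond fun _ => guarded_recv fun m'' hm'' => ?_
  refine guarded_markWith hM (hm'' 1) fun n hn hn' => ?_
  have hh : A.Msg (.hash (tup [.pub n, m'' 1])) := .hash (.pair (.pub hn) (.pair (hm'' 1) .unit))
  have hhE : A.Msg (.exp (.hash (tup [.pub n, m'' 1])) (.priv sk)) := .exp hh hsk
  have hv : A.Msg (.spk V.sskEA) := .spk hV
  refine guarded_insert (by simp [hh, hv]) (by simp) ⟨.pair (.pub hn) (.pair hh (.pair hhE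
    (.pair (.xproof hh hhE ht hq hsk) (.pair ht (.pair hq .unit))))), ⟨fun k hk => ?_, fun k _ => ?_⟩,
    trivial⟩
  · rintro ⟨y, hy⟩
    simp only [tup, nf, pair.injEq, pub.injEq] at hy
    exact hn' (hy.1 ▸ hk)
  · simp [ThdIs, tup, nf]

/-- The pseudonym sent to the NET has passed the check `e`, so it is an exponential and no pair. -/
theorem guarded_storeMark {V : Env} {h p p' s t q : Term} (hp' : A.Msg p') (ht : A.Msg t)
    (hq : A.Msg q) (e : .exp p s ≈ₑ p') : A.Guarded (storeMark V h p' t q) := by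
  refine guarded_lookup fun Ms hMs => guarded_recv fun m hm => guarded_cond fun _ =>
    ⟨hp', hidden_of_nf ?_, guarded_recv fun m' hm' => guarded_lookup fun Ms' hMs' =>
      guarded_insert ?_ (by simp) trivial⟩
  · rw [← e.nf_eq]; simp [nf]
  · simp only [List.forall_mem_cons]
    exact ⟨hMs'.getD 0, hm 0, hMs.getD 0, hm 2, hm 3, ht, hq, nofun⟩

/-- The question is the only forwarded first component, and it comes with a verified signature. The
other outputs start with an exponential or a fresh name, or are not pairs. -/
theorem guarded_examAuthority {V : Env} (hV : A.Msg V.sskEA) {asg : List (Term × Term)} :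
    A.Guarded (HusztiPetho.examAuthority V asg) := by
  intro s
  have hh : A.Msg (.exp .g (.priv s)) := msg_exp_g s
  refine ⟨.pair hh (.pair (.sign hh hV (.inl ⟨_, _, .refl _⟩)) .unit), hidden_exp (.refl _),
    guarded_recv fun m hm => ⟨?_, ?_⟩⟩
  · refine show A.Guarded (examinerReg _ _) from guarded_lookup fun Ms hMs => ?_
    have hq : A.Msg (.exp (Ms.getD 1 .unit) (.priv s)) := .exp (hMs.getD 1) (msg_priv s)
    refine ⟨.pair hq (.pair (hMs.getD 1) .unit), hidden_exp (.refl _),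
      guarded_insert (by simp only [List.forall_mem_cons]; exact ⟨hq, hMs.getD 1, nofun⟩)
        (by simp) <| guarded_recv fun m' hm' => ?_⟩
    refine ⟨.xproof (hm' 0) (hm' 1) .g hh (msg_priv s), hidden_of_nf (by simp [nf]),
      guarded_recv fun m hm => guarded_cond fun _ => fun _ _ => guarded_cond fun _ => trivial⟩
  · refine show A.Guarded (HusztiPetho.candidateReg _ _ _ _ _ _) from guarded_lookup fun Ms hMs => ?_
    have hq : A.Msg (.exp (Ms.getD 1 .unit) (.priv s)) := .exp (hMs.getD 1) (msg_priv s)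
    refine guarded_insert
      (by simp only [List.forall_mem_cons]; exact ⟨hMs.getD 1, hq, hh, nofun⟩) (by simp) ?_
    refine ⟨.pair hq (.pair .gC .unit), hidden_exp (.refl _),
      guarded_insert (by simp only [List.forall_mem_cons]; exact ⟨hq, hMs.getD 1, nofun⟩)
        (by simp) <| guarded_recv fun m' hm' => ?_⟩
    refine ⟨.xproof (hm' 0) (hm' 1) .g hh (msg_priv s), hidden_of_nf (by simp [nf]),
      guarded_recv fun n hn => guarded_cond fun e => fun z hz => guarded_cond fun _ =>
      guarded_cond fun e' => ⟨.pair (hm 0) (.pair (hm 1) .unit), hidden_of_checksign (hm 1) e',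
      guarded_recv fun n' hn' => ⟨?_, hidden_of_nf (by simp [nf]),
        guarded_chooseExaminer fun t q ht hq => fun eap =>
        ⟨.pair (msg_priv eap) (.pair (hn' 2) .unit), ?_, guarded_storeMark (hn 2) ht hq e⟩⟩⟩⟩
    · exact .hash (.pair (hn 0) (.pair (hn 1) (.pair (hn 2) (.pair hz (.pair (hm 0)
        (.pair (hn' 2) .unit))))))
    · refine ⟨fun n _ => ?_, fun n _ => ?_⟩ <;> simp [FstIs, ThdIs, tup, nf]

theorem guarded_net : A.Guarded HusztiPetho.net := by
  refine guarded_recv fun m hm => fun ro => ?_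
  have hp' : A.Msg (.exp (m 0) (.priv ro)) := .exp (hm 0) (msg_priv ro)
  have hr : A.Msg (.exp .g (.priv ro)) := msg_exp_g ro
  refine ⟨.pair hp' (.pair hr .unit), hidden_exp (.refl _), ⟨?_, fun _ => ⟨_, _, _, _, _, rfl⟩⟩,
    fun x _ => guarded_cond fun _ => ⟨.pair hp' (.pair (hm 0) .unit), hidden_exp (.refl _),
    trivial⟩⟩
  simp only [List.forall_mem_cons]
  exact ⟨hm 0, hr, hp', nofun⟩

theorem not_hidden_pub {n : ℕ} {M : Term} (h : A.first n) : ¬ A.Hidden (tup [.pub n, M]) :=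
  fun hM => hM.1 n h ⟨.pair M.nf .unit, rfl⟩

/-- Processes that start with a fresh key, and the output of an identity and the public key. -/
theorem guarded_start {id : ℕ} {P : Proc} (hid : A.name id) (hid' : ¬ A.first id)
    (h : ∃ K : Term → Proc, P = (.new fun sk => .out pubc (tup [.pub id, .exp .g sk]) (K sk)) ∧
      ∀ n, A.Guarded (K (.priv n))) : A.Guarded P := by
  obtain ⟨K, rfl, h⟩ := h
  exact fun n => ⟨.pair (.pub hid) (.pair (msg_exp_g n) .unit), hidden_pub hid', h n⟩

theorem flip_start {id : ℕ} {P : Proc} (hid : B.name id) (hid' : B.first id)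
    (h : ∃ K : Term → Proc, P = (.new fun sk => .out pubc (tup [.pub id, .exp .g sk]) (K sk)) ∧
      ∀ n, B.Guarded (K (.priv n))) : A.Flip B P := by
  obtain ⟨K, rfl, h⟩ := h
  exact .new fun n => .fire (.pair (.pub hid) (.pair (msg_exp_g n) .unit)) (not_hidden_pub hid')
    (h n)

theorem guarded_setup {P : Env → Proc}
    (h : ∀ V : Env, A.Msg V.sskEA → A.Msg V.sskCom → A.Guarded (P V)) : A.Guarded (setup P) :=
  fun n => ⟨.spk (msg_priv n), hidden_of_nf (by simp [nf]), fun n' => ⟨.spk (msg_priv n'),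
    hidden_of_nf (by simp [nf]), fun _ _ => h _ (msg_priv n) (msg_priv n')⟩⟩

theorem flip_setup {P : Env → Proc} (h : ∀ V : Env, A.Msg V.sskEA → A.Msg V.sskCom →
    B.Msg V.sskEA → B.Msg V.sskCom → A.Flip B (P V)) : A.Flip B (setup P) :=
  .new fun n => .out (.spk (msg_priv n)) (hidden_of_nf (by simp [nf])) <| .new fun n' =>
    .out (.spk (msg_priv n')) (hidden_of_nf (by simp [nf])) <| .newChan fun _ => .newChan fun _ =>
    h _ (msg_priv n) (msg_priv n') (msg_priv n) (msg_priv n')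

variable (A) in
/-- The names of the candidate and its answer may be output. -/
def CandOK (x : ℕ × ℕ) : Prop := A.name x.1 ∧ A.name x.2 ∧ ¬ A.third x.2

variable (A) in
/-- The name of the examiner may be used, and its marks may be output. -/
def ExaminerOK (x : ℕ × Marking) : Prop := A.name x.1 ∧ A.Marks x.2

variable (A) in
/-- The question may be signed. -/
def QuestionOK (q : ℕ) : Prop := A.name q ∧ A.signed q

theorem guarded_cands {V : Env} {l : List (ℕ × ℕ)} (h : ∀ x ∈ l, A.CandOK x ∧ ¬ A.first x.1) :
    A.Guarded (parList (l.map fun x => husztiPetho.candidate V (.pub x.1) (.pub x.2))) := by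
  refine guarded_parList fun P hP => ?_
  obtain ⟨x, hx, rfl⟩ := List.mem_map.1 hP
  obtain ⟨⟨h₁, h₂, h₃⟩, h₄⟩ := h x hx
  exact guarded_start h₁ h₄ (candidate_eq h₁ h₂ h₃)

theorem guarded_examiners {V : Env} (hV : A.Msg V.sskEA) {l : List (ℕ × Marking)}
    (h : ∀ x ∈ l, A.ExaminerOK x ∧ ¬ A.first x.1) :
    A.Guarded (parList (l.map fun x => husztiPetho.examiner V (.pub x.1) x.2)) := by
  refine guarded_parList fun P hP => ?_
  obtain ⟨x, hx, rfl⟩ := List.mem_map.1 hP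
  obtain ⟨⟨h₁, h₂⟩, h₃⟩ := h x hx
  exact guarded_start h₁ h₃ (examiner_eq hV h₁ h₂)

theorem guarded_authorities {V : Env} (hV : A.Msg V.sskEA) (hV' : A.Msg V.sskCom) {q : ℕ}
    (hq : A.QuestionOK q) {asg : List (Term × Term)} :
    A.Guarded (.par (husztiPetho.committee V (.pub q))
      (.par (husztiPetho.collector V asg) (husztiPetho.authorities V))) :=
  ⟨guarded_committee hV' hq.1 hq.2, guarded_examAuthority hV, guarded_net⟩

theorem guarded_inst {I : Instance} (hc : ∀ x ∈ I.cands, A.CandOK x ∧ ¬ A.first x.1)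
    (he : ∀ x ∈ I.examiners, A.ExaminerOK x ∧ ¬ A.first x.1) (hq : A.QuestionOK I.question) :
    A.Guarded (husztiPetho.inst I) :=
  guarded_setup fun _ hV hV' => ⟨guarded_cands hc, guarded_examiners hV he,
    guarded_authorities hV hV' hq⟩

theorem flip_parList {P Q : Proc} (h : A.Guarded P) (h' : B.Guarded P) (hQ : A.Flip B Q) :
    A.Flip B (parList [P, Q]) := .parR h h' (.parL hQ trivial trivial)

/-- The second candidate is the one that waits; it has to obey the laxer policy `B` only, since once
started it may reveal what `A` forbids. -/
theorem flip_cand {I : Instance} {x y : ℕ × ℕ} (hI : I.cands = [x, y])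
    (hx : A.CandOK x ∧ ¬ A.first x.1) (hx' : B.CandOK x ∧ ¬ B.first x.1)
    (hy : B.CandOK y ∧ B.first y.1) (he : ∀ x ∈ I.examiners, A.ExaminerOK x ∧ ¬ A.first x.1)
    (he' : ∀ x ∈ I.examiners, B.ExaminerOK x ∧ ¬ B.first x.1) (hq : A.QuestionOK I.question)
    (hq' : B.QuestionOK I.question) : A.Flip B (husztiPetho.inst I) := by
  refine flip_setup fun V hV₁ hV₂ hV₃ hV₄ => .parL ?_
    ⟨guarded_examiners hV₁ he, guarded_authorities hV₁ hV₂ hq⟩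
    ⟨guarded_examiners hV₃ he', guarded_authorities hV₃ hV₄ hq'⟩
  rw [hI]
  exact flip_parList (guarded_start hx.1.1 hx.2 (candidate_eq hx.1.1 hx.1.2.1 hx.1.2.2))
    (guarded_start hx'.1.1 hx'.2 (candidate_eq hx'.1.1 hx'.1.2.1 hx'.1.2.2))
    (flip_start hy.1.1 hy.2 (candidate_eq hy.1.1 hy.1.2.1 hy.1.2.2))

theorem flip_examiner {I : Instance} {x y : ℕ × Marking} (hI : I.examiners = [x, y])
    (hx : A.ExaminerOK x ∧ ¬ A.first x.1) (hx' : B.ExaminerOK x ∧ ¬ B.first x.1)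
    (hy : B.ExaminerOK y ∧ B.first y.1) (hc : ∀ x ∈ I.cands, A.CandOK x ∧ ¬ A.first x.1)
    (hc' : ∀ x ∈ I.cands, B.CandOK x ∧ ¬ B.first x.1) (hq : A.QuestionOK I.question)
    (hq' : B.QuestionOK I.question) : A.Flip B (husztiPetho.inst I) := by
  refine flip_setup fun V hV₁ hV₂ hV₃ hV₄ => .parR (guarded_cands hc) (guarded_cands hc')
    (.parL ?_ (guarded_authorities hV₁ hV₂ hq) (guarded_authorities hV₃ hV₄ hq'))
  rw [hI]
  exact flip_parList (guarded_start hx.1.1 hx.2 (examiner_eq hV₁ hx.1.1 hx.1.2))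
    (guarded_start hx'.1.1 hx'.2 (examiner_eq hV₃ hx'.1.1 hx'.1.2))
    (flip_start hy.1.1 hy.2 (examiner_eq hV₃ hy.1.1 hy.1.2))

end Policy


open Term Proc

/-! ## Execution of scripts -/

/-- A transition, with the record of the events; the recipes of inputs satisfy the policy. -/
def EStep (A : Policy) (x y : Config × List Event) : Prop :=
  (∃ l, (∀ e, l ≠ .event e) ∧ A.Label l ∧ Step x.1 l y.1 ∧ y.2 = x.2) ∨
    ∃ e, Step x.1 (.event e) y.1 ∧ y.2 = x.2 ++ [e]

/-- Executions, with the record of the events. -/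
abbrev Path (A : Policy) (x y : Config × List Event) : Prop := Relation.ReflTransGen (EStep A) x y

variable {A : Policy}

theorem Path.exec {x y : Config × List Event} (h : Path A x y) {c : Config}
    (hx : Exec c x.2 x.1) : Exec c y.2 y.1 := by
  induction h with
  | refl => exact hx
  | tail _ s ih =>
    rcases s with ⟨l, hl, -, s, e⟩ | ⟨e, s, e'⟩
    · rw [e]
      cases l with
      | tau => exact ih.tau s
      | event e => exact absurd rfl (hl e)
      | inp n M => exact ih.inp s
      | out n => exact ih.out s
    · rw [e']
      exact ih.event s

theorem Path.wstep {x y : Config × List Event} (h : Path A x y) :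
    Relation.ReflTransGen (WStep A) x.1 y.1 := by
  refine Relation.ReflTransGen.lift Prod.fst (fun x y s => ?_) _ _ h
  rcases s with ⟨l, hl, hA, s, -⟩ | ⟨e, s, -⟩
  · cases l with
    | tau => exact .inl (.inl s)
    | event e => exact absurd rfl (hl e)
    | inp n M => exact .inr ⟨.inp n M, trivial, hA, s⟩
    | out n => exact .inr ⟨.out n, trivial, hA, s⟩
  · exact .inl (.inr ⟨e, s⟩)

theorem Path.tau {c c' d : Config} {es es' : List Event} (s : Step c .tau c')
    (h : Path A (c', es) (d, es')) : Path A (c, es) (d, es') :=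
  .head (.inl ⟨.tau, by simp, trivial, s, rfl⟩ : EStep A (c, es) (c', es)) h

/-- The choices in the execution of a process: the recipe of an input, or the position of a table
entry. -/
inductive Choice : Type
  | msg (M : Term)
  | entry (k : ℕ)

/-- The tables with the given entries. -/
def tablesOf (T : List (Table × List Term)) : Table → Set (List Term) :=
  fun tb => {Ms | (tb, Ms) ∈ T}

theorem addEntry_tablesOf (T : List (Table × List Term)) (tb : Table) (Ms : List Term) :
    addEntry (tablesOf T) tb Ms = tablesOf (T ++ [(tb, Ms)]) := by
  ext tb' Ms'
  by_cases h : tb' = tb <;> simp [addEntry, tablesOf, h, or_comm]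

/-- The process can be executed with the given choices, until they are exhausted or a parallel
composition, a replication or an output on a private channel is reached, and what is then reached
satisfies `Φ`. The arguments are: the process, the choices, the number of restricted names, the
table entries, the frame and the events. -/
def Drive (A : Policy) : Proc → List Choice → ℕ → List (Table × List Term) → List Term →
    List Event → (Proc → List Proc → ℕ → List (Table × List Term) → List Term → List Event → Prop) →
    Prop
  | .nil, _, n, T, φ, es, Φ => Φ .nil [] n T φ es
  | .par P Q, _, n, T, φ, es, Φ => Φ P [Q] n T φ es
  | .repl P, _, n, T, φ, es, Φ => Φ (.repl P) [P] n T φ es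
  | .new P, cs, n, T, φ, es, Φ => Drive A (P (.priv n)) cs (n + 1) T φ es Φ
  | .newChan P, cs, n, T, φ, es, Φ => Drive A (P (.priv n)) cs (n + 1) T φ es Φ
  -- Scripts follow successful tests only.
  | .ite M N P _, cs, n, T, φ, es, Φ => M ≈ₑ N ∧ Drive A P cs n T φ es Φ
  | .inp u P, cs, n, T, φ, es, Φ =>
    match u, cs with
    | .pub _, .msg M :: cs =>
      (A.Recipe M ∧ M.IsRecipe φ.length) ∧ Drive A (P (M.subst φ)) cs n T φ es Φ
    | _, _ => Φ (.inp u P) [] n T φ es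
  | .out u M P, cs, n, T, φ, es, Φ =>
    match u with
    | .pub _ => Drive A P cs n T (φ ++ [M]) es Φ
    | .priv _ => Φ (.out u M P) [] n T φ es
  | .event e P, cs, n, T, φ, es, Φ => Drive A P cs n T φ (es ++ [e]) Φ
  | .insert tb Ms P, cs, n, T, φ, es, Φ => Drive A P cs n (T ++ [(tb, Ms)]) φ es Φ
  | .get tb pats P Q, cs, n, T, φ, es, Φ =>
    match cs with
    | .entry k :: cs =>
      match T[k]? with
      | some (tb', Ms) => (tb' = tb ∧ Matches pats Ms) ∧ Drive A (P Ms) cs n T φ es Φ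
      | none => False
    | _ => Φ (.get tb pats P Q) [] n T φ es

/-- The configuration with the given number of restricted names, table entries and frame. -/
def configOf (n : ℕ) (T : List (Table × List Term)) (φ : List Term) (S : Multiset Proc) : Config :=
  ⟨Finset.range n, tablesOf T, φ, S⟩

/-- Fresh names are taken in order, so the used ones always form an initial segment; the other
processes `R` stay idle. -/
theorem Drive.path {P : Proc} {cs : List Choice} {n : ℕ} {T : List (Table × List Term)}
    {φ : List Term} {es : List Event}
    {Φ : Proc → List Proc → ℕ → List (Table × List Term) → List Term → List Event → Prop}
    (h : Drive A P cs n T φ es Φ) : ∃ P' L n' T' φ' es', Φ P' L n' T' φ' es' ∧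
      ∀ R, Path A (configOf n T φ (P ::ₘ R), es) (configOf n' T' φ' (P' ::ₘ (L + R)), es') := by
  induction P generalizing cs n T φ es with
  | nil => exact ⟨_, [], n, T, φ, es, h, fun R => by rw [Multiset.coe_nil, zero_add]⟩
  | par P Q => exact ⟨_, [Q], n, T, φ, es, h, fun R => .tau .par .refl⟩
  | repl P =>
    refine ⟨_, [P], n, T, φ, es, h, fun R => .tau .repl ?_⟩
    rw [Multiset.cons_swap]
    exact .refl
  | new P ih =>
    obtain ⟨P', L, n', T', φ', es', h, h'⟩ := ih _ h
    refine ⟨P', L, n', T', φ', es', h, fun R => .tau (.new n (by simp)) ?_⟩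
    rw [← Finset.range_add_one]
    exact h' R
  | newChan P ih =>
    obtain ⟨P', L, n', T', φ', es', h, h'⟩ := ih _ h
    refine ⟨P', L, n', T', φ', es', h, fun R => .tau (.newChan n (by simp)) ?_⟩
    rw [← Finset.range_add_one]
    exact h' R
  | ite M N P Q ih =>
    obtain ⟨e, h⟩ := h
    obtain ⟨P', L, n', T', φ', es', h, h'⟩ := ih h
    exact ⟨P', L, n', T', φ', es', h, fun R => .tau (.iteTrue e) (h' R)⟩
  | inp u P ih =>
    have halt : Φ (.inp u P) [] n T φ es → ∃ P' L n' T' φ' es', Φ P' L n' T' φ' es' ∧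
      ∀ R, Path A (configOf n T φ (.inp u P ::ₘ R), es)
        (configOf n' T' φ' (P' ::ₘ (L + R)), es') := fun h =>
      ⟨_, [], n, T, φ, es, h, fun R => by rw [Multiset.coe_nil, zero_add]⟩
    obtain ch | ch := u
    · obtain _ | ⟨M | k, cs⟩ := cs
      · exact halt h
      · obtain ⟨⟨hM, hM'⟩, h⟩ := h
        obtain ⟨P', L, n', T', φ', es', h, h'⟩ := ih _ h
        exact ⟨P', L, n', T', φ', es', h, fun R =>
          .head (b := (_, es)) (.inl ⟨.inp ch M, by simp, hM, .inp ch M hM', rfl⟩) (h' R)⟩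
      · exact halt h
    · exact halt h
  | out u M P ih =>
    obtain ch | ch := u
    · obtain ⟨P', L, n', T', φ', es', h, h'⟩ := ih h
      exact ⟨P', L, n', T', φ', es', h, fun R =>
        .head (b := (_, es)) (.inl ⟨.out ch, by simp, trivial, .out ch, rfl⟩) (h' R)⟩
    · exact ⟨_, [], n, T, φ, es, h, fun R => by rw [Multiset.coe_nil, zero_add]⟩
  | event e P ih =>
    obtain ⟨P', L, n', T', φ', es', h, h'⟩ := ih h
    exact ⟨P', L, n', T', φ', es', h, fun R => .head (b := (_, es ++ [e])) (.inr ⟨e, .event, rfl⟩) (h' R)⟩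
  | insert tb Ms P ih =>
    obtain ⟨P', L, n', T', φ', es', h, h'⟩ := ih h
    refine ⟨P', L, n', T', φ', es', h, fun R => .tau .insert ?_⟩
    rw [addEntry_tablesOf]
    exact h' R
  | get tb pats P Q ih =>
    have halt : Φ (.get tb pats P Q) [] n T φ es → ∃ P' L n' T' φ' es', Φ P' L n' T' φ' es' ∧
      ∀ R, Path A (configOf n T φ (.get tb pats P Q ::ₘ R), es)
        (configOf n' T' φ' (P' ::ₘ (L + R)), es') := fun h =>
      ⟨_, [], n, T, φ, es, h, fun R => by rw [Multiset.coe_nil, zero_add]⟩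
    obtain _ | ⟨M | k, cs⟩ := cs
    · exact halt h
    · exact halt h
    · simp only [Drive] at h
      rcases hk : T[k]? with _ | ⟨tb', Ms⟩
      · rw [hk] at h; exact h.elim
      · rw [hk] at h
        obtain ⟨⟨rfl, hm⟩, h⟩ := h
        obtain ⟨P', L, n', T', φ', es', h, h'⟩ := ih _ h
        exact ⟨P', L, n', T', φ', es', h, fun R =>
          .tau (.getSome Ms (List.mem_of_getElem? hk) hm) (h' R)⟩

/-- The moves of a script: the execution of the `i`-th process with some choices, and a
communication of its output to the `j`-th of the other processes. -/
inductive Move : Type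
  | go (i : ℕ) (cs : List Choice)
  | comm (i j : ℕ)

/-- The script can be executed, and what is then reached satisfies `Φ`. -/
def Run (A : Policy)
    (Φ : List Proc → ℕ → List (Table × List Term) → List Term → List Event → Prop) :
    List Move → List Proc → ℕ → List (Table × List Term) → List Term → List Event → Prop
  | [], L, n, T, φ, es => Φ L n T φ es
  | .go i cs :: as, L, n, T, φ, es =>
    match L[i]? with
    | some P => Drive A P cs n T φ es fun P' L' => Run A Φ as (L.set i P' ++ L')
    | none => False
  | .comm i j :: as, L, n, T, φ, es =>
    match L[i]?, (L.eraseIdx i)[j]? with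
    | some (.out u M P), some (.inp v Q) =>
      u = v ∧ Run A Φ as ((L.eraseIdx i).set j (Q M) ++ [P]) n T φ es
    | _, _ => False

/-! ### Introduction rules for scripts, with the next state given by an equation to be simplified -/

section Steps

variable {Φ : Proc → List Proc → ℕ → List (Table × List Term) → List Term → List Event → Prop}
  {P Q : Proc} {cs : List Choice} {n n' : ℕ} {T T' : List (Table × List Term)} {φ φ' : List Term}
  {es es' : List Event}

theorem Drive.nil (h : Φ .nil [] n T φ es) : Drive A .nil cs n T φ es Φ := h

theorem Drive.par (h : Φ P [Q] n T φ es) : Drive A (.par P Q) cs n T φ es Φ := h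

theorem Drive.repl (h : Φ (.repl P) [P] n T φ es) : Drive A (.repl P) cs n T φ es Φ := h

theorem Drive.new {P : Term → Proc} (hn : n + 1 = n') (h : Drive A (P (.priv n)) cs n' T φ es Φ) :
    Drive A (.new P) cs n T φ es Φ := by
  subst hn; exact h

theorem Drive.newChan {P : Chan → Proc} (hn : n + 1 = n')
    (h : Drive A (P (.priv n)) cs n' T φ es Φ) : Drive A (.newChan P) cs n T φ es Φ := by
  subst hn; exact h

theorem Drive.ite {M N : Term} (e : M ≈ₑ N) (h : Drive A P cs n T φ es Φ) :
    Drive A (.ite M N P Q) cs n T φ es Φ := ⟨e, h⟩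

theorem Drive.inp {c : ℕ} {M N : Term} {P : Term → Proc} (hN : M.subst φ = N) (hM : A.Recipe M)
    (hM' : M.IsRecipe φ.length) (h : Drive A (P N) cs n T φ es Φ) :
    Drive A (.inp (.pub c) P) (.msg M :: cs) n T φ es Φ := by
  subst hN; exact ⟨⟨hM, hM'⟩, h⟩

theorem Drive.inp_halt {u : Chan} {P : Term → Proc} (h : Φ (.inp u P) [] n T φ es) :
    Drive A (.inp u P) [] n T φ es Φ := by
  cases u <;> exact h

theorem Drive.out {c : ℕ} {M : Term} (hφ : φ ++ [M] = φ') (h : Drive A P cs n T φ' es Φ) :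
    Drive A (.out (.pub c) M P) cs n T φ es Φ := by
  subst hφ; exact h

theorem Drive.out_halt {c : ℕ} {M : Term} (h : Φ (.out (.priv c) M P) [] n T φ es) :
    Drive A (.out (.priv c) M P) cs n T φ es Φ := h

theorem Drive.event {e : Event} (he : es ++ [e] = es') (h : Drive A P cs n T φ es' Φ) :
    Drive A (.event e P) cs n T φ es Φ := by
  subst he; exact h

theorem Drive.insert {tb : Table} {Ms : List Term} (hT : T ++ [(tb, Ms)] = T')
    (h : Drive A P cs n T' φ es Φ) : Drive A (.insert tb Ms P) cs n T φ es Φ := by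
  subst hT; exact h

theorem Drive.get {tb : Table} {k : ℕ} {pats : List (Option Term)} {Ms : List Term}
    {P : List Term → Proc} (hk : T[k]? = some (tb, Ms)) (hm : Matches pats Ms)
    (h : Drive A (P Ms) cs n T φ es Φ) : Drive A (.get tb pats P Q) (.entry k :: cs) n T φ es Φ := by
  simp only [Drive, hk]
  exact ⟨⟨trivial, hm⟩, h⟩

theorem Drive.get_halt {tb : Table} {pats : List (Option Term)} {P : List Term → Proc}
    (h : Φ (.get tb pats P Q) [] n T φ es) : Drive A (.get tb pats P Q) [] n T φ es Φ := h

theorem Run.nil {Φ : List Proc → ℕ → List (Table × List Term) → List Term → List Event → Prop}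
    {L : List Proc} (h : Φ L n T φ es) : Run A Φ [] L n T φ es := h

theorem Run.go {Φ : List Proc → ℕ → List (Table × List Term) → List Term → List Event → Prop}
    {i : ℕ} {as : List Move} {L : List Proc} (hi : L[i]? = some P)
    (h : Drive A P cs n T φ es fun P' L' => Run A Φ as (L.set i P' ++ L')) :
    Run A Φ (.go i cs :: as) L n T φ es := by
  simp only [Run, hi]
  exact h

theorem Run.comm {Φ : List Proc → ℕ → List (Table × List Term) → List Term → List Event → Prop}
    {i j : ℕ} {as : List Move} {L : List Proc} {u : Chan} {M : Term} {Q : Term → Proc}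
    (hi : L[i]? = some (.out u M P)) (hj : (L.eraseIdx i)[j]? = some (.inp u Q))
    (h : Run A Φ as ((L.eraseIdx i).set j (Q M) ++ [P]) n T φ es) :
    Run A Φ (.comm i j :: as) L n T φ es := by
  simp only [Run, hi, hj]
  exact ⟨trivial, h⟩

end Steps

/-! ### From scripts to transitions -/

theorem coe_eq_cons {L : List Proc} {i : ℕ} {P : Proc} (h : L[i]? = some P) :
    (L : Multiset Proc) = P ::ₘ (L.eraseIdx i : Multiset Proc) := by
  obtain ⟨hi, rfl⟩ := List.getElem?_eq_some_iff.1 h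
  exact Multiset.coe_eq_coe.2 (List.getElem_cons_eraseIdx_perm hi).symm

theorem coe_set {L : List Proc} {i : ℕ} {P : Proc} (h : L[i]? = some P) (Q : Proc) :
    (L.set i Q : Multiset Proc) = Q ::ₘ (L.eraseIdx i : Multiset Proc) := by
  obtain ⟨hi, rfl⟩ := List.getElem?_eq_some_iff.1 h
  exact Multiset.coe_eq_coe.2 (List.set_perm_cons_eraseIdx hi Q)

theorem Run.path {Φ : List Proc → ℕ → List (Table × List Term) → List Term → List Event → Prop}
    {as : List Move} {L : List Proc} {n : ℕ} {T : List (Table × List Term)}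
    {φ : List Term} {es : List Event} (h : Run A Φ as L n T φ es) :
    ∃ L' n' T' φ' es', Φ L' n' T' φ' es' ∧
      Path A (configOf n T φ L, es) (configOf n' T' φ' L', es') := by
  induction as generalizing L n T φ es with
  | nil => exact ⟨L, n, T, φ, es, h, .refl⟩
  | cons a as ih =>
    obtain ⟨i, cs⟩ | ⟨i, j⟩ := a
    · simp only [Run] at h
      rcases hi : L[i]? with _ | P
      · rw [hi] at h; exact h.elim
      rw [hi] at h
      obtain ⟨P', L', n', T', φ', es', h, h'⟩ := Drive.path h
      obtain ⟨L'', n'', T'', φ'', es'', h, h''⟩ := ih h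
      refine ⟨L'', n'', T'', φ'', es'', h, Relation.ReflTransGen.trans ?_ h''⟩
      have := h' (L.eraseIdx i)
      rw [← Multiset.coe_add, coe_set hi, coe_eq_cons hi, Multiset.cons_add, add_comm (_ : Multiset Proc)]
      exact this
    · simp only [Run] at h
      split at h
      · rename_i u M P v Q hi hj
        obtain ⟨rfl, h⟩ := h
        obtain ⟨L'', n'', T'', φ'', es'', h, h''⟩ := ih h
        refine ⟨L'', n'', T'', φ'', es'', h, ?_⟩
        rw [← Multiset.coe_add, coe_set hj, Multiset.cons_add, Multiset.coe_singleton, add_comm,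
          Multiset.singleton_add, Multiset.cons_swap] at h''
        rw [coe_eq_cons hi, coe_eq_cons hj]
        exact .tau .comm h''
      · exact h.elim

theorem configOf_init (P : Proc) : configOf 0 [] [] ([P] : List Proc) = Config.init P := by
  have : tablesOf [] = fun _ => ∅ := by ext; simp [tablesOf]
  simp [configOf, Config.init, this]

theorem Run.exec_init
    {Φ : List Proc → ℕ → List (Table × List Term) → List Term → List Event → Prop}
    {as : List Move} {P : Proc} (h : Run A Φ as [P] 0 [] [] []) :
    ∃ es B, Exec (Config.init P) es B ∧ ∃ L n T φ, Φ L n T φ es := by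
  obtain ⟨L, n, T, φ, es, h, h'⟩ := h.path
  rw [configOf_init] at h'
  exact ⟨es, _, Path.exec h' (.refl _), L, n, T, φ, h⟩

/-- The `i`-th message of a frame is not hidden. -/
def Reveals (A : Policy) (i : ℕ) (φ : List Term) : Prop := ∃ M, φ[i]? = some M ∧ ¬ A.Hidden M

theorem Reveals.exists_mem {i : ℕ} {φ : List Term} (h : Reveals A i φ) :
    ∃ M ∈ φ, ¬ A.Hidden M := by
  obtain ⟨M, hi, hM⟩ := h
  exact ⟨M, List.mem_of_getElem? hi, hM⟩

/-- A script that shows that a process with only hidden outputs is not bisimilar to another one. -/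
theorem not_bisimilar_of_run {P Q : Proc} (hQ : A.Guarded Q) {as : List Move} {i : ℕ}
    (h : Run A (fun _ _ _ φ _ => Reveals A i φ) as [P] 0 [] [] []) : ¬ Bisimilar P Q := by
  obtain ⟨L, n, T, φ, es, hi, h⟩ := h.path
  rw [configOf_init] at h
  exact not_bisimilar_of_guarded hQ (Path.wstep h) hi.exists_mem

/-- Scripts that show that a process in which a principal has to start early is not bisimilar to
another one. -/
theorem not_bisimilar_of_run_flip {B : Policy} (hAB : A.Stricter B) {P Q : Proc}
    (hQ : A.Flip B Q) {as as' : List Move} {i j : ℕ}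
    (h : Run A (fun L n T φ es => Reveals A i φ ∧ (∀ M ∈ φ, B.Hidden M) ∧
      Run A (fun _ _ _ φ _ => Reveals B j φ) as' L n T φ es) as [P] 0 [] [] []) :
    ¬ Bisimilar P Q := by
  obtain ⟨L, n, T, φ, es, ⟨hi, hB, h'⟩, h⟩ := h.path
  obtain ⟨L', n', T', φ', es', hj, h'⟩ := h'.path
  rw [configOf_init] at h
  exact not_bisimilar_of_flip hAB hQ (Path.wstep h) hi.exists_mem hB (Path.wstep h') hj.exists_mem

/-! ### Recipes under a policy, by head symbol -/

namespace Policy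

theorem recipe_var (i : ℕ) : A.Recipe (var i) ↔ True := iff_true_intro .var

theorem recipe_pub (n : ℕ) : A.Recipe (pub n) ↔ A.name n := ⟨fun | .pub h => h, .pub⟩

theorem recipe_g : A.Recipe g ↔ True := iff_true_intro .g

theorem recipe_unit : A.Recipe unit ↔ True := iff_true_intro .unit

theorem recipe_pair (M N : Term) : A.Recipe (pair M N) ↔ A.Recipe M ∧ A.Recipe N :=
  ⟨fun | .pair h h' => ⟨h, h'⟩, fun h => .pair h.1 h.2⟩

theorem recipe_fst (M : Term) : A.Recipe (fst M) ↔ A.Recipe M := ⟨fun | .fst h => h, .fst⟩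

theorem recipe_snd (M : Term) : A.Recipe (snd M) ↔ A.Recipe M := ⟨fun | .snd h => h, .snd⟩

theorem recipe_exp (M N : Term) : A.Recipe (exp M N) ↔ A.Recipe M ∧ A.Recipe N :=
  ⟨fun | .exp h h' => ⟨h, h'⟩, fun h => .exp h.1 h.2⟩

theorem recipe_zkpProof2 (M N K : Term) :
    A.Recipe (zkpProof2 M N K) ↔ A.Recipe M ∧ A.Recipe N ∧ A.Recipe K :=
  ⟨fun | .zkpProof2 h h' h'' => ⟨h, h', h''⟩, fun h => .zkpProof2 h.1 h.2.1 h.2.2⟩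

end Policy


open Term Proc

/-! ## Attacks -/

theorem Term.mkCheckproof_of_eq {p p' t d e : Term} (h : d = mkExp t e) :
    mkCheckproof (xproof p p' t d e) p p' t d = tt := by
  rw [h, mkCheckproof_xproof]

theorem Term.tri_ne_pub (x y z : Term) (n : ℕ) : tri x y z ≠ pub n := by
  rw [← mkExp_exp]
  exact mkExp_ne_pub _ _ _

/-- The policy that forbids the names in `l`, the first components in `l₁` and the third components
in `l₂`, and allows to sign only `q`. -/
def Policy.hiding (l l₁ l₂ : List ℕ) (q : ℕ) (h : q ∉ l₁ := by decide) : Policy :=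
  ⟨(· ∉ l), (· ∈ l₁), (· ∈ l₂), (· = q), by rintro _ rfl; exact h⟩

/-- One candidate, and no examiner. -/
def candInstance : Instance := ⟨[(1, 2)], [], 3, []⟩

/-- One examiner, and no candidate. -/
def examinerInstance : Instance := ⟨[], [(1, mkMarking [] 2)], 4, []⟩

/-- One candidate and one examiner. -/
def pairInstance : Instance := ⟨[(1, 2)], [(3, mkMarking [] 4)], 5, []⟩

/-- The two candidates of the attack on anonymous marking. -/
def candsInstance : Instance := ⟨[(1, 3), (2, 4)], [], 5, []⟩

/-- The candidates and examiners of the attack on the anonymity of examiners. -/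
def examinersInstance : Instance :=
  ⟨[(1, 3), (2, 4)], [(5, mkMarking [] 7), (6, mkMarking [] 8)], 9, [(1, 5), (2, 6)]⟩

/-- The candidates and the examiner of the attack on the anonymity of marks. -/
def marksInstance : Instance :=
  ⟨[(1, 3), (2, 4)], [(5, mkMarking [(3, 6), (4, 7)] 8)], 9, [(1, 5), (2, 5)]⟩

/-- A test is distributed with an identifier that is not the one with which a test is marked. -/
def Event.Forged (k : ℕ) : Event → Prop
  | .distributed _ _ _ _ t _ => t.nf = .priv k
  | .marked _ _ _ t _ _ => t.nf ≠ .priv k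
  | _ => True

section Scripts

attribute [local simp] candInstance examinerInstance pairInstance candsInstance examinersInstance
  marksInstance ExamProtocol.inst setup husztiPetho modifiedHusztiPetho parList
  pubc Proc.recv Proc.cond Proc.lookup mkMarking Term.proj Term.tup Term.subst Term.IsRecipe Term.nf
  eqv_iff Term.tri_eq_iff tri_ne_pub Rot mkCheckproof_of_eq ModifiedHP.receipt Policy.recipe_var
  Policy.recipe_pub Policy.recipe_g Policy.recipe_unit Policy.recipe_pair Policy.recipe_fst
  Policy.recipe_snd Policy.recipe_exp Policy.recipe_zkpProof2 Matches FstIs ThdIs Policy.hiding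
  Policy.Hidden Reveals Event.Eqv Event.Forged Event.isMarked Event.isRegistered

attribute [local irreducible] Run Drive

open Choice Move

/-- In the scripts for swaps, the outer run shows a telling name before the waiting principal has
started, and the inner run then starts that principal. -/
theorem attacks :
    -- question indistinguishability
    Run (.hiding [] [1] [] 2) (fun _ _ _ φ _ => Reveals (.hiding [] [1] [] 2) 2 φ)
      [go 0 [], go 1 [], go 2 [], go 2 []]
      [(husztiPetho.inst ⟨[], [], 1, []⟩).prune Event.isRegistered] 0 [] [] [] ∧
    -- mark privacy
    Run (.hiding [] [2] [] 4) (fun _ _ _ φ _ => Reveals (.hiding [] [2] [] 4) 10 φ)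
      [go 0 [], go 1 [], go 2 [], go 3 [], go 1 [], go 2 [], go 3 [], go 6 [msg (var 2)],
        go 6 [], go 1 [msg (var 3)], go 8 [entry 0], go 1 [entry 1], go 8 [msg (var 6)],
        -- The examiner marks the unsigned test `(g, g)`, made up by the attacker, and sends the
        -- mark in clear.
        go 1 [msg (var 7)], go 1 [msg (var 2), msg (tup [g, g])]]
      [husztiPetho.inst examinerInstance] 0 [] [] [] ∧
    -- test authenticity
    Run (.hiding [] [] [] 4) (fun _ _ _ _ es => ∃ q a m t x h, es = [.marked q a m t x h])
      [go 0 [], go 1 [], go 2 [], go 3 [], go 1 [], go 2 [], go 3 [], go 6 [msg (var 2)],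
        go 6 [], go 1 [msg (var 3)], go 8 [entry 0], go 1 [entry 1], go 8 [msg (var 6)],
        go 1 [msg (var 7)], go 1 [msg (var 2), msg (tup [g, g])]]
      [husztiPetho.inst examinerInstance] 0 [] [] [] ∧
    -- anonymous marking
    Run (.hiding [] [2] [3] 5) (fun L n T φ es => Reveals (.hiding [] [2] [3] 5) 11 φ ∧
        (∀ M ∈ φ, (Policy.hiding [] [2] [] 5).Hidden M) ∧
        Run (.hiding [] [2] [3] 5) (fun _ _ _ φ _ => Reveals (.hiding [] [2] [] 5) 12 φ)
          [go 2 []] L n T φ es)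
      [go 0 [], go 0 [], go 2 [], go 1 [], go 4 [], go 5 [], go 4 [], go 5 [], go 7 [msg (var 2)],
        go 8 [], go 0 [msg (var 3)], go 9 [entry 0], go 6 [], go 10 [msg (var 5)],
        go 0 [entry 2, entry 3], go 9 [msg (var 7)], go 0 [msg (var 8), msg (var 2)]]
      [(husztiPetho.inst candsInstance).prune Event.isMarked] 0 [] [] [] ∧
    -- anonymous examiner
    Run (.hiding [] [6, 7] [] 9) (fun L n T φ es => Reveals (.hiding [] [6, 7] [] 9) 10 φ ∧
        (∀ M ∈ φ, (Policy.hiding [] [6] [] 9).Hidden M) ∧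
        Run (.hiding [] [6, 7] [] 9) (fun _ _ _ φ _ => Reveals (.hiding [] [6] [] 9) 11 φ)
          [go 3 []] L n T φ es)
      [go 0 [], go 1 [], go 1 [], go 3 [], go 2 [], go 5 [], go 2 [], go 5 [], go 7 [msg (var 2)],
        go 7 [], go 1 [msg (var 3)], go 9 [entry 0], go 1 [entry 1], go 9 [msg (var 6)],
        go 1 [msg (var 7)], go 1 [msg (var 2), msg (tup [g, g])]]
      [husztiPetho.inst examinersInstance] 0 [] [] [] ∧
    -- mark anonymity
    Run (.hiding [4] [2, 6] [] 9) (fun L n T φ es => Reveals (.hiding [4] [2, 6] [] 9) 10 φ ∧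
        (∀ M ∈ φ, (Policy.hiding [] [2] [] 9).Hidden M) ∧
        Run (.hiding [4] [2, 6] [] 9) (fun _ _ _ φ _ => Reveals (.hiding [] [2] [] 9) 11 φ)
          [go 2 []] L n T φ es)
      [go 0 [], go 0 [], go 2 [], go 1 [], go 1 [], go 4 [], go 6 [], go 4 [], go 6 [],
        go 8 [msg (var 2)], go 8 [], go 1 [msg (var 3)], go 10 [entry 0], go 1 [entry 1],
        go 10 [msg (var 6)], go 1 [msg (var 7)], go 1 [msg (var 2), msg (tup [g, pub 3])]]
      [husztiPetho.inst marksInstance] 0 [] [] [] ∧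
    -- test origin authentication and answer authenticity
    Run (.hiding [] [] [] 3) (fun _ _ _ _ es => ∃ c h q a, es = [.collected c h q a])
      [go 0 [], go 0 [], go 1 [], go 3 [], go 4 [], go 3 [], go 4 [], go 6 [msg (var 2)], go 7 [],
        go 0 [], go 8 [entry 0, msg (tup [g, g]),
          -- With `fst (var 3)` equal to `h`, the terms `p` and `p'` are `g` and `h`, each raised
          -- twice to the attacker's exponent `pub 0`; `p ^ s = p'` is an instance of the rotation.
          msg (tup [exp g (pub 0), exp (exp g (pub 0)) (pub 0),
            exp (exp (fst (var 3)) (pub 0)) (pub 0)]),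
          msg (zkpProof2 (exp g (pub 0)) (exp (exp g (pub 0)) (pub 0)) (pub 0)),
          msg (tup [exp g (pub 0), exp (exp g (pub 0)) (pub 0), g])]]
      [husztiPetho.inst candInstance] 0 [] [] [] ∧
    -- mark authenticity
    Run (.hiding [] [] [] 5) (fun _ _ _ _ es =>
        -- The name created for `eap` has number 9: two keys, two channels, the exam secret, the
        -- examiner's key and exponent, the candidate's key and the NET's exponent precede it.
        (∀ e ∈ es, e.Forged 9) ∧ ∃ c h m, es[5]? = some (.notified c h m))
      [go 0 [], go 0 [], go 1 [], go 1 [], go 3 [], go 5 [], go 3 [], go 5 [], go 7 [msg (var 2)],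
        go 7 [], go 8 [], go 1 [msg (var 3)], go 9 [entry 0], go 1 [entry 1], go 9 [msg (var 6)],
        go 1 [msg (var 7)], go 0 [msg (var 3)], go 10 [entry 3], go 6 [], go 11 [msg (var 11)],
        go 0 [entry 5, entry 6], go 10 [msg (var 13)], go 0 [msg (var 14)],
        go 10 [msg (var 15), msg (var 16)], go 0 [msg (var 17)], go 10 [msg (var 18), entry 2],
        -- The distributed answer is given to the examiner under the identifier `g`; the receipt of
        -- marking does not reveal the change.
        go 0 [msg (var 19)], go 1 [msg (var 2), msg (tup [g, fst (snd (var 20))])],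
        go 10 [entry 8, msg (var 21)], go 11 [msg (var 22)], go 10 [msg (var 23), entry 4],
        go 0 [entry 9, entry 8]]
      [husztiPetho.inst pairInstance] 0 [] [] [] ∧
    -- answer authenticity of the modified protocol
    Run (.hiding [] [] [] 3) (fun _ _ _ _ es =>
        ∃ p c h q a, es = [.registered p, .collected c h q a])
      [go 0 [], go 0 [], go 1 [], go 3 [], go 4 [], go 3 [], go 4 [], go 6 [msg (var 2)], go 7 [],
        go 0 [msg (var 3)], go 8 [entry 0], go 5 [], go 9 [], comm 8 8, go 9 [], go 8 [], comm 8 8,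
        go 0 [entry 2, entry 3], go 8 [msg (var 6)], go 0 [msg (var 7)],
        -- While the candidate still waits for the question, the attacker submits `g` under its `(r,
        -- p)`.
        go 8 [msg (var 8), msg (var 9), msg (tup [fst (var 8), fst (snd (var 8)), g])]]
      [modifiedHusztiPetho.inst candInstance] 0 [] [] [] := by
  -- The rules follow the syntax of processes; the remaining goals are equalities of normal forms,
  -- pattern matches and conditions on recipes.
  repeat' first
    | apply Run.go rfl
    | apply Run.comm rfl rfl
    | apply Run.nil
    | apply Drive.par
    | apply Drive.nil
    | apply Drive.repl
    | refine Drive.new rfl ?_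
    | refine Drive.newChan rfl ?_
    | refine Drive.ite (by simp; done) ?_
    | refine Drive.inp (by simp; rfl) (by simp) (by simp) ?_
    | apply Drive.inp_halt
    | refine Drive.out (by simp; rfl) ?_
    | apply Drive.out_halt
    | refine Drive.event (by simp; rfl) ?_
    | refine Drive.insert (by simp; rfl) ?_
    | refine Drive.get rfl (by simp) ?_
    | apply Drive.get_halt
    | apply And.intro
  all_goals simp

end Scripts

theorem Policy.marks_mkMarking {A : Policy} {l : List (ℕ × ℕ)} {m : ℕ} :
    A.Marks (mkMarking l m) ↔
      (∀ x ∈ l, ¬ A.name x.1 ∨ A.name x.2 ∧ ¬ A.first x.2) ∧ A.name m ∧ ¬ A.first m := by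
  simp only [Marks, mkMarking, List.forall_mem_map]
  simp

/-! ### The violated privacy requirements -/

namespace HusztiPetho

theorem not_questionIndistinguishability : ¬ husztiPetho.QuestionIndistinguishability := by
  intro h
  refine not_bisimilar_of_run (Policy.Guarded.prune ?_) attacks.1
    (h ⟨[], [], 0, []⟩ 1 2 (by simp [Instance.WF]) (by simp [Instance.PublicMarks]))
  exact Policy.guarded_inst (by simp) (by simp) (by simp [Policy.QuestionOK, Policy.hiding])

theorem not_markPrivacy : ¬ husztiPetho.MarkPrivacy := by
  intro h
  refine not_bisimilar_of_run ?_ attacks.2.1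
    (h ⟨[], [], 4, []⟩ 1 2 3 (by simp [Instance.WF]) (by simp [Instance.PublicMarks]))
  exact Policy.guarded_inst (by simp)
    (by simp [Policy.ExaminerOK, Policy.marks_mkMarking, Policy.hiding])
    (by simp [Policy.QuestionOK, Policy.hiding])

theorem not_anonymousMarking : ¬ husztiPetho.AnonymousMarking := by
  intro h
  refine not_bisimilar_of_run_flip (by constructor <;> simp [Policy.hiding])
    (Policy.Flip.prune ?_) attacks.2.2.2.1 (h ⟨[], [], 5, []⟩ 1 2 3 4 (by simp [Instance.WF])
      (by simp [Instance.PublicMarks]))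
  exact Policy.flip_cand rfl (by simp [Policy.CandOK, Policy.hiding])
    (by simp [Policy.CandOK, Policy.hiding]) (by simp [Policy.CandOK, Policy.hiding])
    (by simp) (by simp) (by simp [Policy.QuestionOK, Policy.hiding])
    (by simp [Policy.QuestionOK, Policy.hiding])

theorem not_anonymousExaminer : ¬ husztiPetho.AnonymousExaminer := by
  intro h
  refine not_bisimilar_of_run_flip (by constructor <;> simp [Policy.hiding]) ?_
    attacks.2.2.2.2.1 (h ⟨[], [], 9, []⟩ 1 2 3 4 5 6 7 8 (by simp [Instance.WF])
      (by simp [Instance.PublicMarks]))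
  exact Policy.flip_examiner rfl
    (by simp [Policy.ExaminerOK, Policy.marks_mkMarking, Policy.hiding])
    (by simp [Policy.ExaminerOK, Policy.marks_mkMarking, Policy.hiding])
    (by simp [Policy.ExaminerOK, Policy.marks_mkMarking, Policy.hiding])
    (by simp [Policy.CandOK, Policy.hiding]) (by simp [Policy.CandOK, Policy.hiding])
    (by simp [Policy.QuestionOK, Policy.hiding]) (by simp [Policy.QuestionOK, Policy.hiding])

theorem not_markAnonymity : ¬ husztiPetho.MarkAnonymity := by
  intro h
  refine not_bisimilar_of_run_flip (by constructor <;> simp [Policy.hiding]) ?_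
    attacks.2.2.2.2.2.1 (h ⟨[], [], 9, []⟩ 1 2 3 4 5 6 7 8 (by simp) (by simp [Instance.WF])
      (by simp [Instance.PublicMarks]))
  exact Policy.flip_cand rfl (by simp [Policy.CandOK, Policy.hiding])
    (by simp [Policy.CandOK, Policy.hiding]) (by simp [Policy.CandOK, Policy.hiding])
    (by simp [Policy.ExaminerOK, Policy.marks_mkMarking, Policy.hiding])
    (by simp [Policy.ExaminerOK, Policy.marks_mkMarking, Policy.hiding])
    (by simp [Policy.QuestionOK, Policy.hiding]) (by simp [Policy.QuestionOK, Policy.hiding])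

end HusztiPetho

theorem inst_mem_examProcs {P : ExamProtocol} {I : Instance} (h : I.WF) (h' : I.PublicMarks) :
    P.inst I ∈ P.ExamProcs := .inr ⟨I, h, h', rfl⟩

theorem candInstance_mem {P : ExamProtocol} : P.inst candInstance ∈ P.ExamProcs :=
  inst_mem_examProcs (by simp [Instance.WF, candInstance])
    (by simp [Instance.PublicMarks, candInstance])

/-- An event cannot have an earlier one if it is the only event. -/
theorem InjCorr.false_of_singleton {e : Event} {L : Event → Prop} {R : Event → Event → Prop}
    (h : InjCorr [e] L R) (he : L e) : False := by
  obtain ⟨f, -, h⟩ := h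
  exact absurd (h 0 e rfl he).1 (Nat.not_lt_zero _)

/-! ### The violated authentication requirements of the original protocol -/

namespace HusztiPetho

theorem not_answerAuthenticity : ¬ husztiPetho.AnswerAuthenticity := by
  intro h
  obtain ⟨es, B, hB, _, _, _, _, c, q, a, x, rfl⟩ := attacks.2.2.2.2.2.2.1.exec_init
  exact (h _ candInstance_mem _ _ hB).false_of_singleton ⟨c, q, a, x, rfl⟩

theorem not_testOriginAuthentication : ¬ husztiPetho.TestOriginAuthentication := by
  intro h
  obtain ⟨es, B, hB, _, _, _, _, c, q, a, x, rfl⟩ := attacks.2.2.2.2.2.2.1.exec_init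
  exact (h _ candInstance_mem _ _ hB).false_of_singleton ⟨c, q, a, x, rfl⟩

theorem not_testAuthenticity : ¬ husztiPetho.TestAuthenticity := by
  intro h
  obtain ⟨es, B, hB, _, _, _, _, q, a, m, t, x, y, rfl⟩ := attacks.2.2.1.exec_init
  have hI : husztiPetho.inst examinerInstance ∈ husztiPetho.ExamProcs :=
    inst_mem_examProcs (by simp [Instance.WF, examinerInstance]) (by
      simp only [Instance.PublicMarks, examinerInstance, List.mem_singleton, forall_eq]
      exact ⟨_, _, rfl⟩)
  obtain ⟨f, _, -, -, h⟩ := h _ hI _ _ hB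
  exact absurd (h 0 _ rfl ⟨q, a, m, t, x, y, rfl⟩).1 (Nat.not_lt_zero _)

theorem not_markAuthenticity : ¬ husztiPetho.MarkAuthenticity := by
  intro h
  obtain ⟨es, B, hB, _, _, _, _, hes, c, x, m, hn⟩ := attacks.2.2.2.2.2.2.2.1.exec_init
  have hI : husztiPetho.inst pairInstance ∈ husztiPetho.ExamProcs :=
    inst_mem_examProcs (by simp [Instance.WF, pairInstance]) (by
      simp only [Instance.PublicMarks, pairInstance, List.mem_singleton, forall_eq]
      exact ⟨_, _, rfl⟩)
  obtain ⟨f₁, f₂, -, -, h⟩ := h _ hI _ _ hB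
  obtain ⟨-, -, e₁, e₂, h₁, h₂, c, h, m, q, a, t, x, -, h₃, h₄⟩ := h 5 _ hn ⟨c, x, m, rfl⟩
  have h₁ := hes _ (List.mem_of_getElem? h₁)
  have h₂ := hes _ (List.mem_of_getElem? h₂)
  cases e₁ <;> simp only [Event.Eqv] at h₃
  cases e₂ <;> simp only [Event.Eqv] at h₄
  -- A common identifier would be `priv 9` as that of the distributed test, and different from it as
  -- that of the marked one.
  exact h₂ (h₄.2.2.2.1.nf_eq.trans (h₃.2.2.2.2.1.nf_eq.symm.trans h₁))

end HusztiPetho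

theorem ModifiedHP.not_answerAuthenticity : ¬ modifiedHusztiPetho.AnswerAuthenticity := by
  intro h
  obtain ⟨es, B, hB, _, _, _, _, p, c, q, a, x, rfl⟩ := attacks.2.2.2.2.2.2.2.2.exec_init
  obtain ⟨f, -, h⟩ := h _ candInstance_mem _ _ hB
  obtain ⟨hf, e', he', c, q, a, x, -, h⟩ := h 1 _ rfl ⟨c, q, a, x, rfl⟩
  -- The only event before the collection is `registered`, which is no submission.
  obtain hf : f 1 = 0 := by omega
  rw [hf] at he'
  obtain rfl := Option.some.inj he'
  exact h

end ExamPi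

theorem mainTheorem5 :
    (ExamPi.husztiPetho.CandidateAuthorisation ∧
      ¬ ExamPi.husztiPetho.AnswerAuthenticity ∧
      ¬ ExamPi.husztiPetho.TestOriginAuthentication ∧
      ¬ ExamPi.husztiPetho.TestAuthenticity ∧
      ¬ ExamPi.husztiPetho.MarkAuthenticity ∧
      ¬ ExamPi.husztiPetho.QuestionIndistinguishability ∧
      ¬ ExamPi.husztiPetho.AnonymousMarking ∧
      ¬ ExamPi.husztiPetho.AnonymousExaminer ∧
      ¬ ExamPi.husztiPetho.MarkPrivacy ∧
      ¬ ExamPi.husztiPetho.MarkAnonymity) ∧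
    (ExamPi.modifiedHusztiPetho.CandidateAuthorisation ∧
      ExamPi.modifiedHusztiPetho.TestOriginAuthentication ∧
      ExamPi.modifiedHusztiPetho.TestAuthenticity ∧
      ExamPi.modifiedHusztiPetho.MarkAuthenticity ∧
      ¬ ExamPi.modifiedHusztiPetho.AnswerAuthenticity) := by
  exact ⟨⟨ExamPi.HusztiPetho.rolesOK.candidateAuthorisation,
    ExamPi.HusztiPetho.not_answerAuthenticity, ExamPi.HusztiPetho.not_testOriginAuthentication,
    ExamPi.HusztiPetho.not_testAuthenticity, ExamPi.HusztiPetho.not_markAuthenticity,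
    ExamPi.HusztiPetho.not_questionIndistinguishability, ExamPi.HusztiPetho.not_anonymousMarking,
    ExamPi.HusztiPetho.not_anonymousExaminer, ExamPi.HusztiPetho.not_markPrivacy,
    ExamPi.HusztiPetho.not_markAnonymity⟩,
    ExamPi.ModifiedHP.rolesOK.candidateAuthorisation,
    ExamPi.ModifiedHP.rolesOK.testOriginAuthentication,
    ExamPi.ModifiedHP.rolesOK.testAuthenticity, ExamPi.ModifiedHP.rolesOK.markAuthenticity,
    ExamPi.ModifiedHP.not_answerAuthenticity⟩
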